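/- **Conventions.** For a commutative ring $R$ let $\mathbf D(R)$ be the unbounded derived category of $R$-modules, with tensor product $\otimes^{\mathbf L}_R$ and full subcategory $\mathbf D(R)^c$ of compact objects (those $c$ for which $\mathrm{Hom}(c,-)$ preserves coproducts). A *thick* subcategory is a full triangulated subcategory closed under direct summands. A *definable $\otimes$-ideal* of $\mathbf D(R)$ is a thick subcategory $\mathcal D$ such that $X\otimes^{\mathbf L}_R Y\in\mathcal D$ for all $X\in\mathbf D(R)$, $Y\in\mathcal D$, and such that $\mathcal D=\{X \mid \mathrm{Hom}(f,X)=0\ \forall f\in\Phi\}$ for some set $\Phi$ of morphisms of $\mathbf D(R)^c$. It is *compactly generated* if $\mathcal D=\{X \mid \mathrm{Hom}(s,X[i])=0\ \forall s\in\mathcal S,\ i\in\mathbb Z\}$ for some thick $\otimes$-ideal $\mathcal S$ of $\mathbf D(R)^c$, and *closed under cohomology* if $X\in\mathcal D$ implies $\bigoplus_{n}H^n(X)\in\mathcal D$. $\mathbf D(R)$ satisfies (TC) if every definable $\otimes$-ideal is compactly generated, and (RTC) if every definable $\otimes$-ideal closed under cohomology is compactly generated. A ring epimorphism $R\to S$ is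 *pseudoflat* if $\mathrm{Tor}_1^R(S,S)=0$. A local ring $(R,\mathfrak m)$ is *separated* if $\bigcap_n\mathfrak m^n=0$. **Statement.** Let $B\subseteq\mathbb F_2[[x]]$ be the set of all power series $\sum_{i\ge1}x^{2^{n_i}}$ with $(n_i)_{i\ge 1}$ a strictly increasing sequence of non-negative integers. (a) There is $\alpha_0\in B$ which is transcendental over $\mathbb F_2[x]$. (b) For every $\alpha_0\in B$ there is a unique sequence $(\alpha_n)_{n\ge0}$ in $B$ starting with $\alpha_0$ such that $\alpha_{n+1}^2=\alpha_n+f_n$ for all $n\ge 0$, where $f_n=x$ if the coefficient of $x$ in $\alpha_n$ is non-zero and $f_n=0$ otherwise. (c) Let $(\alpha_n)$ be any sequence as in (b) whose first term $\alpha_0$ is transcendental over $\mathbb F_2[x]$. Let $A=\mathbb F_2[x,\alpha_n:n\ge0]\subseteq\mathbb F_2[[x]]$ be the subalgebra generated by $x$ and all the $\alpha_n$. The ideal $\mathfrak p = A\cap x\,\mathbb F_2[[x]]$ of $A$ is equal to $(x,\alpha_n:n\ge0)$ and is maximal. Put $R=A_{\mathfrak p}$. Then: 1. the inclusion $A\subseteq\mathbb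 F_2[[x]]$ extends to an injective local ring homomorphism $R\to\mathbb F_2[[x]]$; 2. $R$ is a separated local integral domain; 3. $R/(x)$ is a local ring whose maximal ideal is non-zero and idempotent; 4. $\mathbf D(R)$ fails (RTC), and $\mathbf D(R)$ fails (TC); 5. there are a commutative local ring $S$ and a local ring homomorphism $R\to S$ which is a pseudoflat ring epimorphism, is not flat, and is not surjective. -/

import Mathlib

open CategoryTheory CategoryTheory.Limits
open scoped PowerSeries Polynomial ZeroObject

noncomputable section

namespace TelescopeExample

universe u

/-! ### The derived category of a commutative ring and the two telescope properties -/

section Telescope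

variable (R : Type u) [CommRing R]

/-- Unbounded cochain complexes of `R`-modules. -/
abbrev Cpx := CochainComplex (ModuleCat.{u} R) ℤ

/-- The localized category of complexes up to quasi-isomorphism, as constructed in Mathlib. -/
instance instHasDerivedCategoryModule : HasDerivedCategory.{u + 1} (ModuleCat.{u} R) :=
  HasDerivedCategory.standard _

/-- The unbounded derived category `D(R)`. -/
abbrev DMod := DerivedCategory.{u + 1} (ModuleCat.{u} R)

variable {R}

/-- A complex `K` is K-flat if `K ⊗ A` is acyclic for every acyclic complex `A`. -/
def IsKFlat (K : Cpx R) : Prop :=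
  ∀ A : Cpx R, HomologicalComplex.Acyclic A →
    HomologicalComplex.Acyclic (HomologicalComplex.tensorObj K A)

/-- `Z` is (isomorphic to) the derived tensor product `X ⊗ᴸ Y`: the tensor product of complexes
`K ⊗ L`, where `K` is a K-flat complex representing `X` and `L` is a complex representing `Y`. -/
def IsDerivedTensor (X Y Z : DMod R) : Prop :=
  ∃ K L : Cpx R, IsKFlat K ∧
    Nonempty (DerivedCategory.Q.obj K ≅ X) ∧
    Nonempty (DerivedCategory.Q.obj L ≅ Y) ∧
    Nonempty (DerivedCategory.Q.obj (HomologicalComplex.tensorObj K L) ≅ Z)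

/-- Compact objects of `D(R)`: `Hom(X, -)` preserves all (small) coproducts. -/
def IsCompactObj (X : DMod R) : Prop :=
  ∀ J : Type u,
    PreservesColimitsOfShape (Discrete J) (preadditiveCoyoneda.obj (Opposite.op X))

/-- A thick subcategory: a full triangulated subcategory closed under direct summands
(in particular closed under isomorphisms). -/
def IsThick (P : ObjectProperty (DMod R)) : Prop :=
  P.IsTriangulated ∧ P.IsStableUnderRetracts

/-- A definable subcategory of `D(R)`: the objects `X` with `Hom(f, X) = 0` for all `f` in a set
of morphisms between compact objects. -/
def IsDefinable (P : ObjectProperty (DMod R)) : Prop :=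
  ∃ (ι : Type u) (A B : ι → DMod R) (φ : ∀ i, A i ⟶ B i),
    (∀ i, IsCompactObj (A i) ∧ IsCompactObj (B i)) ∧
    ∀ X : DMod R, P X ↔ ∀ (i : ι) (g : B i ⟶ X), φ i ≫ g = 0

/-- A definable `⊗`-ideal of `D(R)`: a thick `⊗`-ideal which is a definable subcategory. -/
structure IsDefinableTensorIdeal (P : ObjectProperty (DMod R)) : Prop where
  thick : IsThick P
  tensor : ∀ X Y Z : DMod R, P Y → IsDerivedTensor X Y Z → P Z
  definable : IsDefinable P

/-- A thick `⊗`-ideal of the category of compact objects of `D(R)`. -/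
structure IsThickTensorIdealOfCompacts (S : ObjectProperty (DMod R)) : Prop where
  compact : ∀ X : DMod R, S X → IsCompactObj X
  thick : IsThick S
  tensor : ∀ X Y Z : DMod R, IsCompactObj X → S Y → IsDerivedTensor X Y Z → S Z

/-- `P` is compactly generated: `P = Sᗮ` for a thick `⊗`-ideal `S` of compact objects, where
`Sᗮ` consists of the `X` with `Hom(s, X⟦i⟧) = 0` for all `s` in `S` and all integers `i`. -/
def IsCompactlyGeneratedIdeal (P : ObjectProperty (DMod R)) : Prop :=
  ∃ S : ObjectProperty (DMod R), IsThickTensorIdealOfCompacts S ∧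
    ∀ X : DMod R, P X ↔ ∀ s : DMod R, S s → ∀ (i : ℤ) (f : s ⟶ X⟦i⟧), f = 0

/-- `P` is closed under cohomology: if `X` is in `P`, then so is the module `⨁ₙ Hⁿ(X)`, viewed as
a complex concentrated in degree `0`. -/
def IsClosedUnderCohomology (P : ObjectProperty (DMod R)) : Prop :=
  ∀ X : DMod R, P X →
    P ((DerivedCategory.singleFunctor (ModuleCat.{u} R) 0).obj
      (∐ fun n : ℤ => (DerivedCategory.homologyFunctor (ModuleCat.{u} R) n).obj X))

variable (R)

/-- The Telescope Conjecture (TC) for `D(R)`. -/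
def SatisfiesTC : Prop :=
  ∀ P : ObjectProperty (DMod R), IsDefinableTensorIdeal P → IsCompactlyGeneratedIdeal P

/-- The Restricted Telescope Conjecture (RTC) for `D(R)`. -/
def SatisfiesRTC : Prop :=
  ∀ P : ObjectProperty (DMod R), IsDefinableTensorIdeal P → IsClosedUnderCohomology P →
    IsCompactlyGeneratedIdeal P

/-- `R → S` is a pseudoflat ring epimorphism: an epimorphism in the category of (not necessarily
commutative) rings such that `Tor₁ᴿ(S, S) = 0`. -/
structure IsPseudoflatEpi (S : Type u) [CommRing S] [Algebra R S] : Prop where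
  epi : Epi (RingCat.ofHom (algebraMap R S))
  tor : IsZero (((Tor (ModuleCat.{u} R) 1).obj (ModuleCat.of R S)).obj (ModuleCat.of R S))

end Telescope

/-! ### The ring -/

/-- The power series over the two element field of the form `∑ᵢ x ^ (2 ^ nᵢ)` for a strictly
increasing infinite sequence `(nᵢ)` of natural numbers. -/
def sparseSeries : Set (ZMod 2)⟦X⟧ :=
  {a | ∃ n : ℕ → ℕ, StrictMono n ∧
    ∀ k : ℕ, ((∃ i, k = 2 ^ n i) → PowerSeries.coeff k a = 1) ∧
      ((¬ ∃ i, k = 2 ^ n i) → PowerSeries.coeff k a = 0)}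

open Classical in
/-- A sequence `α₀, α₁, …` of such series with `αₙ₊₁² = αₙ + fₙ`, where `fₙ = x` if `αₙ` has a
non-zero linear term and `fₙ = 0` otherwise. -/
structure IsRootSequence (α : ℕ → (ZMod 2)⟦X⟧) : Prop where
  mem : ∀ n, α n ∈ sparseSeries
  sq : ∀ n, α (n + 1) ^ 2 =
    α n + (if PowerSeries.coeff 1 (α n) ≠ 0 then PowerSeries.X else 0)

variable (α : ℕ → (ZMod 2)⟦X⟧)

/-- The subalgebra `𝔽₂[x, αₙ : n ≥ 0]` of `𝔽₂⟦x⟧`. -/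
abbrev PolyRing : Subalgebra (ZMod 2) (ZMod 2)⟦X⟧ :=
  Algebra.adjoin (ZMod 2) (insert PowerSeries.X (Set.range α))

/-- The element `x` of `𝔽₂[x, αₙ : n ≥ 0]`. -/
def xElt : PolyRing α :=
  ⟨PowerSeries.X, Algebra.subset_adjoin (Set.mem_insert _ _)⟩

/-- The element `αₙ` of `𝔽₂[x, αₙ : n ≥ 0]`. -/
def rootElt (n : ℕ) : PolyRing α :=
  ⟨α n, Algebra.subset_adjoin (Set.mem_insert_of_mem _ (Set.mem_range_self n))⟩

/-- The intersection of the maximal ideal `(x)` of `𝔽₂⟦x⟧` with `𝔽₂[x, αₙ : n ≥ 0]`. -/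
def centerIdeal : Ideal (PolyRing α) :=
  (Ideal.span {(PowerSeries.X : (ZMod 2)⟦X⟧)}).comap (PolyRing α).val

instance centerIdeal_isPrime : (centerIdeal α).IsPrime := by
  have : (Ideal.span {(PowerSeries.X : (ZMod 2)⟦X⟧)}).IsPrime := PowerSeries.span_X_isPrime
  exact Ideal.comap_isPrime (PolyRing α).val _

/-- The ring `R`, the localization of `𝔽₂[x, αₙ : n ≥ 0]` at the ideal above. -/
def ExRing : Type := Localization.AtPrime (centerIdeal α)

instance instCommRingExRing : CommRing (ExRing α) :=
  inferInstanceAs (CommRing (Localization.AtPrime (centerIdeal α)))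

instance instAlgebraExRing : Algebra (PolyRing α) (ExRing α) :=
  inferInstanceAs (Algebra (PolyRing α) (Localization.AtPrime (centerIdeal α)))

instance instIsLocalizationExRing : IsLocalization.AtPrime (ExRing α) (centerIdeal α) :=
  inferInstanceAs (IsLocalization.AtPrime (Localization.AtPrime (centerIdeal α)) (centerIdeal α))

instance instIsLocalRingExRing : IsLocalRing (ExRing α) :=
  IsLocalization.AtPrime.isLocalRing (ExRing α) (centerIdeal α)

/-- The element `x` of `R`. -/
def xR : ExRing α := algebraMap (PolyRing α) (ExRing α) (xElt α)

end TelescopeExample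

end

open CategoryTheory CategoryTheory.Limits
open scoped PowerSeries Polynomial ZeroObject

noncomputable section

/-! Failure of (RTC) follows from four properties of a ring: $x$ is a nonzerodivisor, $2=0$,
$a_n=a_{n+1}^2+e_nx$ for all $n$, and $a_1\notin(x,a_0)$. Let $\mathcal D$ consist of the $X$ on
which each $a_n$ has the form $x\cdot b$ with $b$ an endomorphism of $X$. In this form $\mathcal D$
is visibly closed under tensor products and cohomology. By `divIdeal_iff` membership also means that
every $a_n$ kills every map from a shift of $R/(x)$ to $X$. Since $R/(x)$ is compact, this gives
definability; since $a_n\equiv a_{n+1}^2$ modulo $x$, it gives closure under extensions.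

Suppose $\mathcal D=\mathcal S^\perp$ with $\mathcal S$ compact. For $s\in\mathcal S$ let $M$ be the
cone of $x$ on $s$ and $Z_n$ the cone of $a_n$ on $M$. All $a_m$ act nilpotently, with a uniform
exponent, on almost all $Z_n$, so $\prod Z_n/\bigoplus Z_n$ lies in $\mathcal D$ and receives no
non-zero map from $M$. Compactness of $M$ then makes $M\to Z_n$ vanish for some $n$, so $a_n$ is
invertible on $M$ (`smul_eq_of_compactlyGenerated`). But $a_n$ is nilpotent on $W=R/(x,a_0)$. Hence
there are no maps from $M$, and then none from $s$, to shifts of $W$. So $W\in\mathcal D$, which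
forces $a_1\in(x,a_0)$, a contradiction (`not_isCompactlyGeneratedIdeal_divIdeal`).

For the concrete ring, $A$ is the increasing union of the polynomial rings $\mathbb
F_2[x,\alpha_N]$. Modulo $x$, the element $\alpha_n$ becomes $T^{2^k}$ with $T=\alpha_{n+k}$. Thus
$\alpha_n$ is regular modulo $x$, $\alpha_1\notin(x,\alpha_0)$, and the maximal ideal of $R/(x)$ is
idempotent.

The ring $S$ is $\mathbb F_2[[x]]\cap\operatorname{Frac}(R)$, in which every non-zero element is a
power of $x$ times a unit. It contains $\beta_n=\alpha_n/x$, so $R\to S$ is neither surjective nor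
flat. The identity $\beta_n=x\beta_{n+1}^2+e_n$, together with $x\beta_{n+1}\in R$, makes it an
epimorphism (`IsRootSequence.map_eq`). For $\mathrm{Tor}_1(S,S)=0$, a first syzygy $K$ of $S$ must
stay a submodule after tensoring with $S$ (`IsRootSequence.lTensor_ker_injective`). This reduces to
$x$ being injective on $S\otimes K$, which follows from the sequence $0\to\mathfrak m\to R\oplus
S\to S\to0$ and injectivity of $\mathfrak m\otimes K\to K$. -/

namespace TelescopeExample


/-! ### Homological algebra in the derived category of an arbitrary commutative ring. -/

section Tensor

universe u

open scoped MonoidalCategory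

variable {R : Type u} [CommRing R] (K : Cpx R)

/-! ### Tensoring with a K-flat complex preserves quasi-isomorphisms -/

/-- The functor `K ⊗ -` on unbounded complexes. -/
abbrev tensorLeftCpx : Cpx R ⥤ Cpx R where
  obj L := HomologicalComplex.tensorObj K L
  map g := HomologicalComplex.tensorHom (𝟙 K) g
  map_id L := ((MonoidalCategory.curriedTensor (ModuleCat.{u} R)).map₂CochainComplex.obj K).map_id L
  map_comp f g :=
    ((MonoidalCategory.curriedTensor (ModuleCat.{u} R)).map₂CochainComplex.obj K).map_comp f g

variable {K} in
lemma tensorObj_hom_ext {L : Cpx R} {n : ℤ} {Y : ModuleCat.{u} R}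
    {f g : (HomologicalComplex.tensorObj K L).X n ⟶ Y}
    (h : ∀ (i j : ℤ) (h : i + j = n), HomologicalComplex.ιTensorObj K L i j n h ≫ f =
      HomologicalComplex.ιTensorObj K L i j n h ≫ g) : f = g :=
  HomologicalComplex.mapBifunctor.hom_ext h

/-- The map induced on a graded piece of a tensor product by a family of maps of modules. -/
def tensorGraded {L M : Cpx R} (f : ∀ i, L.X i ⟶ M.X i) (n : ℤ) :
    (HomologicalComplex.tensorObj K L).X n ⟶ (HomologicalComplex.tensorObj K M).X n :=
  HomologicalComplex.mapBifunctorDesc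
    (fun i j h => K.X i ◁ f j ≫ HomologicalComplex.ιTensorObj K M i j n h)

lemma ι_tensorGraded {L M : Cpx R} (f : ∀ i, L.X i ⟶ M.X i) (n i j : ℤ) (h : i + j = n) :
    HomologicalComplex.ιTensorObj K L i j n h ≫ tensorGraded K f n =
      K.X i ◁ f j ≫ HomologicalComplex.ιTensorObj K M i j n h :=
  HomologicalComplex.ι_mapBifunctorDesc _ _ _ _

lemma tensorLeftCpx_map_f {L M : Cpx R} (f : L ⟶ M) (n : ℤ) :
    ((tensorLeftCpx K).map f).f n = tensorGraded K f.f n := by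
  refine tensorObj_hom_ext fun i j h => ?_
  rw [ι_tensorGraded K f.f n i j h]
  refine (HomologicalComplex.ι_mapBifunctorMap _ _ _ _ _ _ _ _).trans ?_
  simp

lemma tensorGraded_comp {L M N : Cpx R} (f : ∀ i, L.X i ⟶ M.X i) (g : ∀ i, M.X i ⟶ N.X i)
    (n : ℤ) :
    tensorGraded K (fun i => f i ≫ g i) n = tensorGraded K f n ≫ tensorGraded K g n := by
  refine tensorObj_hom_ext fun i j h => ?_
  rw [ι_tensorGraded K _ n i j h, ← Category.assoc, ι_tensorGraded K _ n i j h, Category.assoc,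
    ι_tensorGraded K _ n i j h, MonoidalCategory.whiskerLeft_comp, Category.assoc]

lemma tensorGraded_id {L : Cpx R} (n : ℤ) :
    tensorGraded K (fun i => 𝟙 (L.X i)) n = 𝟙 _ := by
  refine tensorObj_hom_ext fun i j h => ?_
  rw [ι_tensorGraded K _ n i j h, MonoidalCategory.whiskerLeft_id]
  exact (Category.id_comp _).trans (Category.comp_id _).symm

lemma tensorGraded_add {L M : Cpx R} (f g : ∀ i, L.X i ⟶ M.X i) (n : ℤ) :
    tensorGraded K (fun i => f i + g i) n = tensorGraded K f n + tensorGraded K g n := by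
  refine tensorObj_hom_ext fun i j h => ?_
  rw [ι_tensorGraded K _ n i j h, MonoidalPreadditive.whiskerLeft_add]
  refine (Preadditive.add_comp _ _ _ _ _ _).trans (Eq.trans ?_ (Preadditive.comp_add _ _ _ _ _ _).symm)
  rw [ι_tensorGraded K _ n i j h, ι_tensorGraded K _ n i j h]

lemma tensorGraded_smul (r : R) {L M : Cpx R} (f : ∀ i, L.X i ⟶ M.X i) (n : ℤ) :
    tensorGraded K (fun i => r • f i) n = r • tensorGraded K f n := by
  refine tensorObj_hom_ext fun i j h => ?_
  rw [ι_tensorGraded K _ n i j h, Linear.comp_smul, ι_tensorGraded K _ n i j h,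
    MonoidalLinear.whiskerLeft_smul]
  exact Linear.smul_comp _ _ _ _ _ _

instance : (tensorLeftCpx K).Additive where
  map_add {L M f g} := by
    ext1 n
    rw [HomologicalComplex.add_f_apply, tensorLeftCpx_map_f, tensorLeftCpx_map_f,
      tensorLeftCpx_map_f]
    exact tensorGraded_add K f.f g.f n

lemma tensorLeftCpx_map_smul (r : R) {L M : Cpx R} (f : L ⟶ M) :
    (tensorLeftCpx K).map (r • f) = r • (tensorLeftCpx K).map f := by
  ext1 n
  rw [HomologicalComplex.smul_f_apply, tensorLeftCpx_map_f, tensorLeftCpx_map_f]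
  exact tensorGraded_smul K r f.f n

/-- The retractions and sections of a degreewise splitting need not commute with differentials. This
is why `tensorGraded` accepts arbitrary families of maps: additive functoriality in each degree
carries the splitting along. -/
lemma tensorLeftCpx_map_shortExact (S : ShortComplex (Cpx R))
    (σ : ∀ n, (S.map (HomologicalComplex.eval _ _ n)).Splitting) :
    (S.map (tensorLeftCpx K)).ShortExact := by
  refine HomologicalComplex.shortExact_of_degreewise_shortExact _ fun n => ?_
  refine ShortComplex.Splitting.shortExact
    { r := tensorGraded K (fun i => (σ i).r) n
      s := tensorGraded K (fun i => (σ i).s) n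
      f_r := ?_
      s_g := ?_
      id := ?_ }
  · exact (congrArg (· ≫ _) (tensorLeftCpx_map_f K S.f n)).trans
      ((tensorGraded_comp K S.f.f (fun i => (σ i).r) n).symm.trans
        ((congrArg (tensorGraded K · n) (funext fun i => (σ i).f_r)).trans (tensorGraded_id K n)))
  · exact (congrArg (_ ≫ ·) (tensorLeftCpx_map_f K S.g n)).trans
      ((tensorGraded_comp K (fun i => (σ i).s) S.g.f n).symm.trans
        ((congrArg (tensorGraded K · n) (funext fun i => (σ i).s_g)).trans (tensorGraded_id K n)))
  · exact (congrArg₂ (· + ·)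
      ((congrArg (_ ≫ ·) (tensorLeftCpx_map_f K S.f n)).trans
        (tensorGraded_comp K (fun i => (σ i).r) S.f.f n).symm)
      ((congrArg (· ≫ _) (tensorLeftCpx_map_f K S.g n)).trans
        (tensorGraded_comp K S.g.f (fun i => (σ i).s) n).symm)).trans
      ((tensorGraded_add K (fun i => (σ i).r ≫ S.f.f i) (fun i => S.g.f i ≫ (σ i).s) n).symm.trans
        ((congrArg (tensorGraded K · n) (funext fun i => (σ i).id)).trans (tensorGraded_id K n)))

variable {K}

lemma isIso_map_biprod_fst {C D : Type*} [Category* C] [Category* D] [Preadditive C]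
    [Preadditive D] (F : C ⥤ D) [F.Additive] (X Y : C) [HasBinaryBiproduct X Y]
    (hY : IsZero (F.obj Y)) : IsIso (F.map (biprod.fst : X ⊞ Y ⟶ X)) := by
  refine ⟨F.map biprod.inl, ?_, ?_⟩
  · have h : F.map (biprod.snd : X ⊞ Y ⟶ Y) = 0 := hY.eq_of_tgt _ _
    rw [← F.map_comp, ← F.map_id, ← biprod.total, F.map_add, F.map_comp biprod.snd, h, zero_comp,
      add_zero]
  · rw [← F.map_comp, biprod.inl_fst, F.map_id]

lemma quasiIso_map_biprod_fst (F : Cpx R ⥤ Cpx R) [F.Additive] (X Y : Cpx R)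
    (hY : (F.obj Y).Acyclic) : QuasiIso (F.map (biprod.fst : X ⊞ Y ⟶ X)) := by
  rw [quasiIso_iff]
  intro i
  rw [quasiIsoAt_iff_isIso_homologyMap]
  exact isIso_map_biprod_fst (F ⋙ HomologicalComplex.homologyFunctor _ _ i) X Y
    ((HomologicalComplex.exactAt_iff_isZero_homology _ _).1 (hY i))

lemma quasiIso_of_shortExact {S : ShortComplex (Cpx R)} (hS : S.ShortExact)
    (h : S.X₃.Acyclic) : QuasiIso S.f := by
  rw [quasiIso_iff]
  intro i
  rw [quasiIsoAt_iff_isIso_homologyMap]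
  have hz (n : ℤ) : IsZero (S.X₃.homology n) :=
    (HomologicalComplex.exactAt_iff_isZero_homology _ _).1 (h n)
  have h1 : Epi (HomologicalComplex.homologyMap S.f i) :=
    (hS.homology_exact₂ i).epi_f ((hz i).eq_of_tgt _ _)
  have h2 : Mono (HomologicalComplex.homologyMap S.f i) :=
    (hS.homology_exact₁ (i - 1) i (by simp)).mono_g ((hz (i - 1)).eq_of_src _ _)
  exact isIso_of_mono_of_epi _

lemma acyclic_mappingCone_of_quasiIso {L M : Cpx R} (f : L ⟶ M) [QuasiIso f] :
    (CochainComplex.mappingCone f).Acyclic := by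
  rw [← HomotopyCategory.quotient_obj_mem_subcategoryAcyclic_iff_acyclic]
  have h : (HomotopyCategory.subcategoryAcyclic (ModuleCat.{u} R)).trW
      ((HomotopyCategory.quotient _ _).map f) := by
    rw [← HomotopyCategory.quasiIso_eq_trW_subcategoryAcyclic,
      HomotopyCategory.quotient_map_mem_quasiIso_iff]
    assumption
  exact (ObjectProperty.trW_iff_of_distinguished _ _
    (HomotopyCategory.mappingCone_triangleh_distinguished f)).1 h

/-- The short complex `L ⟶ M ⊞ Cone(𝟙 L) ⟶ coker` attached to a map `L ⟶ M`. -/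
abbrev coneShortComplex {L M : Cpx R} (f : L ⟶ M) : ShortComplex (Cpx R) :=
  ShortComplex.mk (biprod.lift f (CochainComplex.mappingCone.inr (𝟙 L)))
    (cokernel.π (biprod.lift f (CochainComplex.mappingCone.inr (𝟙 L)))) (by simp)

/-- A degreewise retraction of `L ⟶ M ⊞ Cone(𝟙 L)`. -/
def coneRetraction (L M : Cpx R) (n : ℤ) :
    (M ⊞ CochainComplex.mappingCone (𝟙 L)).X n ⟶ L.X n :=
  (biprod.snd : M ⊞ CochainComplex.mappingCone (𝟙 L) ⟶ _).f n ≫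
    (CochainComplex.mappingCone.snd (𝟙 L)).v n n (add_zero n)

lemma f_coneRetraction {L M : Cpx R} (f : L ⟶ M) (n : ℤ) :
    (coneShortComplex f).f.f n ≫ coneRetraction L M n = 𝟙 (L.X n) := by
  dsimp [coneShortComplex, coneRetraction]
  rw [← Category.assoc, ← HomologicalComplex.comp_f, biprod.lift_snd]
  simp

lemma coneShortComplex_shortExact {L M : Cpx R} (f : L ⟶ M) : (coneShortComplex f).ShortExact :=
  have : Mono (coneShortComplex f).f := HomologicalComplex.mono_of_mono_f _ fun n =>
    have : Mono ((coneShortComplex f).f.f n ≫ coneRetraction L M n) := by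
      rw [f_coneRetraction]; infer_instance
    mono_of_mono _ (coneRetraction L M n)
  have : Epi (coneShortComplex f).g := coequalizer.π_epi
  { exact := ShortComplex.exact_cokernel _ }

/-- The short complex `L ⟶ M ⊞ Cone(𝟙 L) ⟶ coker` is degreewise split. -/
def coneShortComplexSplitting {L M : Cpx R} (f : L ⟶ M) (n : ℤ) :
    ((coneShortComplex f).map (HomologicalComplex.eval _ _ n)).Splitting :=
  have h := (coneShortComplex_shortExact f).map_of_exact (HomologicalComplex.eval _ _ n)
  ShortComplex.Splitting.ofExactOfRetraction _ h.exact (coneRetraction L M n)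
    (f_coneRetraction f n) h.epi_g

/-- Factor $f$ as $L\to M\oplus\mathrm{Cone}(1_L)\to M$. The first map is a degreewise split
monomorphism with acyclic cokernel, the second discards an acyclic summand. Both properties survive
tensoring with a K-flat complex. -/
lemma IsKFlat.quasiIso (hK : IsKFlat K) {L M : Cpx R} (f : L ⟶ M) [QuasiIso f] :
    QuasiIso ((tensorLeftCpx K).map f) := by
  have hC := acyclic_mappingCone_of_quasiIso (𝟙 L)
  have h1 : QuasiIso (coneShortComplex f).f := by
    have : QuasiIso (biprod.fst : M ⊞ CochainComplex.mappingCone (𝟙 L) ⟶ M) :=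
      quasiIso_map_biprod_fst (𝟭 _) M _ hC
    have h : QuasiIso ((coneShortComplex f).f ≫
        (biprod.fst : M ⊞ CochainComplex.mappingCone (𝟙 L) ⟶ M)) := by
      rwa [biprod.lift_fst]
    exact quasiIso_of_comp_right _ (biprod.fst : M ⊞ CochainComplex.mappingCone (𝟙 L) ⟶ M)
  have h2 : QuasiIso ((tensorLeftCpx K).map (coneShortComplex f).f) :=
    quasiIso_of_shortExact (tensorLeftCpx_map_shortExact K _ (coneShortComplexSplitting f))
      (hK _ ((coneShortComplex_shortExact f).acyclic_X₃ h1))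
  have h3 := quasiIso_map_biprod_fst (tensorLeftCpx K) M _ (hK _ hC)
  have h4 : (tensorLeftCpx K).map f = (tensorLeftCpx K).map (coneShortComplex f).f ≫
      (tensorLeftCpx K).map (biprod.fst : M ⊞ CochainComplex.mappingCone (𝟙 L) ⟶ M) := by
    rw [← Functor.map_comp, biprod.lift_fst]
  rw [h4]
  infer_instance

/-- If multiplication by `r` divides multiplication by `s` on `Y` in the derived category, then
the same holds on every derived tensor product `X ⊗ Y`. -/
lemma IsDerivedTensor.exists_smul_eq {X Y Z : DMod R} (h : IsDerivedTensor X Y Z) {r s : R}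
    (hY : ∃ b : Y ⟶ Y, r • b = s • 𝟙 Y) : ∃ b : Z ⟶ Z, r • b = s • 𝟙 Z := by
  obtain ⟨K, L, hK, -, ⟨eY⟩, ⟨eZ⟩⟩ := h
  obtain ⟨b, hb⟩ := hY
  have hinv : (HomologicalComplex.quasiIso (ModuleCat.{u} R) (ComplexShape.up ℤ)).IsInvertedBy
      (tensorLeftCpx K ⋙ DerivedCategory.Q) := fun L M f hf => by
    have : QuasiIso f := hf
    have := hK.quasiIso f
    dsimp only [Functor.comp_map]
    infer_instance
  -- The endomorphism `b` lives only in the derived category, so $K\otimes-$ has to be descended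
  -- there before it can be applied to `b`.
  let G : DMod R ⥤ DMod R := Localization.lift _ hinv DerivedCategory.Q
  let e : DerivedCategory.Q ⋙ G ≅ tensorLeftCpx K ⋙ DerivedCategory.Q :=
    Localization.fac _ hinv DerivedCategory.Q
  -- Full linearity of `G` is not needed: multiplication by a scalar comes from a chain map, where
  -- it can be compared directly.
  have hG (r : R) : G.map (r • 𝟙 (DerivedCategory.Q.obj L)) = r • 𝟙 _ := by
    have h1 : r • 𝟙 (DerivedCategory.Q.obj L) = DerivedCategory.Q.map (r • 𝟙 L) := by
      rw [Functor.map_smul, CategoryTheory.Functor.map_id]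
    have h2 := e.hom.naturality (r • 𝟙 L)
    have h3 : (tensorLeftCpx K ⋙ DerivedCategory.Q).map (r • 𝟙 L) = r • 𝟙 _ := by
      rw [Functor.comp_map, tensorLeftCpx_map_smul, CategoryTheory.Functor.map_id,
        Functor.map_smul, CategoryTheory.Functor.map_id]
      rfl
    rw [h3, Linear.comp_smul, Category.comp_id] at h2
    rw [h1, ← cancel_mono (e.hom.app L), Linear.smul_comp]
    exact h2.trans (congrArg (r • ·) (Category.id_comp _).symm)
  let eZ' : G.obj (DerivedCategory.Q.obj L) ≅ Z := e.app L ≪≫ eZ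
  refine ⟨eZ'.inv ≫ G.map (eY.hom ≫ b ≫ eY.inv) ≫ eZ'.hom, ?_⟩
  have h4 : (r • 𝟙 (DerivedCategory.Q.obj L)) ≫ eY.hom ≫ b ≫ eY.inv = s • 𝟙 _ := by
    rw [Linear.smul_comp, Category.id_comp, ← Linear.comp_smul, ← Linear.smul_comp, hb]
    simp
  have h5 := congrArg G.map h4
  rw [G.map_comp, hG, hG, Linear.smul_comp, Category.id_comp] at h5
  rw [← Linear.comp_smul, ← Linear.smul_comp, h5]
  simp

end Tensor


section FreeObjects

universe u

variable {R : Type u} [CommRing R]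

/-! ### Maps out of shifts of the ring in the derived category -/

/-- The module `M` as a complex concentrated in degree `i`. -/
abbrev singleCpx (i : ℤ) (M : ModuleCat.{u} R) : Cpx R :=
  (HomologicalComplex.single (ModuleCat.{u} R) (ComplexShape.up ℤ) i).obj M

instance singleCpx_isKProjective (i : ℤ) :
    CochainComplex.IsKProjective (singleCpx i (ModuleCat.of R R)) := by
  have : (singleCpx i (ModuleCat.of R R)).IsStrictlyLE i := inferInstance
  have (n : ℤ) : Projective ((singleCpx i (ModuleCat.of R R)).X n) := by
    by_cases h : n = i
    · subst h
      exact Projective.of_iso (HomologicalComplex.singleObjXSelf (ComplexShape.up ℤ) n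
        (ModuleCat.of R R)).symm inferInstance
    · exact (HomologicalComplex.isZero_single_obj_X (ComplexShape.up ℤ) i
        (ModuleCat.of R R) n h).projective
  exact CochainComplex.isKProjective_of_projective _ i

/-- The map from the free module of rank one in degree `i` determined by a cycle. -/
def ofCycle (L : Cpx R) (i : ℤ) (z : L.X i) (hz : (L.d i (i + 1)).hom z = 0) :
    singleCpx i (ModuleCat.of R R) ⟶ L :=
  HomologicalComplex.mkHomFromSingle (ModuleCat.ofHom (LinearMap.toSpanSingleton R (L.X i) z))
    (fun k hk => by
      obtain rfl : i + 1 = k := hk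
      ext
      simpa using hz)

lemma ofCycle_f (L : Cpx R) (i : ℤ) (z : L.X i) (hz : (L.d i (i + 1)).hom z = 0) :
    (ofCycle L i z hz).f i =
      (HomologicalComplex.singleObjXSelf (ComplexShape.up ℤ) i (ModuleCat.of R R)).hom ≫
        ModuleCat.ofHom (LinearMap.toSpanSingleton R (L.X i) z) :=
  HomologicalComplex.mkHomFromSingle_f _ _

lemma ofCycle_comp {L M : Cpx R} (f : L ⟶ M) (i : ℤ) (z : L.X i)
    (hz : (L.d i (i + 1)).hom z = 0) (hz' : (M.d i (i + 1)).hom ((f.f i).hom z) = 0) :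
    ofCycle L i z hz ≫ f = ofCycle M i ((f.f i).hom z) hz' := by
  apply HomologicalComplex.from_single_hom_ext
  rw [HomologicalComplex.comp_f, ofCycle, ofCycle, HomologicalComplex.mkHomFromSingle_f,
    HomologicalComplex.mkHomFromSingle_f, Category.assoc]
  congr 1
  ext
  simp

lemma exists_eq_ofCycle {L : Cpx R} {i : ℤ} (f : singleCpx i (ModuleCat.of R R) ⟶ L) :
    ∃ (z : L.X i) (hz : (L.d i (i + 1)).hom z = 0), f = ofCycle L i z hz := by
  let z : ModuleCat.of R R ⟶ L.X i :=
    (HomologicalComplex.singleObjXSelf (ComplexShape.up ℤ) i (ModuleCat.of R R)).inv ≫ f.f i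
  have hz : z ≫ L.d i (i + 1) = 0 := by
    simp [z]
  refine ⟨z.hom (1 : R), ?_, ?_⟩
  · have := congrArg (fun t => t.hom (1 : R)) hz
    simpa using this
  · apply HomologicalComplex.from_single_hom_ext
    rw [ofCycle, HomologicalComplex.mkHomFromSingle_f, ← Iso.inv_comp_eq]
    ext
    simp [z]

/-- The ring in one degree is K-projective, so maps out of it in the derived category are already
maps in the homotopy category. With `Q_map_ofCycle_eq_zero_iff` this identifies them with cohomology
classes of $L$, represented by explicit cycles. -/
lemma exists_eq_Q_map_ofCycle {L : Cpx R} {i : ℤ}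
    (g : DerivedCategory.Q.obj (singleCpx i (ModuleCat.of R R)) ⟶ DerivedCategory.Q.obj L) :
    ∃ (z : L.X i) (hz : (L.d i (i + 1)).hom z = 0), g = DerivedCategory.Q.map (ofCycle L i z hz) := by
  let e := DerivedCategory.quotientCompQhIso (ModuleCat.{u} R)
  obtain ⟨g', hg'⟩ := (CochainComplex.IsKProjective.Qh_map_bijective
    (singleCpx i (ModuleCat.of R R)) ((HomotopyCategory.quotient _ _).obj L)).surjective
    (e.hom.app _ ≫ g ≫ e.inv.app L)
  obtain ⟨f, rfl⟩ := (HomotopyCategory.quotient _ _).map_surjective g'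
  obtain ⟨z, hz, rfl⟩ := exists_eq_ofCycle f
  refine ⟨z, hz, ?_⟩
  have h := DerivedCategory.quotientCompQhIso_hom_naturality (ofCycle L i z hz)
  rw [hg', Category.assoc, Category.assoc] at h
  rw [← cancel_epi (e.hom.app _)]
  refine Eq.trans ?_ h
  rw [Iso.inv_hom_id_app]
  exact congrArg (e.hom.app _ ≫ ·) (Category.comp_id g).symm

lemma Q_map_ofCycle_eq_zero_iff {L : Cpx R} {i j : ℤ} (hij : j + 1 = i) (z : L.X i)
    (hz : (L.d i (i + 1)).hom z = 0) :
    DerivedCategory.Q.map (ofCycle L i z hz) = 0 ↔ ∃ w : L.X j, (L.d j i).hom w = z := by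
  constructor
  · intro h
    let e := DerivedCategory.quotientCompQhIso (ModuleCat.{u} R)
    have h1 : (HomotopyCategory.quotient _ _).map (ofCycle L i z hz) = 0 := by
      apply (CochainComplex.IsKProjective.Qh_map_bijective
        (singleCpx i (ModuleCat.of R R)) ((HomotopyCategory.quotient _ _).obj L)).injective
      have h2 := DerivedCategory.quotientCompQhIso_hom_naturality (ofCycle L i z hz)
      rw [h] at h2
      rw [Functor.map_zero, ← cancel_mono (e.hom.app L)]
      refine h2.trans ?_
      rw [Limits.comp_zero]
      exact Limits.zero_comp.symm
    rw [← (HomotopyCategory.quotient (ModuleCat.{u} R) (ComplexShape.up ℤ)).map_zero] at h1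
    let H := HomotopyCategory.homotopyOfEq _ _ h1
    have h2 := H.comm i
    rw [dNext_eq H.hom (show (ComplexShape.up ℤ).Rel i (i + 1) from rfl),
      prevD_eq H.hom (show (ComplexShape.up ℤ).Rel j i from hij), HomologicalComplex.single_obj_d,
      zero_comp, zero_add, HomologicalComplex.zero_f, add_zero, ofCycle_f,
      ← Iso.eq_inv_comp] at h2
    refine ⟨((HomologicalComplex.singleObjXSelf (ComplexShape.up ℤ) i (ModuleCat.of R R)).inv ≫
      H.hom i j).hom (1 : R), ?_⟩
    have h3 := congrArg (fun t => t.hom (1 : R)) h2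
    simpa using h3.symm
  · rintro ⟨w, rfl⟩
    rw [← DerivedCategory.Q.map_zero]
    apply DerivedCategory.Q_map_eq_of_homotopy
    have h1 := CochainComplex.HomComplex.Cochain.δ_fromSingleMk (K := L)
      (ModuleCat.ofHom (LinearMap.toSpanSingleton R (L.X j) w)) (show i + (-1) = j by lia) 0 i
      (by simp)
    have h2 : CochainComplex.HomComplex.Cochain.ofHom
        (ofCycle L i ((L.d j i).hom w) hz) =
        CochainComplex.HomComplex.Cochain.fromSingleMk
          (ModuleCat.ofHom (LinearMap.toSpanSingleton R (L.X j) w) ≫ L.d j i) (add_zero i) := by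
      apply (CochainComplex.HomComplex.Cochain.fromSingleEquiv (add_zero i)).injective
      rw [CochainComplex.HomComplex.Cochain.fromSingleEquiv_fromSingleMk]
      refine Eq.trans (congrArg (_ ≫ ·) ((CochainComplex.HomComplex.Cochain.ofHom_v _ _).trans
        (ofCycle_f _ _ _ _))) ?_
      rw [Iso.inv_hom_id_assoc]
      ext
      simp
    refine (CochainComplex.HomComplex.Cochain.equivHomotopy _ _).symm
      ⟨CochainComplex.HomComplex.Cochain.fromSingleMk
        (ModuleCat.ofHom (LinearMap.toSpanSingleton R (L.X j) w)) (show i + (-1) = j by lia), ?_⟩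
    rw [CochainComplex.HomComplex.Cochain.ofHom_zero, add_zero]
    exact h2.trans h1.symm

end FreeObjects


section Detect

universe u

variable {R : Type u} [CommRing R]

/-! ### Detecting isomorphisms in the derived category on shifts of the ring -/

variable (R) in
/-- The ring as an object of the derived category concentrated in degree `i`. -/
abbrev freeD (i : ℤ) : DMod R := DerivedCategory.Q.obj (singleCpx i (ModuleCat.of R R))

/-- Shifting the ring. -/
def freeDShift (i j : ℤ) (h : 1 + i = j) : (freeD R j)⟦(1 : ℤ)⟧ ≅ freeD R i :=
  ((DerivedCategory.singleFunctors (ModuleCat.{u} R)).shiftIso 1 i j h).app (ModuleCat.of R R)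

lemma exists_obj_Q_iso (X : DMod R) : ∃ L : Cpx R, Nonempty (DerivedCategory.Q.obj L ≅ X) :=
  ⟨_, ⟨DerivedCategory.Q.objObjPreimageIso X⟩⟩

lemma isZero_of_freeD_hom_eq_zero {X : DMod R} (h : ∀ (i : ℤ) (g : freeD R i ⟶ X), g = 0) :
    IsZero X := by
  obtain ⟨L, ⟨e⟩⟩ := exists_obj_Q_iso X
  refine IsZero.of_iso ?_ e.symm
  have hL : L.Acyclic := fun i => by
    rw [HomologicalComplex.exactAt_iff' L (i - 1) i (i + 1) (by simp) (by simp),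
      ShortComplex.moduleCat_exact_iff]
    intro z hz
    have h1 : DerivedCategory.Q.map (ofCycle L i z hz) ≫ e.hom = 0 := h _ _
    rw [Preadditive.IsIso.comp_right_eq_zero] at h1
    exact (Q_map_ofCycle_eq_zero_iff (sub_add_cancel i 1) z hz).1 h1
  have h1 : QuasiIso (0 : L ⟶ 0) := by
    rw [quasiIso_iff]
    intro i
    rw [quasiIsoAt_iff_isIso_homologyMap]
    exact isIso_of_source_target_iso_zero _
      ((HomologicalComplex.exactAt_iff_isZero_homology _ _).1 (hL i)).isoZero
      ((HomologicalComplex.homologyFunctor _ _ i).map_isZero (isZero_zero _)).isoZero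
  exact (DerivedCategory.Q.map_isZero (isZero_zero _)).of_iso
    (asIso (DerivedCategory.Q.map (0 : L ⟶ 0)))

/-- The cone of `θ` receives no non-zero map from a shift of the ring. Injectivity, one degree up,
kills the composite with the connecting map; so the map comes from $Y$, then from $X$ by
surjectivity, and hence vanishes in the cone. -/
lemma isIso_of_freeD_bijective {X Y : DMod R} (θ : X ⟶ Y)
    (h1 : ∀ (i : ℤ) (g : freeD R i ⟶ Y), ∃ g', g' ≫ θ = g)
    (h2 : ∀ (i : ℤ) (g : freeD R i ⟶ X), g ≫ θ = 0 → g = 0) : IsIso θ := by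
  obtain ⟨Z, p, δ, hT⟩ := Pretriangulated.distinguished_cocone_triangle θ
  refine (Pretriangulated.Triangle.isZero₃_iff_isIso₁ _ hT).1
    (isZero_of_freeD_hom_eq_zero (X := Z) (fun i g => ?_))
  have h3 : g ≫ δ = 0 := by
    let e : (freeD R (1 + i))⟦(1 : ℤ)⟧ ≅ freeD R i := freeDShift i _ rfl
    obtain ⟨g', hg'⟩ := (shiftFunctor (DMod R) (1 : ℤ)).map_surjective (e.hom ≫ g ≫ δ)
    have h4 : g' ≫ θ = 0 := by
      apply (shiftFunctor (DMod R) (1 : ℤ)).map_injective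
      rw [CategoryTheory.Functor.map_comp, hg', CategoryTheory.Functor.map_zero]
      have h4 : δ ≫ θ⟦(1 : ℤ)⟧' = 0 := Pretriangulated.comp_distTriang_mor_zero₃₁ _ hT
      rw [Category.assoc, Category.assoc, h4, comp_zero, comp_zero]
    rw [h2 _ _ h4, CategoryTheory.Functor.map_zero] at hg'
    exact (Preadditive.IsIso.comp_left_eq_zero e.hom _).1 hg'.symm
  obtain ⟨k, hk⟩ := Pretriangulated.Triangle.coyoneda_exact₃ _ hT g h3
  obtain ⟨k', rfl⟩ := h1 i k
  have h4 : θ ≫ p = 0 := Pretriangulated.comp_distTriang_mor_zero₁₂ _ hT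
  refine hk.trans ((Category.assoc k' θ p).trans ?_)
  rw [h4, comp_zero]

end Detect

section DirectSum

universe u

variable {R : Type u} [CommRing R]

/-! ### Direct sums and products of complexes -/

open Classical

variable {J : Type u} (Z W : J → Cpx R)

/-- The direct sum of a family of complexes. -/
def dsumCpx : Cpx R where
  X i := ModuleCat.of R (Π₀ j, (Z j).X i)
  d i i' := ModuleCat.ofHom (DFinsupp.mapRange.linearMap fun j => ((Z j).d i i').hom)
  shape i i' h := by
    refine ModuleCat.hom_ext (LinearMap.ext fun (z : Π₀ j, (Z j).X i) =>
      DFinsupp.ext fun j => ?_)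
    change ((Z j).d i i').hom (z j) = 0
    simp [(Z j).shape i i' h]
  d_comp_d' i i' i'' _ _ := by
    refine ModuleCat.hom_ext (LinearMap.ext fun (z : Π₀ j, (Z j).X i) =>
      DFinsupp.ext fun j => ?_)
    exact congrArg (fun t => t.hom (z j)) ((Z j).d_comp_d i i' i'')

/-- The projection to a summand. -/
def dsumπ (j : J) : dsumCpx Z ⟶ Z j where
  f i := ModuleCat.ofHom (DFinsupp.lapply (M := fun j => (Z j).X i) j)
  comm' _ _ _ := rfl

/-- The inclusion of a summand. -/
def dsumι (j : J) : Z j ⟶ dsumCpx Z where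
  f i := ModuleCat.ofHom (DFinsupp.lsingle (M := fun j => (Z j).X i) j)
  comm' i i' _ := ModuleCat.hom_ext (LinearMap.ext fun _ =>
    DFinsupp.mapRange_single (β₁ := fun j => (Z j).X i) (β₂ := fun j => (Z j).X i')
      (f := fun j => ((Z j).d i i').hom) (hf := fun _ => map_zero _))

variable {Z}

lemma dsum_ext {i : ℤ} {z w : (dsumCpx Z).X i}
    (h : ∀ j, ((dsumπ Z j).f i).hom z = ((dsumπ Z j).f i).hom w) : z = w :=
  DFinsupp.ext (β := fun j => (Z j).X i) h

lemma dsumπ_d {i i' : ℤ} (z : (dsumCpx Z).X i) (j : J) :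
    ((dsumπ Z j).f i').hom (((dsumCpx Z).d i i').hom z) =
      ((Z j).d i i').hom (((dsumπ Z j).f i).hom z) := rfl

lemma exists_dsum_apply_eq_sum {i : ℤ} (z : (dsumCpx Z).X i) :
    ∃ s : Finset J, z = ∑ j ∈ s, ((dsumι Z j).f i).hom (((dsumπ Z j).f i).hom z) :=
  ⟨DFinsupp.support (β := fun j => (Z j).X i) z,
    (DFinsupp.sum_single (β := fun j => (Z j).X i) (f := z)).symm⟩

lemma dsum_linearMap_ext {i : ℤ} {M : ModuleCat.{u} R} {f g : (dsumCpx Z).X i ⟶ M}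
    (h : ∀ j, (dsumι Z j).f i ≫ f = (dsumι Z j).f i ≫ g) : f = g :=
  ModuleCat.hom_ext (DFinsupp.lhom_ext (M := fun j => (Z j).X i)
    fun j z => congrArg (fun t => t.hom z) (h j))

/-- The map in degree `i` out of a direct sum induced by a family of maps. -/
def dsumDescX {M : ModuleCat.{u} R} {i : ℤ} (f : ∀ j, (Z j).X i ⟶ M) : (dsumCpx Z).X i ⟶ M :=
  ModuleCat.ofHom (DFinsupp.lsum (M := fun j => (Z j).X i) ℕ fun j => (f j).hom)

lemma dsumι_descX {M : ModuleCat.{u} R} {i : ℤ} (f : ∀ j, (Z j).X i ⟶ M) (j : J) :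
    (dsumι Z j).f i ≫ dsumDescX f = f j :=
  ModuleCat.hom_ext (LinearMap.ext fun z =>
    DFinsupp.lsum_single (M := fun j => (Z j).X i) ℕ (fun j => (f j).hom) j z)

/-- The map out of a direct sum induced by a family of maps. -/
def dsumDesc {M : Cpx R} (f : ∀ j, Z j ⟶ M) : dsumCpx Z ⟶ M where
  f i := dsumDescX fun j => (f j).f i
  comm' i i' _ := dsum_linearMap_ext fun j => by
    rw [← Category.assoc, ← Category.assoc, dsumι_descX, (dsumι Z j).comm, Category.assoc,
      dsumι_descX, (f j).comm]

lemma dsum_hom_ext {M : Cpx R} {f g : dsumCpx Z ⟶ M}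
    (h : ∀ j, dsumι Z j ≫ f = dsumι Z j ≫ g) : f = g :=
  HomologicalComplex.hom_ext _ _ fun i => dsum_linearMap_ext fun j =>
    congrArg (fun t => t.f i) (h j)

lemma dsumι_desc {M : Cpx R} (f : ∀ j, Z j ⟶ M) (j : J) : dsumι Z j ≫ dsumDesc f = f j :=
  HomologicalComplex.hom_ext _ _ fun _ => dsumι_descX _ _

variable {W} in
/-- The map of direct sums induced by a family of maps. -/
def dsumMap (f : ∀ j, Z j ⟶ W j) : dsumCpx Z ⟶ dsumCpx W :=
  dsumDesc fun j => f j ≫ dsumι W j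

variable {W} in
lemma dsumι_map (f : ∀ j, Z j ⟶ W j) (j : J) :
    dsumι Z j ≫ dsumMap f = f j ≫ dsumι W j := dsumι_desc _ _

lemma dsumι_π_self (j : J) : dsumι Z j ≫ dsumπ Z j = 𝟙 _ :=
  HomologicalComplex.hom_ext _ _ fun i => ModuleCat.hom_ext (LinearMap.ext fun _ =>
    DFinsupp.single_eq_same (β := fun j => (Z j).X i))

lemma dsumι_π_of_ne {j k : J} (h : j ≠ k) : dsumι Z j ≫ dsumπ Z k = 0 :=
  HomologicalComplex.hom_ext _ _ fun i => ModuleCat.hom_ext (LinearMap.ext fun _ =>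
    DFinsupp.single_eq_of_ne (β := fun j => (Z j).X i) h.symm)

variable {W} in
lemma dsumMap_π (f : ∀ j, Z j ⟶ W j) (j : J) :
    dsumMap f ≫ dsumπ W j = dsumπ Z j ≫ f j := by
  refine dsum_hom_ext fun k => ?_
  rw [← Category.assoc, dsumι_map, Category.assoc, ← Category.assoc (dsumι Z k)]
  by_cases h : k = j
  · subst h
    rw [dsumι_π_self, dsumι_π_self, Category.comp_id, Category.id_comp]
  · rw [dsumι_π_of_ne h, dsumι_π_of_ne h, zero_comp, comp_zero]

lemma dsum_cycle {i i' : ℤ} {z : (dsumCpx Z).X i} (hz : ((dsumCpx Z).d i i').hom z = 0) (j : J) :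
    ((Z j).d i i').hom (((dsumπ Z j).f i).hom z) = 0 := by
  rw [← dsumπ_d, hz, map_zero]

lemma ofCycle_dsum {i : ℤ} (z : (dsumCpx Z).X i) (hz : ((dsumCpx Z).d i (i + 1)).hom z = 0) :
    ∃ s : Finset J, ofCycle (dsumCpx Z) i z hz =
      ∑ j ∈ s, ofCycle (Z j) i (((dsumπ Z j).f i).hom z) (dsum_cycle hz j) ≫ dsumι Z j := by
  obtain ⟨s, hs⟩ := exists_dsum_apply_eq_sum z
  refine ⟨s, ?_⟩
  apply HomologicalComplex.from_single_hom_ext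
  refine Eq.trans ?_ (map_sum (HomologicalComplex.Hom.fAddMonoidHom
    (C₁ := singleCpx i (ModuleCat.of R R)) (C₂ := dsumCpx Z) i) _ _).symm
  rw [ofCycle_f]
  refine Eq.trans ?_ (Finset.sum_congr rfl fun j _ =>
    ((congrArg (· ≫ (dsumι Z j).f i) (ofCycle_f _ _ _ _)).trans (Category.assoc _ _ _)).symm)
  refine Eq.trans (congrArg (_ ≫ ·) ?_) (Preadditive.comp_sum _ _ _)
  refine ModuleCat.hom_ext (LinearMap.ext_ring ?_)
  rw [ModuleCat.hom_sum, LinearMap.sum_apply]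
  simp only [ModuleCat.hom_comp, ModuleCat.hom_ofHom, LinearMap.comp_apply,
    LinearMap.toSpanSingleton_apply, one_smul]
  exact hs

lemma dsum_boundary {i i' : ℤ} {z : (dsumCpx Z).X i'}
    (h : ∀ j, ∃ w, ((Z j).d i i').hom w = ((dsumπ Z j).f i').hom z) :
    ∃ w, ((dsumCpx Z).d i i').hom w = z := by
  choose w hw using h
  obtain ⟨s, hs⟩ := exists_dsum_apply_eq_sum z
  refine ⟨∑ j ∈ s, ((dsumι Z j).f i).hom (w j), ?_⟩
  rw [map_sum, hs]
  refine Finset.sum_congr rfl fun j _ => ?_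
  rw [← hw]
  exact congrArg (fun t => t.hom (w j)) ((dsumι Z j).comm i i')

lemma exists_dsum_eq_sum {i : ℤ} (g : freeD R i ⟶ DerivedCategory.Q.obj (dsumCpx Z)) :
    ∃ (s : Finset J) (g' : ∀ j, freeD R i ⟶ DerivedCategory.Q.obj (Z j)),
      g = ∑ j ∈ s, g' j ≫ DerivedCategory.Q.map (dsumι Z j) := by
  obtain ⟨z, hz, rfl⟩ := exists_eq_Q_map_ofCycle g
  obtain ⟨s, hs⟩ := ofCycle_dsum z hz
  refine ⟨s, fun j => DerivedCategory.Q.map (ofCycle _ _ _ (dsum_cycle hz j)), ?_⟩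
  rw [hs, Functor.map_sum]
  simp_rw [Functor.map_comp]

lemma freeD_hom_dsum_ext {i : ℤ} (g : freeD R i ⟶ DerivedCategory.Q.obj (dsumCpx Z))
    (h : ∀ j, g ≫ DerivedCategory.Q.map (dsumπ Z j) = 0) : g = 0 := by
  obtain ⟨z, hz, rfl⟩ := exists_eq_Q_map_ofCycle g
  rw [Q_map_ofCycle_eq_zero_iff (sub_add_cancel i 1)]
  refine dsum_boundary fun j => ?_
  have h1 := h j
  rw [← Functor.map_comp, ofCycle_comp (hz' := dsum_cycle hz j),
    Q_map_ofCycle_eq_zero_iff (sub_add_cancel i 1)] at h1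
  exact h1

variable {W} in
lemma isIso_Q_map_dsumMap (f : ∀ j, Z j ⟶ W j) [∀ j, IsIso (DerivedCategory.Q.map (f j))] :
    IsIso (DerivedCategory.Q.map (dsumMap f)) := by
  apply isIso_of_freeD_bijective
  · intro i g
    obtain ⟨s, g', rfl⟩ := exists_dsum_eq_sum g
    refine ⟨∑ j ∈ s, (g' j ≫ inv (DerivedCategory.Q.map (f j))) ≫
      DerivedCategory.Q.map (dsumι Z j), ?_⟩
    rw [Preadditive.sum_comp]
    refine Finset.sum_congr rfl fun j _ => ?_
    rw [Category.assoc, Category.assoc, ← Functor.map_comp, dsumι_map, Functor.map_comp,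
      IsIso.inv_hom_id_assoc]
  · intro i g hg
    refine freeD_hom_dsum_ext g fun j => ?_
    rw [← cancel_mono (DerivedCategory.Q.map (f j)), Category.assoc, ← Functor.map_comp,
      ← dsumMap_π, Functor.map_comp, reassoc_of% hg, zero_comp, zero_comp]

/-- Write each map as a right fraction. A direct sum of quasi-isomorphisms is inverted in the
derived category, so all denominators can be inverted at once. -/
lemma exists_desc_Q_dsum {M : DMod R} (f : ∀ j, DerivedCategory.Q.obj (Z j) ⟶ M) :
    ∃ g : DerivedCategory.Q.obj (dsumCpx Z) ⟶ M,
      ∀ j, DerivedCategory.Q.map (dsumι Z j) ≫ g = f j := by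
  obtain ⟨M, ⟨e⟩⟩ := exists_obj_Q_iso M
  choose Z' s hs g hg using fun j => DerivedCategory.right_fac (f j ≫ e.inv)
  have := isIso_Q_map_dsumMap s
  refine ⟨inv (DerivedCategory.Q.map (dsumMap s)) ≫
    DerivedCategory.Q.map (dsumDesc g) ≫ e.hom, fun j => ?_⟩
  have h1 : DerivedCategory.Q.map (dsumι Z j) ≫ inv (DerivedCategory.Q.map (dsumMap s)) =
      inv (DerivedCategory.Q.map (s j)) ≫ DerivedCategory.Q.map (dsumι Z' j) := by
    rw [IsIso.comp_inv_eq, Category.assoc, ← Functor.map_comp, dsumι_map, Functor.map_comp,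
      IsIso.inv_hom_id_assoc]
  rw [reassoc_of% h1, ← Functor.map_comp_assoc, dsumι_desc, ← Category.assoc, ← hg]
  simp

/-- Each inclusion of a summand lifts to the fibre $w$ of $f$. The lifts assemble to a map $g$ from
the direct sum to the fibre, and $g$ followed by $w$ acts as the identity on maps from shifts of the
ring, so it is an isomorphism. It is annihilated by $f$, hence $f=0$. -/
lemma Q_dsum_hom_eq_zero {M : DMod R} (f : DerivedCategory.Q.obj (dsumCpx Z) ⟶ M)
    (h : ∀ j, DerivedCategory.Q.map (dsumι Z j) ≫ f = 0) : f = 0 := by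
  obtain ⟨W, w, δ, hT⟩ := Pretriangulated.distinguished_cocone_triangle₁ f
  have hw : w ≫ f = 0 := Pretriangulated.comp_distTriang_mor_zero₁₂ _ hT
  have h1 (j : J) : ∃ u : DerivedCategory.Q.obj (Z j) ⟶ W,
      DerivedCategory.Q.map (dsumι Z j) = u ≫ w :=
    Pretriangulated.Triangle.coyoneda_exact₂ _ hT _ (h j)
  choose u hu using h1
  obtain ⟨g, hg⟩ := exists_desc_Q_dsum u
  have : IsIso (g ≫ w) := by
    have h1 : ∀ (i : ℤ) (k : freeD R i ⟶ DerivedCategory.Q.obj (dsumCpx Z)),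
        k ≫ g ≫ w = k := fun i k => by
      obtain ⟨s, g', rfl⟩ := exists_dsum_eq_sum k
      rw [Preadditive.sum_comp]
      refine Finset.sum_congr rfl fun j _ => ?_
      rw [Category.assoc, reassoc_of% hg j, ← hu j]
    exact isIso_of_freeD_bijective _ (fun i k => ⟨k, h1 i k⟩) (fun i k hk => by rwa [h1] at hk)
  rw [← cancel_epi (g ≫ w), Category.assoc, hw, comp_zero, comp_zero]

variable (Z) in
/-- The direct sum of complexes is a coproduct in the derived category. -/
def isColimitQDsum : IsColimit (Cofan.mk (DerivedCategory.Q.obj (dsumCpx Z))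
    fun j => DerivedCategory.Q.map (dsumι Z j)) :=
  Cofan.IsColimit.mk _ (fun s => (exists_desc_Q_dsum s.inj).choose)
    (fun s => (exists_desc_Q_dsum s.inj).choose_spec)
    (fun s m hm => by
      rw [← sub_eq_zero]
      refine Q_dsum_hom_eq_zero _ fun j => ?_
      rw [Preadditive.comp_sub, sub_eq_zero, (exists_desc_Q_dsum s.inj).choose_spec]
      exact hm j)

end DirectSum


section Triangles

universe u

variable {R : Type u} [CommRing R] {A B C X : DMod R} {f : A ⟶ B} {p : B ⟶ C}
  {δ : C ⟶ A⟦(1 : ℤ)⟧}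

/-! ### Long exact sequences -/

lemma triangle_factor_left
    (hT : Pretriangulated.Triangle.mk f p δ ∈ Pretriangulated.distinguishedTriangles)
    (g : B ⟶ X) (hg : f ≫ g = 0) : ∃ h : C ⟶ X, g = p ≫ h :=
  Pretriangulated.Triangle.yoneda_exact₂ _ hT g hg

lemma triangle_factor_δ
    (hT : Pretriangulated.Triangle.mk f p δ ∈ Pretriangulated.distinguishedTriangles)
    (g : C ⟶ X) (hg : p ≫ g = 0) : ∃ h : A⟦(1 : ℤ)⟧ ⟶ X, g = δ ≫ h :=
  Pretriangulated.Triangle.yoneda_exact₃ _ hT g hg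

lemma triangle_lift₁
    (hT : Pretriangulated.Triangle.mk f p δ ∈ Pretriangulated.distinguishedTriangles)
    (g : X ⟶ B) (hg : g ≫ p = 0) : ∃ h : X ⟶ A, g = h ≫ f :=
  Pretriangulated.Triangle.coyoneda_exact₂ _ hT g hg

lemma triangle_lift₂
    (hT : Pretriangulated.Triangle.mk f p δ ∈ Pretriangulated.distinguishedTriangles)
    (g : X ⟶ C) (hg : g ≫ δ = 0) : ∃ h : X ⟶ B, g = h ≫ p :=
  Pretriangulated.Triangle.coyoneda_exact₃ _ hT g hg

end Triangles

section Compact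

universe u

variable {R : Type u} [CommRing R]

/-! ### Compactness -/

open Classical

variable {J : Type u}

/-- The idempotent of a direct sum given by the projection to a finite subsum. -/
def dsumTrunc (Z : J → Cpx R) (s : Finset J) :
    DerivedCategory.Q.obj (dsumCpx Z) ⟶ DerivedCategory.Q.obj (dsumCpx Z) :=
  ∑ j ∈ s, DerivedCategory.Q.map (dsumπ Z j) ≫ DerivedCategory.Q.map (dsumι Z j)

lemma ι_dsumTrunc {Z : J → Cpx R} {s : Finset J} {j : J} (hj : j ∈ s) :
    DerivedCategory.Q.map (dsumι Z j) ≫ dsumTrunc Z s = DerivedCategory.Q.map (dsumι Z j) := by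
  rw [dsumTrunc, Preadditive.comp_sum, Finset.sum_eq_single j]
  · rw [← Category.assoc, ← Functor.map_comp, dsumι_π_self, CategoryTheory.Functor.map_id,
      Category.id_comp]
  · intro k _ hk
    rw [← Category.assoc, ← Functor.map_comp, dsumι_π_of_ne hk.symm,
      CategoryTheory.Functor.map_zero, zero_comp]
  · exact fun h => (h hj).elim

lemma dsumTrunc_π {Z : J → Cpx R} {s : Finset J} {j : J} (hj : j ∉ s) :
    dsumTrunc Z s ≫ DerivedCategory.Q.map (dsumπ Z j) = 0 := by
  rw [dsumTrunc, Preadditive.sum_comp]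
  refine Finset.sum_eq_zero fun k hk => ?_
  rw [Category.assoc, ← Functor.map_comp, dsumι_π_of_ne (ne_of_mem_of_not_mem hk hj),
    CategoryTheory.Functor.map_zero, comp_zero]

lemma dsumTrunc_comp (Z : J → Cpx R) {s t : Finset J} (h : s ⊆ t) :
    dsumTrunc Z s ≫ dsumTrunc Z t = dsumTrunc Z s := by
  rw [dsumTrunc, Preadditive.sum_comp]
  exact Finset.sum_congr rfl fun j hj => by rw [Category.assoc, ι_dsumTrunc (h hj)]

/-- Maps to direct sums of complexes factor through finite subsums. -/
def IsSmall (X : DMod R) : Prop :=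
  ∀ (J : Type u) (Z : J → Cpx R) (g : X ⟶ DerivedCategory.Q.obj (dsumCpx Z)),
    ∃ s : Finset J, g ≫ dsumTrunc Z s = g

lemma IsSmall.of_iso {X Y : DMod R} (hX : IsSmall X) (e : X ≅ Y) : IsSmall Y := fun J Z g => by
  obtain ⟨s, hs⟩ := hX J Z (e.hom ≫ g)
  exact ⟨s, by rwa [Category.assoc, cancel_epi] at hs⟩

lemma isSmall_freeD (i : ℤ) : IsSmall (freeD R i) := fun J Z g => by
  obtain ⟨s, g', rfl⟩ := exists_dsum_eq_sum g
  refine ⟨s, ?_⟩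
  rw [Preadditive.sum_comp]
  exact Finset.sum_congr rfl fun j hj => by rw [Category.assoc, ι_dsumTrunc hj]

/-- A finite truncation handles the restriction of a map to $B$. The discrepancy factors through
$A[1]$ and needs a second finite set; the union of the two works. -/
lemma isSmall_of_distinguished {A B C : DMod R} {f : A ⟶ B} {p : B ⟶ C} {δ : C ⟶ A⟦(1 : ℤ)⟧}
    (hT : Pretriangulated.Triangle.mk f p δ ∈ Pretriangulated.distinguishedTriangles)
    (hA : IsSmall (A⟦(1 : ℤ)⟧)) (hB : IsSmall B) : IsSmall C := fun J Z g => by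
  obtain ⟨s, hs⟩ := hB J Z (p ≫ g)
  have h1 : p ≫ (g - g ≫ dsumTrunc Z s) = 0 := by
    rw [Preadditive.comp_sub, ← Category.assoc, hs, sub_self]
  obtain ⟨h, hh'⟩ := triangle_factor_δ hT _ h1
  obtain ⟨t, ht⟩ := hA J Z h
  refine ⟨s ∪ t, ?_⟩
  have h2 : (g - g ≫ dsumTrunc Z s) ≫ dsumTrunc Z (s ∪ t) = (δ ≫ h) ≫ dsumTrunc Z (s ∪ t) :=
    congrArg (· ≫ dsumTrunc Z (s ∪ t)) hh'
  rw [Category.assoc, ← ht, Category.assoc h, dsumTrunc_comp Z Finset.subset_union_right, ht,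
    Preadditive.sub_comp, Category.assoc, dsumTrunc_comp Z Finset.subset_union_left, ← hh'] at h2
  exact sub_left_injective h2

/-- An arbitrary coproduct is compared with a direct sum of complexes representing its terms. Finite
truncation there shows that $\bigoplus\mathrm{Hom}(X,F_j)\to\mathrm{Hom}(X,\coprod F_j)$ is
surjective; the coordinate maps show that it is injective. -/
lemma IsSmall.isCompactObj {X : DMod R} (hX : IsSmall X) : IsCompactObj X := fun J => by
  refine ⟨fun {F} => ⟨fun {c} hc => ⟨?_⟩⟩⟩
  -- the coordinate maps
  let π (j : J) : c.pt ⟶ F.obj ⟨j⟩ := hc.desc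
    ⟨F.obj ⟨j⟩, Discrete.natTrans fun k =>
      if h : k = ⟨j⟩ then eqToHom (by rw [h]; rfl) else 0⟩
  have hπ (j : J) : c.ι.app ⟨j⟩ ≫ π j = 𝟙 _ := by
    refine (hc.fac _ _).trans ?_
    simp
  have hπ' (j k : J) (h : k ≠ j) : c.ι.app ⟨k⟩ ≫ π j = 0 := by
    refine (hc.fac _ _).trans ?_
    simp [h]
  let Ψ : (Π₀ j : J, (X ⟶ F.obj ⟨j⟩)) →+ (X ⟶ c.pt) :=
    DFinsupp.sumAddHom fun j => Preadditive.rightComp X (c.ι.app ⟨j⟩)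
  have hΨs (j : J) (g : X ⟶ F.obj ⟨j⟩) : Ψ (DFinsupp.single j g) = g ≫ c.ι.app ⟨j⟩ :=
    DFinsupp.sumAddHom_single _ _ _
  have hΨ : Function.Bijective Ψ := by
    constructor
    · rw [injective_iff_map_eq_zero]
      intro f hf
      ext j
      have h1 : (Preadditive.rightComp X (π j)).comp Ψ = DFinsupp.evalAddMonoidHom j := by
        refine DFinsupp.addHom_ext fun k g => ?_
        rw [AddMonoidHom.comp_apply, hΨs]
        change (g ≫ c.ι.app ⟨k⟩) ≫ π j =
          DFinsupp.single (β := fun j : J => (X ⟶ F.obj ⟨j⟩)) k g j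
        rw [Category.assoc]
        by_cases h : k = j
        · subst h
          rw [hπ, Category.comp_id, DFinsupp.single_eq_same]
        · rw [hπ' _ _ h, comp_zero, DFinsupp.single_eq_of_ne (Ne.symm h)]
      have h2 := DFunLike.congr_fun h1 f
      rw [AddMonoidHom.comp_apply, hf, map_zero] at h2
      exact h2.symm
    · intro g
      choose Z e using fun j : J => exists_obj_Q_iso (F.obj ⟨j⟩)
      replace e (j : J) := (e j).some
      let u : c.pt ⟶ DerivedCategory.Q.obj (dsumCpx Z) := hc.desc
        ⟨_, Discrete.natTrans fun j => (e j.as).inv ≫ DerivedCategory.Q.map (dsumι Z j.as)⟩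
      have hu (j : J) : c.ι.app ⟨j⟩ ≫ u = (e j).inv ≫ DerivedCategory.Q.map (dsumι Z j) :=
        hc.fac _ _
      obtain ⟨v, hv⟩ := exists_desc_Q_dsum fun j => (e j).hom ≫ c.ι.app ⟨j⟩
      have huv : u ≫ v = 𝟙 _ := hc.hom_ext fun ⟨j⟩ => by
        rw [reassoc_of% hu j, hv, Iso.inv_hom_id_assoc, Category.comp_id]
      obtain ⟨s, hs⟩ := hX J Z (g ≫ u)
      refine ⟨∑ j ∈ s, DFinsupp.single j
        (g ≫ u ≫ DerivedCategory.Q.map (dsumπ Z j) ≫ (e j).hom), ?_⟩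
      rw [map_sum]
      have h1 : ((g ≫ u) ≫ dsumTrunc Z s) ≫ v = (g ≫ u) ≫ v := congrArg (· ≫ v) hs
      rw [Category.assoc g u v, huv, Category.comp_id, dsumTrunc, Preadditive.comp_sum,
        Preadditive.sum_comp] at h1
      refine Eq.trans (Finset.sum_congr rfl fun j _ => ?_) h1
      rw [hΨs]
      simp only [Category.assoc, hv]
  let Ψe := AddEquiv.ofBijective Ψ hΨ
  have hΨe (j : J) (g : X ⟶ F.obj ⟨j⟩) :
      Ψe.symm (g ≫ c.ι.app ⟨j⟩) = DFinsupp.single j g := by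
    rw [AddEquiv.symm_apply_eq]
    exact (hΨs j g).symm
  let τ (s : Cocone (F ⋙ preadditiveCoyoneda.obj (Opposite.op X))) (j : J) :
      (X ⟶ F.obj ⟨j⟩) →+ s.pt := (s.ι.app ⟨j⟩).hom
  exact
    { desc := fun s => AddCommGrpCat.ofHom
        ((DFinsupp.sumAddHom (τ s)).comp Ψe.symm.toAddMonoidHom)
      fac := fun s ⟨j⟩ => by
        refine AddCommGrpCat.hom_ext (AddMonoidHom.ext fun (g : X ⟶ F.obj ⟨j⟩) => ?_)
        exact (congrArg (DFinsupp.sumAddHom (τ s)) (hΨe j g)).trans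
          (DFinsupp.sumAddHom_single (τ s) j g)
      uniq := fun s m hm => by
        refine AddCommGrpCat.hom_ext (AddMonoidHom.ext fun (g : X ⟶ c.pt) => ?_)
        obtain ⟨f, rfl⟩ := Ψe.surjective g
        let m' : (X ⟶ c.pt) →+ s.pt := m.hom
        have h1 : m'.comp Ψ = DFinsupp.sumAddHom (τ s) := by
          refine DFinsupp.addHom_ext fun j g => ?_
          refine Eq.trans ?_ (DFinsupp.sumAddHom_single (τ s) j g).symm
          rw [AddMonoidHom.comp_apply, hΨs]
          exact DFunLike.congr_fun (congrArg AddCommGrpCat.Hom.hom (hm ⟨j⟩)) g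
        refine (DFunLike.congr_fun h1 f).trans ?_
        change _ = DFinsupp.sumAddHom (τ s) (Ψe.symm (Ψe f))
        rw [AddEquiv.symm_apply_apply] }

/-- The maps fixed by some finite truncation form a subgroup containing everything that comes from a
single summand. The quotient map by this subgroup therefore vanishes, by uniqueness for maps out of
the coproduct of the groups $\mathrm{Hom}(X,Z_j)$. -/
lemma IsCompactObj.isSmall {X : DMod R} (hX : IsCompactObj X) : IsSmall X := fun J Z g => by
  have := hX J
  have hc := isColimitOfPreserves (preadditiveCoyoneda.obj (Opposite.op X)) (isColimitQDsum Z)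
  let H : AddSubgroup (X ⟶ DerivedCategory.Q.obj (dsumCpx Z)) :=
    { carrier := {g | ∃ s : Finset J, g ≫ dsumTrunc Z s = g}
      zero_mem' := ⟨∅, zero_comp⟩
      add_mem' := by
        rintro a b ⟨s, hs⟩ ⟨t, ht⟩
        refine ⟨s ∪ t, ?_⟩
        rw [Preadditive.add_comp, ← hs, ← ht, Category.assoc, Category.assoc,
          dsumTrunc_comp Z Finset.subset_union_left, dsumTrunc_comp Z Finset.subset_union_right]
      neg_mem' := by
        rintro a ⟨s, hs⟩
        exact ⟨s, by rw [Preadditive.neg_comp, hs]⟩ }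
  have h1 : AddCommGrpCat.ofHom (QuotientAddGroup.mk' H) = AddCommGrpCat.ofHom 0 := by
    refine hc.hom_ext fun ⟨j⟩ => AddCommGrpCat.hom_ext (AddMonoidHom.ext
      fun (f : X ⟶ DerivedCategory.Q.obj (Z j)) => ?_)
    refine (QuotientAddGroup.eq_zero_iff (N := H)
      (f ≫ DerivedCategory.Q.map (dsumι Z j))).2 ⟨{j}, ?_⟩
    rw [Category.assoc, ι_dsumTrunc (Finset.mem_singleton_self j)]
  exact (QuotientAddGroup.eq_zero_iff (N := H) g).1
    (DFunLike.congr_fun (congrArg AddCommGrpCat.Hom.hom h1) g)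

end Compact

section Koszul

universe u

variable {R : Type u} [CommRing R] (x : R)

/-! ### The quotient of the ring by a regular element -/

/-- The module `R/(x)` as an object of the derived category concentrated in degree `i`. -/
abbrev quotD (i : ℤ) : DMod R :=
  (DerivedCategory.singleFunctor (ModuleCat.{u} R) i).obj (ModuleCat.of R (R ⧸ Ideal.span {x}))

variable {x}

lemma smul_quotD (i : ℤ) : x • 𝟙 (quotD x i) = 0 := by
  have h : x • 𝟙 (ModuleCat.of R (R ⧸ Ideal.span {x})) = 0 := by
    refine ModuleCat.hom_ext (LinearMap.ext fun z => ?_)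
    obtain ⟨r, rfl⟩ := Ideal.Quotient.mk_surjective z
    change x • Ideal.Quotient.mk _ r = 0
    rw [Algebra.smul_def, Ideal.Quotient.algebraMap_eq, ← map_mul,
      Ideal.Quotient.eq_zero_iff_mem]
    exact Ideal.mul_mem_right _ _ (Ideal.mem_span_singleton_self x)
  rw [← CategoryTheory.Functor.map_id, ← Functor.map_smul, h, CategoryTheory.Functor.map_zero]

lemma exists_quotD_triangle (hx : x ∈ nonZeroDivisors R) (i : ℤ) :
    ∃ (p : freeD R i ⟶ quotD x i) (δ : quotD x i ⟶ (freeD R i)⟦(1 : ℤ)⟧),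
      Pretriangulated.Triangle.mk (x • 𝟙 (freeD R i)) p δ ∈
        Pretriangulated.distinguishedTriangles := by
  let S : ShortComplex (ModuleCat.{u} R) :=
    ShortComplex.mk (X₁ := ModuleCat.of R R) (X₂ := ModuleCat.of R R)
      (X₃ := ModuleCat.of R (R ⧸ Ideal.span {x})) (x • 𝟙 _)
      (ModuleCat.ofHom (Submodule.mkQ (Ideal.span {x}))) (by
        refine ModuleCat.hom_ext (LinearMap.ext fun z => ?_)
        exact (Submodule.Quotient.mk_eq_zero _).2
          (Ideal.mul_mem_right z _ (Ideal.mem_span_singleton_self x)))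
  have hS : S.ShortExact :=
    { exact := by
        rw [ShortComplex.moduleCat_exact_iff]
        intro z hz
        obtain ⟨y, hy⟩ := Ideal.mem_span_singleton'.1 ((Submodule.Quotient.mk_eq_zero _).1 hz)
        exact ⟨y, (mul_comm x y).trans hy⟩
      mono_f := (ModuleCat.mono_iff_injective _).2 fun a b h =>
        (mul_cancel_left_mem_nonZeroDivisors hx).1 h
      epi_g := (ModuleCat.epi_iff_surjective _).2 (Submodule.mkQ_surjective _) }
  have h := DerivedCategory.triangleOfSES_distinguished (hS.map_of_exact
    (HomologicalComplex.single (ModuleCat.{u} R) (ComplexShape.up ℤ) i))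
  have e : DerivedCategory.Q.map ((HomologicalComplex.single (ModuleCat.{u} R)
      (ComplexShape.up ℤ) i).map (x • 𝟙 (ModuleCat.of R R))) = x • 𝟙 (freeD R i) := by
    refine Eq.trans (b := (DerivedCategory.singleFunctor (ModuleCat.{u} R) i).map
      (x • 𝟙 (ModuleCat.of R R))) rfl ?_
    rw [Functor.map_smul, CategoryTheory.Functor.map_id]
    rfl
  refine ⟨DerivedCategory.Q.map ((HomologicalComplex.single (ModuleCat.{u} R)
      (ComplexShape.up ℤ) i).map S.g), DerivedCategory.triangleOfSESδ (hS.map_of_exact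
    (HomologicalComplex.single (ModuleCat.{u} R) (ComplexShape.up ℤ) i)), ?_⟩
  rw [← e]
  exact h

lemma isSmall_quotD (hx : x ∈ nonZeroDivisors R) (i : ℤ) : IsSmall (quotD x i) := by
  obtain ⟨p, δ, h⟩ := exists_quotD_triangle hx i
  exact isSmall_of_distinguished h
    ((isSmall_freeD (i - 1)).of_iso (freeDShift (i - 1) i (by ring)).symm) (isSmall_freeD i)

end Koszul


/-! ### A criterion for the failure of the restricted telescope conjecture. -/

section Divisibility

variable {R : Type} [CommRing R]

/-! ### The definable tensor ideal of objects on which `x` divides every `a n` -/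

/-- Multiplication by `x` divides multiplication by every `a n` on `X`. -/
def divIdeal (x : R) (a : ℕ → R) : ObjectProperty (DMod R) := fun X =>
  ∀ n, ∃ b : X ⟶ X, x • b = a n • 𝟙 X

variable {x : R} {a e : ℕ → R}

lemma divIdeal.of_retract {X Y : DMod R} (i : X ⟶ Y) (r : Y ⟶ X) (h : i ≫ r = 𝟙 X)
    (hY : divIdeal x a Y) : divIdeal x a X := fun n => by
  obtain ⟨b, hb⟩ := hY n
  refine ⟨i ≫ b ≫ r, ?_⟩
  rw [← Linear.comp_smul, ← Linear.smul_comp, hb, Linear.smul_comp, Linear.comp_smul,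
    Category.id_comp, h]

lemma divIdeal.map {X : DMod R} (hX : divIdeal x a X) (F : DMod R ⥤ DMod R)
    [F.Additive] [Functor.Linear R F] : divIdeal x a (F.obj X) := fun n => by
  obtain ⟨b, hb⟩ := hX n
  exact ⟨F.map b, by rw [← F.map_smul, hb, F.map_smul, F.map_id]⟩

lemma divIdeal.shift {X : DMod R} (hX : divIdeal x a X) (k : ℤ) : divIdeal x a (X⟦k⟧) :=
  hX.map (shiftFunctor (DMod R) k)

lemma smul_quotD_hom_eq_zero {X : DMod R} {i : ℤ} (g : quotD x i ⟶ X) {r : R}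
    (hr : r ∈ Ideal.span {x}) : r • g = 0 := by
  obtain ⟨s, rfl⟩ := Ideal.mem_span_singleton'.1 hr
  rw [mul_smul, ← Category.id_comp g, ← Linear.smul_comp, smul_quotD, zero_comp, smul_zero]

lemma smul_quotD_hom_congr {X : DMod R} {i : ℤ} (g : quotD x i ⟶ X) {r s : R}
    (h : r - s ∈ Ideal.span {x}) : r • g = s • g := by
  rw [← sub_eq_zero, ← sub_smul]
  exact smul_quotD_hom_eq_zero g h

lemma divIdeal.smul_eq_zero {X : DMod R} (hX : divIdeal x a X) (n : ℕ) {i : ℤ}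
    (g : quotD x i ⟶ X) : a n • g = 0 := by
  obtain ⟨b, hb⟩ := hX n
  rw [← Category.comp_id g, ← Linear.comp_smul, ← hb, Linear.comp_smul, ← Linear.smul_comp,
    smul_quotD_hom_eq_zero g (Ideal.mem_span_singleton_self x), zero_comp]

/-- Shifting the quotient `R/(x)`. -/
def quotDShift (x : R) (k i j : ℤ) (h : k + i = j) : (quotD x j)⟦k⟧ ≅ quotD x i :=
  ((DerivedCategory.singleFunctors (ModuleCat R)).shiftIso k i j h).app _

/-- Every `a n` kills all maps from shifts of `R/(x)` to `X`. -/
def quotKilled (x : R) (a : ℕ → R) (X : DMod R) : Prop :=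
  ∀ (n : ℕ) (i : ℤ) (g : quotD x i ⟶ X), a n • g = 0

lemma quotKilled.shift {X : DMod R} (hX : quotKilled x a X) (k : ℤ) : quotKilled x a (X⟦k⟧) := by
  intro n i g
  obtain ⟨g', hg'⟩ := (shiftFunctor (DMod R) k).map_surjective ((quotDShift x k i _ rfl).hom ≫ g)
  rw [← cancel_epi (quotDShift x k i _ rfl).hom, Linear.comp_smul, ← hg', ← Functor.map_smul,
    hX n _ g', CategoryTheory.Functor.map_zero, comp_zero]

lemma sub_pow_mem (ha : ∀ n, a n = a (n + 1) ^ 2 + e n * x) (n k : ℕ) :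
    a n - a (n + k) ^ 2 ^ k ∈ Ideal.span {x} := by
  induction k with
  | zero => simp
  | succ k ih =>
    have h1 : a (n + k) ^ 2 ^ k - (a (n + (k + 1)) ^ 2) ^ 2 ^ k ∈ Ideal.span {x} := by
      refine Ideal.mem_of_dvd _ (sub_dvd_pow_sub_pow _ _ _) ?_
      rw [ha (n + k), ← add_assoc, add_sub_cancel_left]
      exact Ideal.mul_mem_left _ _ (Ideal.mem_span_singleton_self x)
    have h2 := add_mem ih h1
    rwa [sub_add_sub_cancel, ← pow_mul, ← pow_succ'] at h2

/-- A bound on the nilpotency of the `a m` on maps from shifts of the ring suffices. -/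
lemma quotKilled_of_pow (hx : x ∈ nonZeroDivisors R) (ha : ∀ n, a n = a (n + 1) ^ 2 + e n * x)
    {X : DMod R} (k : ℕ) (h : ∀ (m : ℕ) (i : ℤ) (g : freeD R i ⟶ X), a m ^ 2 ^ k • g = 0) :
    quotKilled x a X := by
  intro n i g
  obtain ⟨p, δ, hT⟩ := exists_quotD_triangle hx i
  -- The two cells of $R/(x)$ are shifts of $R$, and `c` kills the contribution of each. So $c^2$
  -- kills all of `g`, and $c^2=a_{n+k+1}^{2^{k+1}}\equiv a_n$ modulo $x$.
  set c := a (n + (k + 1)) ^ 2 ^ k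
  obtain ⟨u, hu⟩ := triangle_factor_δ hT (c • g) (by
    rw [Linear.comp_smul]
    exact h _ _ _)
  have h1 : c • u = 0 := by
    rw [← cancel_epi (freeDShift (R := R) (i - 1) i (by ring)).inv, Linear.comp_smul, comp_zero]
    exact h _ _ _
  rw [smul_quotD_hom_congr g (sub_pow_mem ha n (k + 1)), pow_succ, pow_mul, sq, mul_smul]
  change c • c • g = 0
  rw [hu, ← Linear.comp_smul, h1, comp_zero]

lemma exists_mor₁_shift_factor {A B C X : DMod R} {f : A ⟶ B} {p : B ⟶ C} {δ : C ⟶ A⟦(1 : ℤ)⟧}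
    (hT : Pretriangulated.Triangle.mk f p δ ∈ Pretriangulated.distinguishedTriangles)
    (g : A⟦(1 : ℤ)⟧ ⟶ X) (hg : δ ≫ g = 0) : ∃ h : B⟦(1 : ℤ)⟧ ⟶ X, g = f⟦(1 : ℤ)⟧' ≫ h := by
  obtain ⟨h, hh⟩ : ∃ h : B⟦(1 : ℤ)⟧ ⟶ X, g = (-f⟦(1 : ℤ)⟧') ≫ h :=
    Pretriangulated.Triangle.yoneda_exact₃ _ (Pretriangulated.rot_of_distTriang _ hT) g hg
  -- Rotating the triangle introduces a sign on the shifted map, which is absorbed into `h`.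
  exact ⟨-h, by rw [hh, Preadditive.neg_comp, Preadditive.comp_neg]⟩

/-- If `c` kills two terms of a distinguished triangle, then `c ^ 2` kills the third. -/
lemma sq_smul_eq_zero_of_distinguished {A B C : DMod R} {f : A ⟶ B} {p : B ⟶ C}
    {δ : C ⟶ A⟦(1 : ℤ)⟧}
    (hT : Pretriangulated.Triangle.mk f p δ ∈ Pretriangulated.distinguishedTriangles)
    {c : R} (hA : c • δ = 0) (hB : c • p = 0) : c ^ 2 • 𝟙 C = 0 := by
  obtain ⟨h, hh⟩ := triangle_factor_δ hT (c • 𝟙 C) (by rw [Linear.comp_smul, Category.comp_id, hB])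
  rw [sq, mul_smul, hh, ← Linear.smul_comp, hA, zero_comp]

lemma smul_eq_zero_of_distinguished {A C : DMod R} {c : R} {p : A ⟶ C} {δ : C ⟶ A⟦(1 : ℤ)⟧}
    (hT : Pretriangulated.Triangle.mk (c • 𝟙 A) p δ ∈ Pretriangulated.distinguishedTriangles) :
    c • p = 0 ∧ c • δ = 0 := by
  have h1 : (c • 𝟙 A) ≫ p = 0 := Pretriangulated.comp_distTriang_mor_zero₁₂ _ hT
  have h2 : δ ≫ (c • 𝟙 A)⟦(1 : ℤ)⟧' = 0 := Pretriangulated.comp_distTriang_mor_zero₃₁ _ hT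
  rw [Linear.smul_comp, Category.id_comp] at h1
  rw [Functor.map_smul, CategoryTheory.Functor.map_id, Linear.comp_smul, Category.comp_id] at h2
  exact ⟨h1, h2⟩

/-- Passing from vanishing on cohomology to vanishing in the derived category is a telescope
argument. Since $a_n^2$ and $a_{n+1}^4$ agree on $M$, the maps $a_n^2$ are compatible along the
sequence $M\to M\to\cdots$ with transition maps $a_{n+1}^2$. These transition maps vanish on
cohomology, so the telescope is zero, and with it every $a_n^2$. -/
lemma sq_smul_id_eq_zero (h2 : (2 : R) = 0) (ha : ∀ n, a n = a (n + 1) ^ 2 + e n * x)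
    {M : Cpx R} (hx2 : x ^ 2 • 𝟙 (DerivedCategory.Q.obj M) = 0)
    (hM : ∀ (n : ℕ) (i : ℤ) (g : freeD R i ⟶ DerivedCategory.Q.obj M), a n ^ 2 • g = 0) (n : ℕ) :
    a n ^ 2 • 𝟙 (DerivedCategory.Q.obj M) = 0 := by
  let Z : ℕ → Cpx R := fun _ => M
  let Φ : dsumCpx Z ⟶ dsumCpx Z := dsumDesc (Z := Z) fun n =>
    dsumι Z n - a (n + 1) ^ 2 • dsumι Z (n + 1)
  let f : dsumCpx Z ⟶ M := dsumDesc (Z := Z) fun n => a n ^ 2 • 𝟙 M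
  -- `Φ` is the identity minus the shift by the transition maps; the second term is invisible on
  -- cohomology.
  have hΦ (i : ℤ) (g : freeD R i ⟶ DerivedCategory.Q.obj (dsumCpx Z)) :
      g ≫ DerivedCategory.Q.map Φ = g := by
    obtain ⟨s, g', rfl⟩ := exists_dsum_eq_sum g
    rw [Preadditive.sum_comp]
    refine Finset.sum_congr rfl fun j _ => ?_
    rw [Category.assoc, ← Functor.map_comp, dsumι_desc, Functor.map_sub, Functor.map_smul,
      Preadditive.comp_sub, Linear.comp_smul, ← Linear.smul_comp, hM, zero_comp, sub_zero]
  have h1 : IsIso (DerivedCategory.Q.map Φ) :=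
    isIso_of_freeD_bijective _ (fun i g => ⟨g, hΦ i g⟩) (fun i g hg => by rwa [hΦ] at hg)
  have h3 : DerivedCategory.Q.map Φ ≫ DerivedCategory.Q.map f = 0 := by
    refine Q_dsum_hom_eq_zero (Z := Z) _ fun j => ?_
    have h4 : dsumι Z j ≫ Φ ≫ f = (a j ^ 2 - a (j + 1) ^ 2 * a (j + 1) ^ 2) • 𝟙 M := by
      rw [← Category.assoc, dsumι_desc, Preadditive.sub_comp, Linear.smul_comp, dsumι_desc,
        dsumι_desc, smul_smul, sub_smul]
    have h5 : a j ^ 2 - a (j + 1) ^ 2 * a (j + 1) ^ 2 = e j ^ 2 * x ^ 2 := by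
      rw [ha j]
      linear_combination (a (j + 1) ^ 2 * e j * x) * h2
    rw [← Functor.map_comp, ← Functor.map_comp, h4, Functor.map_smul,
      CategoryTheory.Functor.map_id, h5, mul_smul, hx2, smul_zero]
  have h6 : DerivedCategory.Q.map f = 0 := by
    rw [← cancel_epi (DerivedCategory.Q.map Φ), h3, comp_zero]
  have h7 : dsumι Z n ≫ f = a n ^ 2 • 𝟙 M := dsumι_desc _ _
  rw [← CategoryTheory.Functor.map_id, ← Functor.map_smul, ← h7, Functor.map_comp, h6, comp_zero]

/-- Let $C$ be the cone of $x$ on $X$. Its cohomology is built from the $x$-torsion and the cokernel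
of $x$ on the cohomology of $X$, both killed by $a_n$. So $a_n^2$ is zero on the cohomology of $C$,
hence on $C$ itself by `sq_smul_id_eq_zero`. Consequently $a_n=a_{n+1}^2+e_nx$ vanishes after $X\to
C$ and lifts along $x$. -/
lemma quotKilled.divIdeal (hx : x ∈ nonZeroDivisors R) (h2 : (2 : R) = 0)
    (ha : ∀ n, a n = a (n + 1) ^ 2 + e n * x) {X : DMod R} (hX : quotKilled x a X) :
    divIdeal x a X := by
  obtain ⟨C, j, δ, hT⟩ := Pretriangulated.distinguished_cocone_triangle (x • 𝟙 X)
  obtain ⟨hj, hδ⟩ := smul_eq_zero_of_distinguished hT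
  have hx2 := sq_smul_eq_zero_of_distinguished hT hδ hj
  have h3 (n : ℕ) {i : ℤ} (g : freeD R i ⟶ X⟦(1 : ℤ)⟧) (hg : x • g = 0) : a n • g = 0 := by
    obtain ⟨p, δ', hT'⟩ := exists_quotD_triangle hx i
    obtain ⟨k, rfl⟩ := triangle_factor_left hT' g (by rw [Linear.smul_comp, Category.id_comp, hg])
    rw [← Linear.comp_smul, hX.shift, comp_zero]
  have h4 (n : ℕ) {i : ℤ} (g : freeD R i ⟶ X) : ∃ g', a n • g = x • g' := by
    obtain ⟨p, δ', hT'⟩ := exists_quotD_triangle hx (1 + i)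
    let E := freeDShift (R := R) i _ rfl
    obtain ⟨k, hk⟩ := exists_mor₁_shift_factor hT' (a n • E.hom ≫ g)
      (by rw [Linear.comp_smul, hX])
    rw [Functor.map_smul, CategoryTheory.Functor.map_id, Linear.smul_comp, Category.id_comp] at hk
    refine ⟨E.inv ≫ k, ?_⟩
    rw [← cancel_epi E.hom, Linear.comp_smul, Linear.comp_smul, hk, Iso.hom_inv_id_assoc]
  have h5 (n : ℕ) {i : ℤ} (g : freeD R i ⟶ C) : a n ^ 2 • g = 0 := by
    obtain ⟨k, hk⟩ := triangle_lift₂ hT (a n • g) (by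
      rw [Linear.smul_comp]
      exact h3 n _ (by rw [← Linear.comp_smul, hδ, comp_zero]))
    obtain ⟨k', hk'⟩ := h4 n k
    rw [sq, mul_smul, hk, ← Linear.smul_comp, hk', Linear.smul_comp, ← Linear.comp_smul, hj,
      comp_zero]
  have h6 (n : ℕ) : a n ^ 2 • 𝟙 C = 0 := by
    obtain ⟨M, ⟨E⟩⟩ := exists_obj_Q_iso C
    have h7 := sq_smul_id_eq_zero h2 ha (M := M)
      (by rw [← cancel_mono E.hom, Linear.smul_comp, Category.id_comp, zero_comp,
            ← Category.comp_id E.hom, ← Linear.comp_smul, hx2, comp_zero])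
      (fun n i g => by rw [← cancel_mono E.hom, Linear.smul_comp, h5, zero_comp]) n
    rw [← cancel_epi E.hom, Linear.comp_smul, Category.comp_id, comp_zero,
      ← Category.id_comp E.hom, ← Linear.smul_comp, h7, zero_comp]
  intro n
  obtain ⟨b, hb⟩ := triangle_lift₁ hT (a n • 𝟙 X) (by
    rw [Linear.smul_comp, Category.id_comp, ha n, add_smul, mul_smul, hj, smul_zero, add_zero,
      ← Category.comp_id j, ← Linear.comp_smul, h6, comp_zero])
  exact ⟨b, by rw [hb, Linear.comp_smul, Category.comp_id]⟩

lemma divIdeal_iff (hx : x ∈ nonZeroDivisors R) (h2 : (2 : R) = 0)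
    (ha : ∀ n, a n = a (n + 1) ^ 2 + e n * x) {X : DMod R} :
    divIdeal x a X ↔ quotKilled x a X :=
  ⟨fun h n _ g => h.smul_eq_zero n g, fun h => h.divIdeal hx h2 ha⟩

lemma isThick_divIdeal (hx : x ∈ nonZeroDivisors R) (h2 : (2 : R) = 0)
    (ha : ∀ n, a n = a (n + 1) ^ 2 + e n * x) : IsThick (divIdeal x a) := by
  constructor
  · exact
      { exists_zero := ⟨0, isZero_zero _, fun n => ⟨0, (isZero_zero _).eq_of_src _ _⟩⟩
        isStableUnderShiftBy := fun k => ⟨fun X hX => hX.shift k⟩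
        ext₂' := fun T hT h1 h3 => by
          refine ObjectProperty.le_isoClosure _ _ ?_
          rw [divIdeal_iff hx h2 ha] at h1 h3 ⊢
          intro n i g
          -- One factor $a_{n+1}$ pushes the map into the first term and a second one kills it
          -- there; their product is $a_n$ modulo $x$.
          obtain ⟨k, hk⟩ := Pretriangulated.Triangle.coyoneda_exact₂ T hT (a (n + 1) • g) (by
            rw [Linear.smul_comp, h3])
          rw [smul_quotD_hom_congr g (sub_pow_mem ha n 1), pow_one, sq, mul_smul, hk,
            ← Linear.smul_comp, h1, zero_comp] }
  · exact ⟨fun r hY => hY.of_retract r.i r.r r.retract⟩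

/-- Divisibility by $x$ is transported by tensor products, while the description by maps out of
$R/(x)$ supplies the defining set: the endomorphisms $a_n$ of the shifts of $R/(x)$. -/
lemma isDefinableTensorIdeal_divIdeal (hx : x ∈ nonZeroDivisors R) (h2 : (2 : R) = 0)
    (ha : ∀ n, a n = a (n + 1) ^ 2 + e n * x) : IsDefinableTensorIdeal (divIdeal x a) where
  thick := isThick_divIdeal hx h2 ha
  tensor _ _ _ hY h n := h.exists_smul_eq (hY n)
  definable := by
    refine ⟨ℕ × ℤ, fun i => quotD x i.2, fun i => quotD x i.2, fun i => a i.1 • 𝟙 _,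
      fun i => ⟨(isSmall_quotD hx _).isCompactObj, (isSmall_quotD hx _).isCompactObj⟩,
      fun X => ?_⟩
    rw [divIdeal_iff hx h2 ha]
    simp only [Linear.smul_comp, Category.id_comp, Prod.forall]
    rfl

lemma homologyMap_smul_id (r : R) (L : Cpx R) (n : ℤ) :
    HomologicalComplex.homologyMap (r • 𝟙 L) n = r • 𝟙 (L.homology n) := by
  rw [← cancel_epi (L.homologyπ n), HomologicalComplex.homologyπ_naturality, Linear.comp_smul,
    Category.comp_id]
  have h : HomologicalComplex.cyclesMap (r • 𝟙 L) n = r • 𝟙 _ := by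
    rw [← cancel_mono (L.iCycles n), HomologicalComplex.cyclesMap_i, Linear.smul_comp,
      Category.id_comp, HomologicalComplex.smul_f_apply, HomologicalComplex.id_f,
      Linear.comp_smul, Category.comp_id]
  rw [h, Linear.smul_comp, Category.id_comp]

lemma homologyFunctor_map_smul_id (r : R) (X : DMod R) (n : ℤ) :
    (DerivedCategory.homologyFunctor (ModuleCat R) n).map (r • 𝟙 X) = r • 𝟙 _ := by
  obtain ⟨L, ⟨E⟩⟩ := exists_obj_Q_iso X
  let F := DerivedCategory.homologyFunctor (ModuleCat R) n
  have h1 : F.map (r • 𝟙 (DerivedCategory.Q.obj L)) = r • 𝟙 _ := by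
    let N := DerivedCategory.homologyFunctorFactors (ModuleCat R) n
    have h2 := N.hom.naturality (r • 𝟙 L)
    have h3 : (DerivedCategory.Q ⋙ F).map (r • 𝟙 L) = F.map (r • 𝟙 (DerivedCategory.Q.obj L)) := by
      rw [Functor.comp_map, Functor.map_smul, CategoryTheory.Functor.map_id]
    rw [h3] at h2
    rw [← cancel_mono (N.hom.app L)]
    refine h2.trans ?_
    refine Eq.trans (congrArg (N.hom.app L ≫ ·) (homologyMap_smul_id r L n)) ?_
    refine (Linear.comp_smul _ _ _ (N.hom.app L) r (𝟙 _)).trans ?_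
    refine Eq.trans ?_ (Linear.smul_comp _ _ _ r (𝟙 _) (N.hom.app L)).symm
    exact congrArg (r • ·) ((Category.comp_id _).trans (Category.id_comp _).symm)
  have h4 : r • 𝟙 X = E.inv ≫ (r • 𝟙 _) ≫ E.hom := by
    rw [Linear.smul_comp, Category.id_comp, Linear.comp_smul, E.inv_hom_id]
  rw [h4]
  change F.map _ = _
  rw [F.map_comp, F.map_comp, h1, Linear.smul_comp, Category.id_comp, Linear.comp_smul,
    ← F.map_comp, E.inv_hom_id, F.map_id]

/-- The quotient of $a_n$ by $x$ is an actual endomorphism of $X$. It therefore acts on every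
$H^k(X)$, and these actions add up to one on the direct sum. -/
lemma isClosedUnderCohomology_divIdeal (x : R) (a : ℕ → R) :
    IsClosedUnderCohomology (divIdeal x a) := by
  intro X hX n
  obtain ⟨b, hb⟩ := hX n
  let H (k : ℤ) := (DerivedCategory.homologyFunctor (ModuleCat R) k).obj X
  have h1 (k : ℤ) : x • (DerivedCategory.homologyFunctor (ModuleCat R) k).map b =
      a n • 𝟙 (H k) := by
    have h2 : b ≫ (x • 𝟙 X) = a n • 𝟙 X := by rw [Linear.comp_smul, Category.comp_id, hb]
    rw [← homologyFunctor_map_smul_id, ← h2, CategoryTheory.Functor.map_comp,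
      homologyFunctor_map_smul_id, Linear.comp_smul, Category.comp_id]
  let B : (∐ H) ⟶ ∐ H :=
    Limits.Sigma.map fun k => (DerivedCategory.homologyFunctor (ModuleCat R) k).map b
  have h2 : x • B = a n • 𝟙 _ := Limits.Sigma.hom_ext _ _ fun k => by
    rw [Linear.comp_smul, Linear.comp_smul, Category.comp_id, Limits.Sigma.ι_map, ← Linear.smul_comp, h1,
      Linear.smul_comp, Category.id_comp]
  exact ⟨(DerivedCategory.singleFunctor (ModuleCat R) 0).map B, by
    rw [← Functor.map_smul, h2, Functor.map_smul, CategoryTheory.Functor.map_id]⟩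

end Divisibility


section Germs

universe u

variable {R : Type u} [CommRing R] {J : Type u} (Z : J → Cpx R)

/-! ### The product of a family of complexes modulo the direct sum -/

open Classical

/-- The product of a family of complexes. -/
def prodCpx : Cpx R where
  X i := ModuleCat.of R (∀ j, (Z j).X i)
  d i i' := ModuleCat.ofHom (LinearMap.pi fun j => ((Z j).d i i').hom ∘ₗ LinearMap.proj j)
  shape i i' h := by
    refine ModuleCat.hom_ext (LinearMap.ext fun (z : ∀ j, (Z j).X i) => funext fun j => ?_)
    change ((Z j).d i i').hom (z j) = 0
    simp [(Z j).shape i i' h]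
  d_comp_d' i i' i'' _ _ := by
    refine ModuleCat.hom_ext (LinearMap.ext fun (z : ∀ j, (Z j).X i) => funext fun j => ?_)
    exact congrArg (fun t => t.hom (z j)) ((Z j).d_comp_d i i' i'')

/-- The projection to a factor. -/
def prodπ (j : J) : prodCpx Z ⟶ Z j where
  f i := ModuleCat.ofHom (LinearMap.proj (φ := fun j => (Z j).X i) j)
  comm' _ _ _ := rfl

variable {Z}

lemma prod_ext {i : ℤ} {z w : (prodCpx Z).X i}
    (h : ∀ j, ((prodπ Z j).f i).hom z = ((prodπ Z j).f i).hom w) : z = w :=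
  funext (β := fun j => (Z j).X i) h

/-- The element of a product with the given components. -/
def prodMk {i : ℤ} (v : ∀ j, (Z j).X i) : (prodCpx Z).X i := v

lemma prodπ_mk {i : ℤ} (v : ∀ j, (Z j).X i) (j : J) :
    ((prodπ Z j).f i).hom (prodMk v) = v j := rfl

lemma prodπ_d {i i' : ℤ} (z : (prodCpx Z).X i) (j : J) :
    ((prodπ Z j).f i').hom (((prodCpx Z).d i i').hom z) =
      ((Z j).d i i').hom (((prodπ Z j).f i).hom z) := rfl

/-- The map to a product induced by a family of maps. -/
def prodLift {M : Cpx R} (f : ∀ j, M ⟶ Z j) : M ⟶ prodCpx Z where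
  f i := ModuleCat.ofHom (LinearMap.pi fun j => ((f j).f i).hom)
  comm' i i' _ := ModuleCat.hom_ext (LinearMap.ext fun z => funext fun j =>
    congrArg (fun t => t.hom z) ((f j).comm i i'))

lemma prodLift_π {M : Cpx R} (f : ∀ j, M ⟶ Z j) (j : J) : prodLift f ≫ prodπ Z j = f j := rfl

variable (Z) in
/-- The inclusion of the direct sum in the product. -/
def dsumToProd : dsumCpx Z ⟶ prodCpx Z := prodLift (dsumπ Z)

lemma dsumToProd_π (j : J) : dsumToProd Z ≫ prodπ Z j = dsumπ Z j := prodLift_π _ _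

lemma prodπ_dsumToProd {i : ℤ} (z : (dsumCpx Z).X i) (j : J) :
    ((prodπ Z j).f i).hom (((dsumToProd Z).f i).hom z) = ((dsumπ Z j).f i).hom z := rfl

instance : Mono (dsumToProd Z) := HomologicalComplex.mono_of_mono_f _ fun i =>
  (ModuleCat.mono_iff_injective _).2 fun z w h => dsum_ext fun j => by
    rw [← prodπ_dsumToProd, ← prodπ_dsumToProd]
    exact congrArg (fun t => ((prodπ Z j).f i).hom t) h

variable (Z) in
/-- The exact sequence expressing the quotient of the product by the direct sum. -/
abbrev germSeq : ShortComplex (Cpx R) :=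
  ShortComplex.mk (dsumToProd Z) (cokernel.π (dsumToProd Z)) (by simp)

variable (Z) in
lemma germSeq_shortExact : (germSeq Z).ShortExact :=
  have : Mono (germSeq Z).f := inferInstanceAs (Mono (dsumToProd Z))
  have : Epi (germSeq Z).g := coequalizer.π_epi
  { exact := ShortComplex.exact_cokernel _ }

lemma dsum_finite_support {i : ℤ} (z : (dsumCpx Z).X i) :
    ∃ s : Finset J, ∀ j ∉ s, ((dsumπ Z j).f i).hom z = 0 := by
  refine ⟨DFinsupp.support (β := fun j => (Z j).X i) z, fun j hj => ?_⟩
  exact (DFinsupp.notMem_support_iff (β := fun j => (Z j).X i)).1 hj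

lemma exists_dsumToProd_eq {i : ℤ} (y : (prodCpx Z).X i) (s : Finset J)
    (h : ∀ j ∉ s, ((prodπ Z j).f i).hom y = 0) : ∃ z, ((dsumToProd Z).f i).hom z = y := by
  let t : Π₀ j, (Z j).X i := DFinsupp.mk s fun j => ((prodπ Z j).f i).hom y
  have ht (j : J) : t j = ((prodπ Z j).f i).hom y := by
    rw [DFinsupp.mk_apply]
    split_ifs with hj
    · rfl
    · exact (h j hj).symm
  exact ⟨t, prod_ext ht⟩

/-- A scalar which acts by zero on almost all `Z j` kills all maps from shifts of the ring to the
quotient of the product by the direct sum. -/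
lemma smul_freeD_germ_eq_zero {c : R} (s : Finset J)
    (h : ∀ j ∉ s, c • 𝟙 (DerivedCategory.Q.obj (Z j)) = 0) {i : ℤ}
    (g : freeD R i ⟶ DerivedCategory.Q.obj (germSeq Z).X₃) : c • g = 0 := by
  obtain ⟨z, hz, rfl⟩ := exists_eq_Q_map_ofCycle g
  have hex (k : ℤ) := (germSeq_shortExact Z).map_of_exact (HomologicalComplex.eval _ _ k)
  have hsurj : Function.Surjective (((germSeq Z).g.f i).hom) :=
    (ModuleCat.epi_iff_surjective _).1 (hex i).epi_g
  obtain ⟨w, rfl⟩ := hsurj z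
  have hcomm (k k' : ℤ) (v : (prodCpx Z).X k) :
      ((germSeq Z).X₃.d k k').hom (((germSeq Z).g.f k).hom v) =
        ((germSeq Z).g.f k').hom (((prodCpx Z).d k k').hom v) :=
    congrArg (fun t => t.hom v) ((germSeq Z).g.comm k k')
  -- A cycle of the quotient lifts to `w` with differential in the direct sum, so all but finitely
  -- many components of `w` are honest cycles.
  obtain ⟨u, hu⟩ : ∃ u, ((dsumToProd Z).f (i + 1)).hom u = ((prodCpx Z).d i (i + 1)).hom w :=
    (ShortComplex.moduleCat_exact_iff _).1 (hex (i + 1)).exact _ ((hcomm _ _ _).symm.trans hz)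
  obtain ⟨t, ht⟩ := dsum_finite_support u
  have hv (j : J) : ∃ v : (Z j).X (i - 1), j ∉ s ∪ t →
      ((Z j).d (i - 1) i).hom v = c • ((prodπ Z j).f i).hom w := by
    by_cases hj : j ∈ s ∪ t
    · exact ⟨0, fun h => (h hj).elim⟩
    · rw [Finset.notMem_union] at hj
      have hc : ((Z j).d i (i + 1)).hom (((prodπ Z j).f i).hom w) = 0 := by
        rw [← prodπ_d, ← hu, prodπ_dsumToProd, ht j hj.2]
      have h1 : DerivedCategory.Q.map (ofCycle (Z j) i _ hc ≫ (c • 𝟙 (Z j))) = 0 := by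
        rw [Functor.map_comp, Functor.map_smul, CategoryTheory.Functor.map_id, h j hj.1, comp_zero]
      have hc' : ((Z j).d i (i + 1)).hom (((c • 𝟙 (Z j) : Z j ⟶ Z j).f i).hom
          (((prodπ Z j).f i).hom w)) = 0 := by
        change ((Z j).d i (i + 1)).hom (c • ((prodπ Z j).f i).hom w) = 0
        rw [map_smul, hc, smul_zero]
      rw [ofCycle_comp (hz' := hc'), Q_map_ofCycle_eq_zero_iff (sub_add_cancel i 1)] at h1
      obtain ⟨v, hv⟩ := h1
      exact ⟨v, fun _ => hv⟩
  choose v hv using hv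
  -- Outside a finite set `c • w` is componentwise the boundary of `v`; the finite error disappears
  -- in the quotient.
  obtain ⟨y, hy⟩ := exists_dsumToProd_eq
    (((prodCpx Z).d (i - 1) i).hom (prodMk v) - c • w) (s ∪ t) fun j hj => by
      rw [map_sub, prodπ_d, prodπ_mk, hv j hj, map_smul, sub_self]
  have hzero : ((germSeq Z).g.f i).hom (((dsumToProd Z).f i).hom y) = 0 :=
    congrArg (fun t => (t.f i).hom y) (germSeq Z).zero
  have hb : ((germSeq Z).X₃.d (i - 1) i).hom (((germSeq Z).g.f (i - 1)).hom (prodMk v)) =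
      c • ((germSeq Z).g.f i).hom w := by
    rw [hcomm, ← sub_eq_zero, ← map_smul, ← map_sub, ← hy, hzero]
  have hcz : ((germSeq Z).X₃.d i (i + 1)).hom (((c • 𝟙 (germSeq Z).X₃ :
      (germSeq Z).X₃ ⟶ _).f i).hom (((germSeq Z).g.f i).hom w)) = 0 := by
    change ((germSeq Z).X₃.d i (i + 1)).hom (c • ((germSeq Z).g.f i).hom w) = 0
    rw [map_smul, hz, smul_zero]
  have h1 : DerivedCategory.Q.map (ofCycle _ i _ hz ≫ (c • 𝟙 (germSeq Z).X₃)) = 0 := by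
    rw [ofCycle_comp (hz' := hcz), Q_map_ofCycle_eq_zero_iff (sub_add_cancel i 1)]
    exact ⟨_, hb⟩
  rwa [Functor.map_comp, Functor.map_smul, CategoryTheory.Functor.map_id, Linear.comp_smul,
    Category.comp_id] at h1

end Germs

section TelescopeFails

variable {R : Type} [CommRing R] {x : R} {a e : ℕ → R}

/-! ### The definable tensor ideal is not compactly generated -/

lemma exists_sub_pow_eq (ha : ∀ n, a n = a (n + 1) ^ 2 + e n * x) {m n : ℕ} (h : m < n) :
    ∃ u v : R, a m = a n ^ 2 * u + v * x := by
  obtain ⟨k, rfl⟩ := Nat.exists_eq_add_of_lt h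
  obtain ⟨v, hv⟩ := Ideal.mem_span_singleton'.1 (sub_pow_mem ha m (k + 1))
  refine ⟨a (m + k + 1) ^ (2 ^ (k + 1) - 2), v, ?_⟩
  rw [← pow_add, Nat.add_sub_cancel' (Nat.le_self_pow (Nat.succ_ne_zero k) 2), hv]
  simp [add_assoc]

/-- Let $Z_n$ be the cone of $a_n$ on $M$. The maps $M\to Z_n$ define a map to $\prod Z_n/\bigoplus
Z_n$, an object of the ideal, so that map is zero. Hence $M\to\prod Z_n$ factors through the direct
sum, and by compactness through a finite part of it. For the remaining $n$ the map $M\to Z_n$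
vanishes, so the identity of $M$ factors through $a_n$. -/
lemma smul_eq_of_compactlyGenerated (hx : x ∈ nonZeroDivisors R) (h2 : (2 : R) = 0)
    (ha : ∀ n, a n = a (n + 1) ^ 2 + e n * x) {M : Cpx R}
    (hM : IsCompactObj (DerivedCategory.Q.obj M)) (hx2 : x ^ 2 • 𝟙 (DerivedCategory.Q.obj M) = 0)
    (hD : ∀ X, divIdeal x a X → ∀ f : DerivedCategory.Q.obj M ⟶ X, f = 0) :
    ∃ (n : ℕ) (g : DerivedCategory.Q.obj M ⟶ DerivedCategory.Q.obj M), a n • g = 𝟙 _ := by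
  let Z : ℕ → Cpx R := fun n => CochainComplex.mappingCone (a n • 𝟙 M)
  let inr (n : ℕ) : M ⟶ Z n := CochainComplex.mappingCone.inr (a n • 𝟙 M)
  have hT (n : ℕ) : ∃ δ : DerivedCategory.Q.obj (Z n) ⟶ (DerivedCategory.Q.obj M)⟦(1 : ℤ)⟧,
      Pretriangulated.Triangle.mk (a n • 𝟙 (DerivedCategory.Q.obj M))
        (DerivedCategory.Q.map (inr n)) δ ∈ Pretriangulated.distinguishedTriangles := by
    have h := DerivedCategory.mappingCone_triangle_distinguished (a n • 𝟙 M)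
    refine ⟨_, (?_ : Pretriangulated.Triangle.mk _ _ (DerivedCategory.Q.mapTriangle.obj
      (CochainComplex.mappingCone.triangle (a n • 𝟙 M))).mor₃ ∈ _)⟩
    have h1 : a n • 𝟙 (DerivedCategory.Q.obj M) = DerivedCategory.Q.map (a n • 𝟙 M) := by
      rw [Functor.map_smul, CategoryTheory.Functor.map_id]
    rw [h1]
    exact h
  -- On $Z_n$ both $a_n^2$ and $x^4$ vanish. For $n>m$ one has $a_m=a_n^2u+vx$, and in
  -- characteristic 2 the fourth power is additive. The exponent 4 does not depend on $m$ or $n$, as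
  -- `quotKilled_of_pow` requires.
  have hZ (m n : ℕ) (h : n ∉ Finset.range (m + 1)) :
      a m ^ 2 ^ 2 • 𝟙 (DerivedCategory.Q.obj (Z n)) = 0 := by
    obtain ⟨δ, hδ⟩ := hT n
    obtain ⟨h3, h4⟩ := smul_eq_zero_of_distinguished hδ
    have h5 := sq_smul_eq_zero_of_distinguished hδ h4 h3
    have h6 : x ^ 2 • δ = 0 := by
      have h8 := congrArg (shiftFunctor (DMod R) (1 : ℤ)).map hx2
      rw [Functor.map_smul, CategoryTheory.Functor.map_id, CategoryTheory.Functor.map_zero] at h8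
      rw [← Category.comp_id δ, ← Linear.comp_smul]
      exact (congrArg (δ ≫ ·) h8).trans comp_zero
    have h7 := sq_smul_eq_zero_of_distinguished hδ h6
      (by rw [← Category.id_comp (DerivedCategory.Q.map (inr n)), ← Linear.smul_comp, hx2,
            zero_comp])
    obtain ⟨u, v, huv⟩ := exists_sub_pow_eq ha (Nat.lt_of_not_le fun hle =>
      h (Finset.mem_range.2 (Nat.lt_succ_of_le hle)))
    have h8 : a m ^ 2 ^ 2 = (a n ^ 6 * u ^ 4) * a n ^ 2 + v ^ 4 * (x ^ 2) ^ 2 := by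
      rw [huv]
      linear_combination (2 * (a n ^ 2 * u) ^ 3 * (v * x) + 3 * (a n ^ 2 * u) ^ 2 * (v * x) ^ 2 +
        2 * (a n ^ 2 * u) * (v * x) ^ 3) * h2
    rw [h8, add_smul, mul_smul, h5, smul_zero, mul_smul, h7, smul_zero, add_zero]
  have hY : divIdeal x a (DerivedCategory.Q.obj (germSeq Z).X₃) :=
    (quotKilled_of_pow hx ha 2 fun m i g =>
      smul_freeD_germ_eq_zero (Z := Z) _ (hZ m) g).divIdeal hx h2 ha
  have hT' := DerivedCategory.triangleOfSES_distinguished (germSeq_shortExact Z)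
  obtain ⟨f, hf⟩ := triangle_lift₁ hT' (DerivedCategory.Q.map (prodLift inr)) (hD _ hY _)
  obtain ⟨s, hs⟩ := hM.isSmall ℕ Z f
  obtain ⟨n, hn⟩ := Infinite.exists_notMem_finset s
  have h3 : DerivedCategory.Q.map (inr n) = 0 := by
    have h4 : DerivedCategory.Q.map (dsumToProd Z) ≫ DerivedCategory.Q.map (prodπ Z n) =
        DerivedCategory.Q.map (dsumπ Z n) := by
      rw [← Functor.map_comp, dsumToProd_π]
    rw [← prodLift_π inr n, Functor.map_comp, hf, Category.assoc]
    refine (congrArg (f ≫ ·) h4).trans ?_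
    change f ≫ _ = 0
    rw [← hs, Category.assoc, dsumTrunc_π hn, comp_zero]
  obtain ⟨δ, hδ⟩ := hT n
  obtain ⟨g, hg⟩ := triangle_lift₁ hδ (𝟙 _) (by rw [h3, comp_zero])
  exact ⟨n, g, by rw [hg, Linear.comp_smul, Category.comp_id]⟩

/-- The test object is $W=R/(x,a_0)$. Since $x=0$ on it, membership in the ideal would force $a_1=0$
on $W$; yet compact generation puts it there. -/
lemma not_isCompactlyGeneratedIdeal_divIdeal (hx : x ∈ nonZeroDivisors R) (h2 : (2 : R) = 0)
    (ha : ∀ n, a n = a (n + 1) ^ 2 + e n * x) (ha1 : a 1 ∉ Ideal.span {x, a 0}) :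
    ¬ IsCompactlyGeneratedIdeal (divIdeal x a) := by
  rintro ⟨S, hS, hSP⟩
  have := hS.thick.1
  have := hS.thick.2
  have hS0 {s X : DMod R} (hs : S s) (hX : divIdeal x a X) (f : s ⟶ X) : f = 0 := by
    have h := (hSP X).1 hX s hs 0 (f ≫ (shiftFunctorZero (DMod R) ℤ).inv.app X)
    rwa [Preadditive.IsIso.comp_right_eq_zero] at h
  let W : DMod R := (DerivedCategory.singleFunctor (ModuleCat R) 0).obj
    (ModuleCat.of R (R ⧸ Ideal.span {x, a 0}))
  have hW {r : R} (hr : r ∈ Ideal.span {x, a 0}) : r • 𝟙 W = 0 := by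
    have h : r • 𝟙 (ModuleCat.of R (R ⧸ Ideal.span {x, a 0})) = 0 := by
      refine ModuleCat.hom_ext (LinearMap.ext fun z => ?_)
      obtain ⟨y, rfl⟩ := Ideal.Quotient.mk_surjective z
      change r • Ideal.Quotient.mk _ y = 0
      rw [Algebra.smul_def, Ideal.Quotient.algebraMap_eq, ← map_mul,
        Ideal.Quotient.eq_zero_iff_mem]
      exact Ideal.mul_mem_right _ _ hr
    rw [← CategoryTheory.Functor.map_id, ← Functor.map_smul, h, CategoryTheory.Functor.map_zero]
  have hWk {r : R} (hr : r ∈ Ideal.span {x, a 0}) {k : ℤ} {X : DMod R} (f : X ⟶ W⟦k⟧) :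
      r • f = 0 := by
    have h8 := congrArg (shiftFunctor (DMod R) k).map (hW hr)
    rw [Functor.map_smul, CategoryTheory.Functor.map_id, CategoryTheory.Functor.map_zero] at h8
    rw [← Category.comp_id f, ← Linear.comp_smul, h8, comp_zero]
  have hxW : x ∈ Ideal.span {x, a 0} := Ideal.subset_span (Set.mem_insert _ _)
  have hPW : divIdeal x a W := by
    rw [hSP]
    intro s hs k f
    -- Replacing $s$ by the cone of $x$ makes $x^2$ vanish, and loses nothing: $x$ is zero on $W$,
    -- so every map from $s$ to a shift of $W$ extends over the cone.
    obtain ⟨C, hC, j, δ, hT⟩ := S.distinguished_cocone_triangle (x • 𝟙 s) hs hs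
    obtain ⟨h3, h4⟩ := smul_eq_zero_of_distinguished hT
    have h5 := sq_smul_eq_zero_of_distinguished hT h4 h3
    obtain ⟨M, ⟨E⟩⟩ := exists_obj_Q_iso C
    have hM : S (DerivedCategory.Q.obj M) :=
      S.prop_of_retract ⟨E.hom, E.inv, E.hom_inv_id⟩ hC
    obtain ⟨n, g, hg⟩ := smul_eq_of_compactlyGenerated hx h2 ha (hS.compact _ hM)
      (by rw [← cancel_mono E.hom, Linear.smul_comp, Category.id_comp, zero_comp,
            ← Category.comp_id E.hom, ← Linear.comp_smul, h5, comp_zero])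
      (fun X hX f => hS0 hM hX f)
    have h6 (q : DerivedCategory.Q.obj M ⟶ W⟦k⟧) : q = 0 := by
      -- Invertibility of $a_n$ on $M$ makes `q` divisible by all powers of $a_n$; but
      -- $a_n^{2^n}\equiv a_0$ modulo $x$, which is zero on $W$.
      have h7 (t : ℕ) : ∃ q' : DerivedCategory.Q.obj M ⟶ W⟦k⟧, q = a n ^ t • q' := by
        induction t with
        | zero => exact ⟨q, by simp⟩
        | succ t ih =>
          obtain ⟨q', hq'⟩ := ih
          refine ⟨g ≫ q', ?_⟩
          rw [pow_succ, mul_smul, ← Linear.smul_comp, hg, Category.id_comp, hq']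
      obtain ⟨q', hq'⟩ := h7 (2 ^ n)
      rw [hq']
      refine hWk ?_ q'
      have h8 := sub_pow_mem ha 0 n
      rw [zero_add] at h8
      rw [← sub_sub_cancel (a 0) (a n ^ 2 ^ n)]
      exact sub_mem (Ideal.subset_span (by simp)) (Ideal.span_mono (by simp) h8)
    obtain ⟨q, hq⟩ := triangle_factor_left hT f (by
      rw [Linear.smul_comp, Category.id_comp, hWk hxW])
    have h9 : q = 0 := by
      rw [← cancel_epi E.hom, comp_zero]
      exact h6 _
    rw [hq, h9, comp_zero]
  obtain ⟨b, hb⟩ := hPW 1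
  have h3 : a 1 • 𝟙 W = 0 := by
    rw [← hb, ← Category.id_comp b, ← Linear.smul_comp, hW hxW, zero_comp]
  have h4 : a 1 • 𝟙 (ModuleCat.of R (R ⧸ Ideal.span {x, a 0})) = 0 := by
    apply (DerivedCategory.singleFunctor (ModuleCat R) 0).map_injective
    rw [Functor.map_smul, CategoryTheory.Functor.map_id, CategoryTheory.Functor.map_zero]
    exact h3
  have h5 : Ideal.Quotient.mk (Ideal.span {x, a 0}) (a 1 * 1) = 0 :=
    congrArg (fun t => t.hom (Ideal.Quotient.mk (Ideal.span {x, a 0}) 1)) h4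
  rw [mul_one, Ideal.Quotient.eq_zero_iff_mem] at h5
  exact ha1 h5

theorem not_satisfiesRTC (hx : x ∈ nonZeroDivisors R) (h2 : (2 : R) = 0)
    (ha : ∀ n, a n = a (n + 1) ^ 2 + e n * x) (ha1 : a 1 ∉ Ideal.span {x, a 0}) :
    ¬ SatisfiesRTC R := fun h =>
  not_isCompactlyGeneratedIdeal_divIdeal hx h2 ha ha1
    (h _ (isDefinableTensorIdeal_divIdeal hx h2 ha) (isClosedUnderCohomology_divIdeal x a))

lemma SatisfiesTC.satisfiesRTC (h : SatisfiesTC R) : SatisfiesRTC R := fun P hP _ => h P hP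

end TelescopeFails


/-! ### The sparse series, the algebra $A$ and the local ring $R$. -/

section SparseSeries

/-! ### Sparse power series and their iterated square roots -/

open Classical

/-- The power series `∑ x ^ (2 ^ n)`, the sum being over the elements of a set. -/
def setSeries (N : Set ℕ) : (ZMod 2)⟦X⟧ :=
  PowerSeries.mk fun k => if ∃ n ∈ N, k = 2 ^ n then 1 else 0

lemma coeff_setSeries (N : Set ℕ) (k : ℕ) :
    PowerSeries.coeff k (setSeries N) = if ∃ n ∈ N, k = 2 ^ n then 1 else 0 :=
  PowerSeries.coeff_mk _ _

lemma coeff_two_pow_setSeries (N : Set ℕ) (n : ℕ) :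
    PowerSeries.coeff (2 ^ n) (setSeries N) = if n ∈ N then 1 else 0 := by
  rw [coeff_setSeries]
  congr 1
  refine propext ⟨?_, fun h => ⟨n, h, rfl⟩⟩
  rintro ⟨m, hm, h⟩
  rwa [Nat.pow_right_injective le_rfl h]

lemma coeff_one_setSeries (N : Set ℕ) :
    PowerSeries.coeff 1 (setSeries N) = if 0 ∈ N then 1 else 0 :=
  coeff_two_pow_setSeries N 0

lemma mem_sparseSeries_iff {f : (ZMod 2)⟦X⟧} :
    f ∈ sparseSeries ↔ ∃ N : Set ℕ, N.Infinite ∧ f = setSeries N := by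
  constructor
  · rintro ⟨n, hn, h⟩
    refine ⟨Set.range n, Set.infinite_range_of_injective hn.injective, ?_⟩
    ext k
    rw [coeff_setSeries]
    split_ifs with hk
    · obtain ⟨_, ⟨i, rfl⟩, hi⟩ := hk
      exact (h k).1 ⟨i, hi⟩
    · exact (h k).2 fun ⟨i, hi⟩ => hk ⟨n i, ⟨i, rfl⟩, hi⟩
  · rintro ⟨N, hN, rfl⟩
    have hr : Set.range (Nat.nth (· ∈ N)) = N := Nat.range_nth_of_infinite hN
    refine ⟨Nat.nth (· ∈ N), Nat.nth_strictMono hN, fun k => ?_⟩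
    have h : (∃ i, k = 2 ^ Nat.nth (· ∈ N) i) ↔ ∃ n ∈ N, k = 2 ^ n := by
      conv_rhs => rw [← hr]
      simp
    rw [coeff_setSeries, h]
    exact ⟨fun hk => if_pos hk, fun hk => if_neg hk⟩

lemma setSeries_injective : Function.Injective setSeries := fun N M h => by
  ext n
  have h1 := coeff_two_pow_setSeries N n
  rw [h, coeff_two_pow_setSeries] at h1
  by_cases hN : n ∈ N <;> by_cases hM : n ∈ M <;> simp_all

lemma constantCoeff_of_mem_sparseSeries {f : (ZMod 2)⟦X⟧} (hf : f ∈ sparseSeries) :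
    PowerSeries.constantCoeff f = 0 := by
  obtain ⟨N, -, rfl⟩ := mem_sparseSeries_iff.1 hf
  rw [← PowerSeries.coeff_zero_eq_constantCoeff_apply, coeff_setSeries, if_neg]
  rintro ⟨n, -, hn⟩
  exact (pow_ne_zero n two_ne_zero) hn.symm

lemma algebraMap_polynomial_injective :
    Function.Injective (algebraMap (ZMod 2)[X] (ZMod 2)⟦X⟧) := fun p q h =>
  Polynomial.coe_injective _ (by simpa [PowerSeries.algebraMap_apply'] using h)

instance : Module.IsTorsionFree (ZMod 2)[X] (ZMod 2)⟦X⟧ :=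
  Module.isTorsionFree_iff_algebraMap_injective.2 algebraMap_polynomial_injective

/-- There are uncountably many sparse series, hence some of them are transcendental. -/
lemma exists_transcendental_mem_sparseSeries :
    ∃ a ∈ sparseSeries, Transcendental (ZMod 2)[X] a := by
  by_contra! h
  have : Countable (ZMod 2)[X] := by
    rw [← Cardinal.mk_le_aleph0_iff]
    exact (Polynomial.cardinalMk_le_max).trans (by simp)
  have hc : {f : (ZMod 2)⟦X⟧ | IsAlgebraic (ZMod 2)[X] f}.Countable := Algebraic.countable _ _
  -- the infinite sets `{2 i + b i}`
  let B : Set ℕ → Set ℕ := fun T => {k | if Even k then k / 2 ∈ T else k / 2 ∉ T}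
  have hB (T : Set ℕ) (i : ℕ) : 2 * i ∈ B T ↔ i ∈ T := by
    simp [B]
  have hB' (T : Set ℕ) (i : ℕ) : 2 * i + 1 ∈ B T ↔ i ∉ T := by
    have h1 : (2 * i + 1) / 2 = i := by omega
    simp [B, h1]
  have hinj : Function.Injective fun T => setSeries (B T) := fun T T' hT => by
    ext i
    rw [← hB, ← hB T', setSeries_injective hT]
  have hBinf (T : Set ℕ) : (B T).Infinite := by
    rw [Set.infinite_iff_exists_gt]
    intro i
    by_cases hi : i + 1 ∈ T
    · exact ⟨2 * (i + 1), (hB T _).2 hi, by omega⟩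
    · exact ⟨2 * (i + 1) + 1, (hB' T _).2 hi, by omega⟩
  -- If all sparse series were algebraic, the power set of $\mathbb N$ would embed in a countable
  -- set, against Cantor.
  have hcount : Countable (Set ℕ) := by
    have := hc.to_subtype
    refine Function.Injective.countable (f := fun T : Set ℕ =>
      (⟨setSeries (B T), not_not.1 (h _ (mem_sparseSeries_iff.2 ⟨_, hBinf T, rfl⟩))⟩ :
        {f : (ZMod 2)⟦X⟧ | IsAlgebraic (ZMod 2)[X] f})) fun T T' hT => ?_
    exact hinj (congrArg Subtype.val hT)
  obtain ⟨g, hg⟩ := exists_surjective_nat (Set ℕ)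
  exact Function.cantor_surjective g hg

lemma coeff_sq (f : (ZMod 2)⟦X⟧) (k : ℕ) :
    PowerSeries.coeff k (f ^ 2) = if 2 ∣ k then PowerSeries.coeff (k / 2) f else 0 := by
  rw [sq, PowerSeries.coeff_mul_eq_coeff_trunc_mul_trunc f f (Nat.lt_succ_self k)]
  rw [← Polynomial.coe_mul, Polynomial.coeff_coe, ← sq, ← ZMod.expand_card,
    Polynomial.coeff_expand two_pos]
  split_ifs with h
  · rw [PowerSeries.coeff_trunc, if_pos (Nat.lt_succ_of_le (Nat.div_le_self k 2))]
  · rfl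

lemma two_eq_zero : (2 : (ZMod 2)⟦X⟧) = 0 := by
  rw [← map_ofNat (PowerSeries.C (R := ZMod 2)) 2]
  exact (congrArg _ (by decide)).trans (map_zero _)

/-- By Frobenius, squaring turns $x^{2^m}$ into $x^{2^{m+1}}$. So shifting the exponent set down by
one and squaring recovers every term except $x^{2^0}=x$, which the correction cancels in
characteristic 2. -/
lemma setSeries_sq (N : Set ℕ) :
    setSeries {m | m + 1 ∈ N} ^ 2 = setSeries N +
      (if PowerSeries.coeff 1 (setSeries N) ≠ 0 then PowerSeries.X else 0) := by
  ext k
  rw [coeff_sq, map_add, coeff_setSeries, coeff_setSeries, coeff_one_setSeries]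
  have h0 : ((if (if 0 ∈ N then (1 : ZMod 2) else 0) ≠ 0 then PowerSeries.X else 0) :
      (ZMod 2)⟦X⟧) = if 0 ∈ N then PowerSeries.X else 0 := by
    split_ifs <;> simp_all
  rw [h0]
  have h1 : PowerSeries.coeff k (if 0 ∈ N then PowerSeries.X else 0 : (ZMod 2)⟦X⟧) =
      if k = 1 ∧ 0 ∈ N then 1 else 0 := by
    split_ifs with h2 h3 h3 <;> simp_all [PowerSeries.coeff_X]
  rw [h1]
  have h2 : (∃ n ∈ N, k = 2 ^ n) ↔
      (2 ∣ k ∧ ∃ n ∈ {m | m + 1 ∈ N}, k / 2 = 2 ^ n) ∨ (k = 1 ∧ 0 ∈ N) := by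
    constructor
    · rintro ⟨n, hn, rfl⟩
      cases n with
      | zero => exact Or.inr ⟨rfl, hn⟩
      | succ n =>
        refine Or.inl ⟨⟨2 ^ n, by rw [pow_succ, mul_comm]⟩, n, hn, ?_⟩
        rw [pow_succ, Nat.mul_div_cancel _ two_pos]
    · rintro (⟨⟨l, rfl⟩, n, hn, h⟩ | ⟨rfl, h⟩)
      · rw [Nat.mul_div_cancel_left _ two_pos] at h
        exact ⟨n + 1, hn, by rw [h, pow_succ, mul_comm]⟩
      · exact ⟨0, h, rfl⟩
  rw [if_congr h2 rfl rfl]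
  by_cases hk : k = 1 ∧ 0 ∈ N
  · obtain ⟨rfl, h⟩ := hk
    rw [if_neg (by decide), if_pos (Or.inr ⟨rfl, h⟩), if_pos ⟨rfl, h⟩]
    decide
  · rw [if_neg hk, add_zero]
    by_cases hk2 : 2 ∣ k <;> simp [hk2, hk]

/-- Every sparse series starts a unique sequence of iterated square roots. -/
lemma existsUnique_isRootSequence {a : (ZMod 2)⟦X⟧} (ha : a ∈ sparseSeries) :
    ∃! α : ℕ → (ZMod 2)⟦X⟧, α 0 = a ∧ IsRootSequence α := by
  obtain ⟨N, hN, rfl⟩ := mem_sparseSeries_iff.1 ha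
  refine ⟨fun n => setSeries {m | m + n ∈ N}, ⟨rfl, fun n => ?_, fun n => ?_⟩, ?_⟩
  · refine mem_sparseSeries_iff.2 ⟨_, ?_, rfl⟩
    rw [Set.infinite_iff_exists_gt] at hN ⊢
    intro i
    obtain ⟨j, hj, hij⟩ := hN (i + n)
    exact ⟨j - n, by rwa [Set.mem_ofPred_eq, Nat.sub_add_cancel (by omega)], by omega⟩
  · have h := setSeries_sq {m | m + n ∈ N}
    rwa [show {m | m + 1 ∈ {m | m + n ∈ N}} = {m | m + (n + 1) ∈ N} from
      Set.ext fun m => by simp only [Set.mem_ofPred_eq]; rw [add_assoc, add_comm 1 n]] at h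
  · rintro β ⟨h0, hβ⟩
    funext n
    induction n with
    | zero => exact h0
    | succ n ih =>
      have h1 := hβ.sq n
      rw [ih, ← setSeries_sq, sq_eq_sq_iff_eq_or_eq_neg] at h1
      have h2 : β (n + 1) = setSeries {m | m + 1 ∈ {m | m + n ∈ N}} := by
        refine h1.elim id fun h => h.trans ?_
        linear_combination (-setSeries {m | m + 1 ∈ {m | m + n ∈ N}}) * two_eq_zero
      rw [h2]
      congr 1
      ext m
      simp only [Set.mem_ofPred_eq]
      rw [add_assoc, add_comm 1 n]

end SparseSeries


section RootRing

variable {α : ℕ → (ZMod 2)⟦X⟧}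

/-! ### The polynomial rings `𝔽₂[x, αₙ]` and their union -/

lemma val_aeval_xElt (p : (ZMod 2)[X]) :
    (PolyRing α).val (Polynomial.aeval (xElt α) p) = algebraMap (ZMod 2)[X] (ZMod 2)⟦X⟧ p := by
  have h : ((PolyRing α).val.comp (Polynomial.aeval (xElt α))) =
      Polynomial.coeToPowerSeries.algHom (ZMod 2) := by
    refine Polynomial.algHom_ext ?_
    simp [xElt]
  exact DFunLike.congr_fun h p

variable (α) in
/-- The evaluation map `𝔽₂[x][T] → A` at `T = αₙ`. -/
def evalRoot (N : ℕ) : (ZMod 2)[X][X] →+* PolyRing α :=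
  Polynomial.eval₂RingHom (Polynomial.aeval (xElt α)).toRingHom (rootElt α N)

lemma evalRoot_C (N : ℕ) (p : (ZMod 2)[X]) :
    evalRoot α N (Polynomial.C p) = Polynomial.aeval (xElt α) p := by
  simp [evalRoot]

lemma evalRoot_X (N : ℕ) : evalRoot α N Polynomial.X = rootElt α N := by
  simp [evalRoot]

lemma evalRoot_C_X (N : ℕ) : evalRoot α N (Polynomial.C Polynomial.X) = xElt α := by
  rw [evalRoot_C, Polynomial.aeval_X]

lemma val_evalRoot (N : ℕ) (P : (ZMod 2)[X][X]) :
    (PolyRing α).val (evalRoot α N P) = Polynomial.aeval (α N) P := by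
  have h : (PolyRing α).val.toRingHom.comp (evalRoot α N) =
      (Polynomial.aeval (α N) : (ZMod 2)[X][X] →ₐ[(ZMod 2)[X]] _).toRingHom := by
    refine Polynomial.ringHom_ext (fun p => ?_) ?_
    · have h1 : (PolyRing α).val (evalRoot α N (Polynomial.C p)) =
          Polynomial.aeval (α N) (Polynomial.C p) := by
        rw [evalRoot_C, val_aeval_xElt, Polynomial.aeval_C]
      exact h1
    · have h1 : (PolyRing α).val (evalRoot α N Polynomial.X) =
          Polynomial.aeval (R := (ZMod 2)[X]) (α N) Polynomial.X := by
        rw [evalRoot_X, Polynomial.aeval_X]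
        rfl
      exact h1
  exact DFunLike.congr_fun h P

lemma IsRootSequence.rootElt_sq (hα : IsRootSequence α) (n : ℕ) :
    ∃ ε : ZMod 2, rootElt α (n + 1) ^ 2 = rootElt α n + algebraMap _ _ ε * xElt α := by
  classical
  by_cases h : PowerSeries.coeff 1 (α n) ≠ 0
  · refine ⟨1, Subtype.ext ?_⟩
    rw [map_one, one_mul]
    refine (hα.sq n).trans ?_
    rw [if_pos h]
    rfl
  · refine ⟨0, Subtype.ext ?_⟩
    rw [map_zero, zero_mul, add_zero]
    refine (hα.sq n).trans ?_
    rw [if_neg h, add_zero]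
    rfl

/-- Reduction modulo `x`. -/
def redX : (ZMod 2)[X][X] →+* (ZMod 2)[X] :=
  Polynomial.mapRingHom (Polynomial.evalRingHom 0)

lemma exists_eq_C_X_mul {P : (ZMod 2)[X][X]} (h : redX P = 0) :
    ∃ Q, P = Polynomial.C Polynomial.X * Q := by
  refine (Polynomial.C_dvd_iff_dvd_coeff _ _).2 fun i => ?_
  rw [Polynomial.X_dvd_iff, Polynomial.coeff_zero_eq_eval_zero]
  have h1 := congrArg (fun p => Polynomial.coeff p i) h
  simpa [redX] using h1

/-- Substituting $\alpha_m=\alpha_{m+1}^2-\varepsilon x$ repeatedly expresses $\alpha_n$ as a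
polynomial in $x$ and $\alpha_{n+k}$; the corrections vanish modulo $x$. This leading form drives
all computations in $A/(x)$. -/
lemma IsRootSequence.exists_evalRoot_eq_rootElt (hα : IsRootSequence α) (n k : ℕ) :
    ∃ P, evalRoot α (n + k) P = rootElt α n ∧ redX P = Polynomial.X ^ 2 ^ k := by
  induction k with
  | zero => exact ⟨Polynomial.X, evalRoot_X n, by simp [redX]⟩
  | succ k ih =>
    obtain ⟨P, hP, hP'⟩ := ih
    obtain ⟨ε, hε⟩ := hα.rootElt_sq (n + k)
    let t : (ZMod 2)[X][X] := Polynomial.X ^ 2 -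
      Polynomial.C (Polynomial.C ε * Polynomial.X)
    have ht : evalRoot α (n + (k + 1)) t = rootElt α (n + k) := by
      rw [map_sub, map_pow, evalRoot_X, evalRoot_C, map_mul, Polynomial.aeval_C,
        Polynomial.aeval_X, ← add_assoc, hε, add_sub_cancel_right]
    refine ⟨P.comp t, ?_, ?_⟩
    · rw [← hP, evalRoot, Polynomial.coe_eval₂RingHom, Polynomial.eval₂_comp]
      congr 1
    · have h1 : redX t = Polynomial.X ^ 2 := by simp [redX, t]
      change (P.comp t).map _ = _
      rw [Polynomial.map_comp]
      change (redX P).comp (redX t) = _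
      rw [hP', h1, Polynomial.X_pow_comp, ← pow_mul, pow_succ']

lemma IsRootSequence.exists_evalRoot_eq (hα : IsRootSequence α) (a : PolyRing α) :
    ∃ N₀, ∀ N ≥ N₀, ∃ P, evalRoot α N P = a := by
  obtain ⟨a, ha⟩ := a
  induction ha using Algebra.adjoin_induction with
  | mem a ha =>
    rcases ha with rfl | ⟨n, rfl⟩
    · exact ⟨0, fun N _ => ⟨_, evalRoot_C_X N⟩⟩
    · refine ⟨n, fun N hN => ?_⟩
      obtain ⟨k, rfl⟩ := Nat.exists_eq_add_of_le hN
      obtain ⟨P, hP, -⟩ := hα.exists_evalRoot_eq_rootElt n k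
      exact ⟨P, hP⟩
  | algebraMap r =>
    exact ⟨0, fun N _ => ⟨Polynomial.C (Polynomial.C r), by
      rw [evalRoot_C, Polynomial.aeval_C]; rfl⟩⟩
  | add a b ha hb iha ihb =>
    obtain ⟨N, hN⟩ := iha
    obtain ⟨M, hM⟩ := ihb
    refine ⟨max N M, fun k hk => ?_⟩
    obtain ⟨P, hP⟩ := hN k (le_of_max_le_left hk)
    obtain ⟨Q, hQ⟩ := hM k (le_of_max_le_right hk)
    exact ⟨P + Q, by rw [map_add, hP, hQ]; rfl⟩
  | mul a b ha hb iha ihb =>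
    obtain ⟨N, hN⟩ := iha
    obtain ⟨M, hM⟩ := ihb
    refine ⟨max N M, fun k hk => ?_⟩
    obtain ⟨P, hP⟩ := hN k (le_of_max_le_left hk)
    obtain ⟨Q, hQ⟩ := hM k (le_of_max_le_right hk)
    exact ⟨P * Q, by rw [map_mul, hP, hQ]; rfl⟩

lemma IsRootSequence.transcendental (hα : IsRootSequence α)
    (h : Transcendental (ZMod 2)[X] (α 0)) (n : ℕ) : Transcendental (ZMod 2)[X] (α n) := by
  classical
  induction n with
  | zero => exact h
  | succ n ih =>
    intro hn
    refine ih ?_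
    have h1 : α n = α (n + 1) ^ 2 -
        (if PowerSeries.coeff 1 (α n) ≠ 0 then PowerSeries.X else 0) := by
      rw [hα.sq n, add_sub_cancel_right]
    rw [h1]
    refine (hn.pow 2).sub ?_
    split_ifs
    · have h2 := isAlgebraic_algebraMap (A := (ZMod 2)⟦X⟧) (Polynomial.X : (ZMod 2)[X])
      rwa [← val_aeval_xElt (α := α), Polynomial.aeval_X] at h2
    · exact isAlgebraic_zero

lemma IsRootSequence.evalRoot_injective (hα : IsRootSequence α)
    (h : Transcendental (ZMod 2)[X] (α 0)) (N : ℕ) : Function.Injective (evalRoot α N) := by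
  rw [injective_iff_map_eq_zero]
  intro P hP
  refine (transcendental_iff.1 (hα.transcendental h N)) P ?_
  rw [← val_evalRoot, hP, map_zero]

variable (α) in
/-- The constant coefficient of an element of `A`. -/
def constA : PolyRing α →+* ZMod 2 := PowerSeries.constantCoeff.comp (PolyRing α).val.toRingHom

lemma constA_xElt : constA α (xElt α) = 0 := PowerSeries.constantCoeff_X

lemma IsRootSequence.constA_rootElt (hα : IsRootSequence α) (n : ℕ) :
    constA α (rootElt α n) = 0 := constantCoeff_of_mem_sparseSeries (hα.mem n)

lemma IsRootSequence.constA_evalRoot (hα : IsRootSequence α) (N : ℕ) (P : (ZMod 2)[X][X]) :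
    constA α (evalRoot α N P) = (redX P).eval 0 := by
  have h : (constA α).comp (evalRoot α N) = (Polynomial.evalRingHom 0).comp redX := by
    refine Polynomial.ringHom_ext (fun p => ?_) ?_
    · simp only [RingHom.comp_apply]
      rw [evalRoot_C]
      have h1 : (constA α).comp (Polynomial.aeval (xElt α)).toRingHom =
          Polynomial.evalRingHom 0 := by
        refine Polynomial.ringHom_ext (fun r => ?_) ?_
        · exact (congrArg (constA α) (Polynomial.aeval_C (xElt α) r)).trans (by
            rw [Polynomial.coe_evalRingHom, Polynomial.eval_C]
            exact PowerSeries.constantCoeff_C r)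
        · exact (congrArg (constA α) (Polynomial.aeval_X (xElt α))).trans (by
            rw [Polynomial.coe_evalRingHom, Polynomial.eval_X, constA_xElt])
      refine (DFunLike.congr_fun h1 p).trans ?_
      simp [redX]
    · simp only [RingHom.comp_apply]
      rw [evalRoot_X, hα.constA_rootElt]
      simp [redX]
  exact DFunLike.congr_fun h P

lemma constA_surjective : Function.Surjective (constA α) := ZMod.ringHom_surjective _

lemma ker_constA : RingHom.ker (constA α) = centerIdeal α := by
  ext a
  rw [RingHom.mem_ker, centerIdeal, Ideal.mem_comap, Ideal.mem_span_singleton,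
    PowerSeries.X_dvd_iff]
  rfl

lemma mem_centerIdeal_iff {a : PolyRing α} : a ∈ centerIdeal α ↔ constA α a = 0 := by
  rw [← ker_constA, RingHom.mem_ker]

lemma centerIdeal_isMaximal : (centerIdeal α).IsMaximal := by
  rw [← ker_constA]
  exact RingHom.ker_isMaximal_of_surjective _ constA_surjective

lemma IsRootSequence.centerIdeal_eq (hα : IsRootSequence α) :
    centerIdeal α = Ideal.span (insert (xElt α) (Set.range (rootElt α))) := by
  apply le_antisymm
  · intro a ha
    obtain ⟨N, hN⟩ := hα.exists_evalRoot_eq a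
    obtain ⟨P, rfl⟩ := hN N le_rfl
    rw [mem_centerIdeal_iff, hα.constA_evalRoot] at ha
    have h1 : (P.coeff 0).coeff 0 = 0 := by
      rw [← ha, ← Polynomial.coeff_zero_eq_eval_zero, redX, Polynomial.coe_mapRingHom,
        Polynomial.coeff_map, Polynomial.coe_evalRingHom, Polynomial.coeff_zero_eq_eval_zero]
    rw [← Polynomial.divX_mul_X_add P, ← Polynomial.divX_mul_X_add (P.coeff 0), h1]
    simp only [map_add, map_mul, evalRoot_X, map_zero, add_zero, evalRoot_C_X]
    exact add_mem (Ideal.mul_mem_left _ _ (Ideal.subset_span (Set.mem_insert_of_mem _ ⟨N, rfl⟩)))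
      (Ideal.mul_mem_left _ _ (Ideal.subset_span (Set.mem_insert _ _)))
  · rw [Ideal.span_le]
    rintro a (rfl | ⟨n, rfl⟩)
    · exact mem_centerIdeal_iff.2 constA_xElt
    · exact mem_centerIdeal_iff.2 (hα.constA_rootElt n)

/-- The classes of the roots modulo `x` are regular. -/
lemma IsRootSequence.xElt_dvd_of_rootElt_mul (hα : IsRootSequence α)
    (h : Transcendental (ZMod 2)[X] (α 0)) (n : ℕ) {u : PolyRing α}
    (hu : xElt α ∣ rootElt α n * u) : xElt α ∣ u := by
  obtain ⟨w, hw⟩ := hu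
  obtain ⟨N, hN⟩ := hα.exists_evalRoot_eq u
  obtain ⟨M, hM⟩ := hα.exists_evalRoot_eq w
  obtain ⟨P, rfl⟩ := hN (n + (N + M)) (by omega)
  obtain ⟨Q, rfl⟩ := hM (n + (N + M)) (by omega)
  obtain ⟨T, hT, hT'⟩ := hα.exists_evalRoot_eq_rootElt n (N + M)
  rw [← hT, ← evalRoot_C_X (n + (N + M)), ← map_mul, ← map_mul] at hw
  have h1 := congrArg redX (hα.evalRoot_injective h _ hw)
  have h2 : redX (Polynomial.C Polynomial.X) = 0 := by simp [redX]
  rw [map_mul, map_mul, hT', h2, zero_mul] at h1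
  obtain ⟨P', rfl⟩ := exists_eq_C_X_mul
    ((mul_eq_zero.1 h1).resolve_left (pow_ne_zero _ Polynomial.X_ne_zero))
  exact ⟨evalRoot α _ P', by rw [map_mul, evalRoot_C_X]⟩

/-- Write everything in $\mathbb F_2[x,T]$ with $T=\alpha_{1+k}$ and reduce modulo $x$. There
$\alpha_1=T^{2^k}$ and $\alpha_0=T^{2^{k+1}}$; cancelling shows that $s$ is divisible by $T^{2^k}$.
-/
lemma IsRootSequence.constA_eq_zero_of_mul_rootElt_one (hα : IsRootSequence α)
    (h : Transcendental (ZMod 2)[X] (α 0)) {s a b : PolyRing α}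
    (hs : s * rootElt α 1 = a * xElt α + b * rootElt α 0) : constA α s = 0 := by
  obtain ⟨N₁, h₁⟩ := hα.exists_evalRoot_eq s
  obtain ⟨N₂, h₂⟩ := hα.exists_evalRoot_eq a
  obtain ⟨N₃, h₃⟩ := hα.exists_evalRoot_eq b
  let k := N₁ + N₂ + N₃
  obtain ⟨P₁, rfl⟩ := h₁ (1 + k) (by omega)
  obtain ⟨P₂, rfl⟩ := h₂ (1 + k) (by omega)
  obtain ⟨P₃, rfl⟩ := h₃ (1 + k) (by omega)
  obtain ⟨T₁, hT₁, hT₁'⟩ := hα.exists_evalRoot_eq_rootElt 1 k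
  obtain ⟨T₀, hT₀, hT₀'⟩ := hα.exists_evalRoot_eq_rootElt 0 (1 + k)
  rw [zero_add] at hT₀
  rw [← hT₁, ← hT₀, ← evalRoot_C_X (1 + k), ← map_mul, ← map_mul, ← map_mul, ← map_add] at hs
  have h1 := congrArg redX (hα.evalRoot_injective h _ hs)
  have h2 : redX (Polynomial.C Polynomial.X) = 0 := by simp [redX]
  have h4 : (Polynomial.X : (ZMod 2)[X]) ^ 2 ^ (1 + k) =
      Polynomial.X ^ 2 ^ k * Polynomial.X ^ 2 ^ k := by
    rw [pow_add 2 1 k, pow_one, two_mul, pow_add]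
  rw [map_mul, map_add, map_mul, map_mul, hT₁', hT₀', h2, mul_zero, zero_add, h4,
    ← mul_assoc] at h1
  have h3 := mul_right_cancel₀ (pow_ne_zero _ Polynomial.X_ne_zero) h1
  rw [hα.constA_evalRoot, h3]
  simp

end RootRing


section LocalRing

variable {α : ℕ → (ZMod 2)⟦X⟧}

/-! ### The local ring `R` -/

lemma isUnit_val_of_mem_primeCompl (y : (centerIdeal α).primeCompl) :
    IsUnit ((PolyRing α).val.toRingHom y) := by
  rw [PowerSeries.isUnit_iff_constantCoeff]
  exact isUnit_iff_ne_zero.2 fun h => y.2 (mem_centerIdeal_iff.2 h)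

variable (α) in
/-- The embedding of `R` in the power series ring. -/
def toSeries : ExRing α →+* (ZMod 2)⟦X⟧ :=
  IsLocalization.lift (M := (centerIdeal α).primeCompl) (g := (PolyRing α).val.toRingHom)
    isUnit_val_of_mem_primeCompl

lemma toSeries_algebraMap (a : PolyRing α) : toSeries α (algebraMap _ _ a) = a :=
  IsLocalization.lift_eq _ a

lemma exists_mul_eq_algebraMap (r : ExRing α) :
    ∃ (a s : PolyRing α), constA α s ≠ 0 ∧ r * algebraMap _ _ s = algebraMap _ _ a := by
  obtain ⟨⟨a, s⟩, h⟩ := IsLocalization.surj (centerIdeal α).primeCompl r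
  exact ⟨a, s, fun h0 => s.2 (mem_centerIdeal_iff.2 h0), h⟩

lemma isUnit_algebraMap_iff {s : PolyRing α} :
    IsUnit (algebraMap (PolyRing α) (ExRing α) s) ↔ constA α s ≠ 0 := by
  rw [IsLocalization.AtPrime.isUnit_to_map_iff (ExRing α) (centerIdeal α)]
  exact not_congr mem_centerIdeal_iff

lemma toSeries_injective : Function.Injective (toSeries α) := by
  rw [injective_iff_map_eq_zero]
  intro r hr
  obtain ⟨a, s, hs, h⟩ := exists_mul_eq_algebraMap r
  have h1 := congrArg (toSeries α) h
  rw [map_mul, hr, zero_mul, toSeries_algebraMap] at h1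
  have h2 : a = 0 := Subtype.ext h1.symm
  rw [h2, map_zero] at h
  exact (isUnit_algebraMap_iff.2 hs).mul_left_eq_zero.1 h

lemma algebraMap_injective : Function.Injective (algebraMap (PolyRing α) (ExRing α)) :=
  fun a b h => Subtype.ext (by rw [← toSeries_algebraMap, h, toSeries_algebraMap])

instance : IsLocalHom (toSeries α) where
  map_nonunit r hr := by
    obtain ⟨a, s, hs, h⟩ := exists_mul_eq_algebraMap r
    have h1 := congrArg (toSeries α) h
    rw [map_mul, toSeries_algebraMap, toSeries_algebraMap] at h1
    have h2 : IsUnit (a : (ZMod 2)⟦X⟧) := by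
      rw [← h1]
      exact hr.mul (PowerSeries.isUnit_iff_constantCoeff.2 (isUnit_iff_ne_zero.2 hs))
    have h3 : IsUnit (algebraMap (PolyRing α) (ExRing α) a) :=
      isUnit_algebraMap_iff.2 ((PowerSeries.isUnit_iff_constantCoeff.1 h2).ne_zero)
    rw [← h] at h3
    exact isUnit_of_mul_isUnit_left h3

instance : IsDomain (ExRing α) := toSeries_injective.isDomain (toSeries α)

lemma mem_maximalIdeal_iff {r : ExRing α} :
    r ∈ IsLocalRing.maximalIdeal (ExRing α) ↔ PowerSeries.X ∣ toSeries α r := by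
  rw [IsLocalRing.mem_maximalIdeal, mem_nonunits_iff, ← isUnit_map_iff (toSeries α),
    PowerSeries.X_dvd_iff, PowerSeries.isUnit_iff_constantCoeff, isUnit_iff_ne_zero, not_not]

lemma iInf_maximalIdeal_pow : (⨅ n : ℕ, IsLocalRing.maximalIdeal (ExRing α) ^ n) = ⊥ := by
  rw [eq_bot_iff]
  intro r hr
  rw [Submodule.mem_iInf] at hr
  have h (n : ℕ) : (PowerSeries.X : (ZMod 2)⟦X⟧) ^ n ∣ toSeries α r := by
    have h1 : IsLocalRing.maximalIdeal (ExRing α) ≤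
        (Ideal.span {(PowerSeries.X : (ZMod 2)⟦X⟧)}).comap (toSeries α) := fun y hy =>
      Ideal.mem_comap.2 (Ideal.mem_span_singleton.2 (mem_maximalIdeal_iff.1 hy))
    have h2 := (Ideal.pow_right_mono h1 n).trans (Ideal.le_comap_pow _ n) (hr n)
    rwa [Ideal.mem_comap, Ideal.span_singleton_pow, Ideal.mem_span_singleton] at h2
  refine (Submodule.mem_bot _).2 (toSeries_injective ?_)
  rw [map_zero]
  ext n
  exact PowerSeries.X_pow_dvd_iff.1 (h (n + 1)) n (Nat.lt_succ_self n)

variable (α) in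
/-- The element `αₙ` of `R`. -/
def rootR (n : ℕ) : ExRing α := algebraMap (PolyRing α) (ExRing α) (rootElt α n)

lemma toSeries_xR : toSeries α (xR α) = PowerSeries.X := toSeries_algebraMap _

lemma toSeries_rootR (n : ℕ) : toSeries α (rootR α n) = α n := toSeries_algebraMap _

lemma xR_ne_zero : xR α ≠ 0 := fun h => by
  have h1 := toSeries_xR (α := α)
  rw [h, map_zero] at h1
  exact PowerSeries.X_ne_zero h1.symm

lemma two_ExRing_eq_zero : (2 : ExRing α) = 0 :=
  toSeries_injective (by rw [map_ofNat, map_zero, two_eq_zero])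

lemma IsRootSequence.rootR_eq (hα : IsRootSequence α) :
    ∃ e : ℕ → ℤ, ∀ n, rootR α n = rootR α (n + 1) ^ 2 + e n * xR α := by
  have h (n : ℕ) : ∃ m : ℤ, rootR α n = rootR α (n + 1) ^ 2 + m * xR α := by
    obtain ⟨ε, hε⟩ := hα.rootElt_sq n
    obtain ⟨m, rfl⟩ := ZMod.intCast_surjective ε
    refine ⟨-m, ?_⟩
    rw [rootR, rootR, xR, ← map_pow, hε, map_intCast, map_add, map_mul, map_intCast]
    push_cast
    ring
  exact ⟨_, fun n => (h n).choose_spec⟩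

lemma IsRootSequence.rootR_mem (hα : IsRootSequence α) (n : ℕ) :
    rootR α n ∈ IsLocalRing.maximalIdeal (ExRing α) := by
  rw [mem_maximalIdeal_iff, toSeries_rootR, PowerSeries.X_dvd_iff]
  exact constantCoeff_of_mem_sparseSeries (hα.mem n)

lemma xR_mem : xR α ∈ IsLocalRing.maximalIdeal (ExRing α) := by
  rw [mem_maximalIdeal_iff, toSeries_xR]

lemma IsRootSequence.maximalIdeal_eq (hα : IsRootSequence α) :
    IsLocalRing.maximalIdeal (ExRing α) =
      Ideal.span (insert (xR α) (Set.range (rootR α))) := by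
  apply le_antisymm
  · intro r hr
    obtain ⟨a, s, hs, h⟩ := exists_mul_eq_algebraMap r
    rw [← Ideal.mul_unit_mem_iff_mem _ (isUnit_algebraMap_iff.2 hs), h]
    have h1 : a ∈ centerIdeal α := by
      by_contra ha
      have h2 := isUnit_algebraMap_iff.2 (fun h0 => ha (mem_centerIdeal_iff.2 h0))
      rw [← h] at h2
      exact hr (isUnit_of_mul_isUnit_left h2)
    rw [hα.centerIdeal_eq] at h1
    have h2 := Ideal.mem_map_of_mem (algebraMap (PolyRing α) (ExRing α)) h1
    rwa [Ideal.map_span, Set.image_insert_eq, ← Set.range_comp] at h2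
  · rw [Ideal.span_le]
    rintro a (rfl | ⟨n, rfl⟩)
    · exact xR_mem
    · exact hα.rootR_mem n

lemma IsRootSequence.mem_span_xR_of_rootR_mul (hα : IsRootSequence α)
    (h : Transcendental (ZMod 2)[X] (α 0)) (n : ℕ) {v : ExRing α}
    (hv : rootR α n * v ∈ Ideal.span {xR α}) : v ∈ Ideal.span {xR α} := by
  rw [Ideal.mem_span_singleton] at hv ⊢
  obtain ⟨w, hw⟩ := hv
  obtain ⟨a, s, hs, hv⟩ := exists_mul_eq_algebraMap v
  obtain ⟨b, t, ht, hw'⟩ := exists_mul_eq_algebraMap w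
  have h1 : rootElt α n * (a * t) = xElt α * (b * s) := by
    apply algebraMap_injective
    simp only [map_mul]
    rw [← hv, ← hw']
    change rootR α n * (v * algebraMap _ _ s * algebraMap _ _ t) =
      xR α * (w * algebraMap _ _ t * algebraMap _ _ s)
    linear_combination (algebraMap _ (ExRing α) s * algebraMap _ _ t) * hw
  obtain ⟨u, hu⟩ := hα.xElt_dvd_of_rootElt_mul h n ⟨_, h1⟩
  have h2 : xR α ∣ v * (algebraMap _ _ s * algebraMap _ _ t) := by
    refine ⟨algebraMap _ _ u, ?_⟩
    rw [← mul_assoc, hv, ← map_mul, hu, map_mul]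
    rfl
  exact ((isUnit_algebraMap_iff.2 hs).mul (isUnit_algebraMap_iff.2 ht)).dvd_mul_right.1 h2

lemma one_notMem_span_xR : (1 : ExRing α) ∉ Ideal.span {xR α} := fun h1 =>
  (Ideal.ne_top_iff_one _).1 (IsLocalRing.maximalIdeal.isMaximal (ExRing α)).ne_top
    ((Ideal.span_singleton_le_iff_mem _).2 xR_mem h1)

lemma IsRootSequence.rootR_notMem_span_xR (hα : IsRootSequence α)
    (h : Transcendental (ZMod 2)[X] (α 0)) (n : ℕ) : rootR α n ∉ Ideal.span {xR α} := fun h1 =>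
  one_notMem_span_xR (hα.mem_span_xR_of_rootR_mul h n (v := 1) (by rwa [mul_one]))

/-- Clearing denominators in a relation over $R$ would give one over $A$ whose coefficient of
$\alpha_1$ has non-zero constant term. -/
lemma IsRootSequence.rootR_one_notMem (hα : IsRootSequence α)
    (h : Transcendental (ZMod 2)[X] (α 0)) :
    rootR α 1 ∉ Ideal.span {xR α, rootR α 0} := fun h1 => by
  obtain ⟨p, q, hpq⟩ := Ideal.mem_span_pair.1 h1
  obtain ⟨a, s, hs, hp⟩ := exists_mul_eq_algebraMap p
  obtain ⟨b, t, ht, hq⟩ := exists_mul_eq_algebraMap q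
  have h2 : (s * t) * rootElt α 1 = (a * t) * xElt α + (b * s) * rootElt α 0 := by
    apply algebraMap_injective
    simp only [map_mul, map_add]
    rw [← hp, ← hq]
    change _ * rootR α 1 = _ * xR α + _ * rootR α 0
    linear_combination (-algebraMap _ (ExRing α) s * algebraMap _ _ t) * hpq
  have h3 := hα.constA_eq_zero_of_mul_rootElt_one h h2
  rw [map_mul] at h3
  exact mul_ne_zero hs ht h3

/-- The maximal ideal of `R/(x)` is non-zero and idempotent. -/
lemma IsRootSequence.quotient_local (hα : IsRootSequence α)
    (h : Transcendental (ZMod 2)[X] (α 0)) :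
    ∃ _ : IsLocalRing (ExRing α ⧸ Ideal.span {xR α}),
      IsLocalRing.maximalIdeal (ExRing α ⧸ Ideal.span {xR α}) ≠ ⊥ ∧
      IsIdempotentElem (IsLocalRing.maximalIdeal (ExRing α ⧸ Ideal.span {xR α})) := by
  have : Nontrivial (ExRing α ⧸ Ideal.span {xR α}) :=
    Ideal.Quotient.nontrivial_iff.2 ((Ideal.ne_top_iff_one _).2 one_notMem_span_xR)
  have hL : IsLocalRing (ExRing α ⧸ Ideal.span {xR α}) :=
    IsLocalRing.of_surjective' (Ideal.Quotient.mk _) Ideal.Quotient.mk_surjective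
  have hmem (n : ℕ) : Ideal.Quotient.mk (Ideal.span {xR α}) (rootR α n) ∈
      IsLocalRing.maximalIdeal (ExRing α ⧸ Ideal.span {xR α}) := fun hu => by
    obtain ⟨y, hy⟩ := hu.exists_right_inv
    obtain ⟨y, rfl⟩ := Ideal.Quotient.mk_surjective y
    rw [← map_mul, ← map_one (Ideal.Quotient.mk _), Ideal.Quotient.eq] at hy
    refine (Ideal.ne_top_iff_one _).1 (IsLocalRing.maximalIdeal.isMaximal (ExRing α)).ne_top ?_
    rw [← sub_sub_cancel (rootR α n * y) 1]
    exact sub_mem (Ideal.mul_mem_right _ _ (hα.rootR_mem n))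
      ((Ideal.span_singleton_le_iff_mem _).2 xR_mem hy)
  refine ⟨hL, fun hbot => ?_, ?_⟩
  · have h1 := hmem 0
    rw [hbot, Ideal.mem_bot, Ideal.Quotient.eq_zero_iff_mem] at h1
    exact hα.rootR_notMem_span_xR h 0 h1
  · refine le_antisymm Ideal.mul_le_right ?_
    intro y hy
    obtain ⟨r, rfl⟩ := Ideal.Quotient.mk_surjective y
    have hr : r ∈ IsLocalRing.maximalIdeal (ExRing α) := fun hu => hy (hu.map _)
    rw [hα.maximalIdeal_eq] at hr
    obtain ⟨e, he⟩ := hα.rootR_eq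
    have hx : Ideal.Quotient.mk (Ideal.span {xR α}) (xR α) = 0 :=
      Ideal.Quotient.eq_zero_iff_mem.2 (Ideal.mem_span_singleton_self _)
    have h2 : Ideal.span (insert (xR α) (Set.range (rootR α))) ≤
        (IsLocalRing.maximalIdeal (ExRing α ⧸ Ideal.span {xR α}) *
          IsLocalRing.maximalIdeal (ExRing α ⧸ Ideal.span {xR α})).comap
            (Ideal.Quotient.mk _) := by
      rw [Ideal.span_le]
      rintro a (rfl | ⟨n, rfl⟩)
      · rw [SetLike.mem_coe, Ideal.mem_comap, hx]
        exact zero_mem _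
      · rw [SetLike.mem_coe, Ideal.mem_comap, he n, map_add, map_mul, hx, mul_zero, add_zero,
          map_pow, pow_two]
        exact Ideal.mul_mem_mul (hmem _) (hmem _)
    exact h2 hr

end LocalRing


/-! ### The pseudoflat epimorphism $R\to S$. -/

section EpiRing

variable {α : ℕ → (ZMod 2)⟦X⟧}

/-! ### The ring `S` of power series which are fractions of elements of `R` -/

variable (α) in
/-- The intersection of the ring of power series with the field of fractions of `R`. -/
def fracSubring : Subring (ZMod 2)⟦X⟧ where
  carrier := {f | ∃ s ∈ PolyRing α, s ≠ 0 ∧ s * f ∈ PolyRing α}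
  mul_mem' := by
    rintro f g ⟨s, hs, hs0, hf⟩ ⟨t, ht, ht0, hg⟩
    refine ⟨s * t, mul_mem hs ht, mul_ne_zero hs0 ht0, ?_⟩
    rw [mul_mul_mul_comm]
    exact mul_mem hf hg
  one_mem' := ⟨1, one_mem _, one_ne_zero, by simp⟩
  add_mem' := by
    rintro f g ⟨s, hs, hs0, hf⟩ ⟨t, ht, ht0, hg⟩
    refine ⟨s * t, mul_mem hs ht, mul_ne_zero hs0 ht0, ?_⟩
    rw [show s * t * (f + g) = t * (s * f) + s * (t * g) by ring]
    exact add_mem (mul_mem ht hf) (mul_mem hs hg)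
  zero_mem' := ⟨1, one_mem _, one_ne_zero, by simp⟩
  neg_mem' := by
    rintro f ⟨s, hs, hs0, hf⟩
    exact ⟨s, hs, hs0, by rw [mul_neg]; exact neg_mem hf⟩

lemma mem_fracSubring_of_mem {a : (ZMod 2)⟦X⟧} (ha : a ∈ PolyRing α) : a ∈ fracSubring α :=
  ⟨1, one_mem _, one_ne_zero, by rwa [one_mul]⟩

lemma X_mem_fracSubring : (PowerSeries.X : (ZMod 2)⟦X⟧) ∈ fracSubring α :=
  mem_fracSubring_of_mem (xElt α).2

lemma mem_fracSubring_of_mul_mem {f g : (ZMod 2)⟦X⟧} (hg : g ∈ fracSubring α) (hg0 : g ≠ 0)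
    (h : g * f ∈ fracSubring α) : f ∈ fracSubring α := by
  obtain ⟨s, hs, hs0, hgf⟩ := h
  obtain ⟨t, ht, ht0, hg'⟩ := hg
  refine ⟨s * (t * g), mul_mem hs hg', mul_ne_zero hs0 (mul_ne_zero ht0 hg0), ?_⟩
  rw [show s * (t * g) * f = t * (s * (g * f)) by ring]
  exact mul_mem ht hgf

lemma toSeries_mem_fracSubring (r : ExRing α) : toSeries α r ∈ fracSubring α := by
  obtain ⟨a, s, hs, h⟩ := exists_mul_eq_algebraMap r
  have h1 := congrArg (toSeries α) h
  rw [map_mul, toSeries_algebraMap, toSeries_algebraMap] at h1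
  refine ⟨s, s.2, fun h0 => hs ?_, ?_⟩
  · rw [show s = 0 from Subtype.ext h0, map_zero]
  · rw [mul_comm, h1]
    exact a.2

variable (α) in
/-- The ring `S`. -/
abbrev FracRing : Type := fracSubring α

variable (α) in
/-- The inclusion `R → S`. -/
def toFracRing : ExRing α →+* FracRing α :=
  (toSeries α).codRestrict (fracSubring α) toSeries_mem_fracSubring

instance instAlgebraFracRing : Algebra (ExRing α) (FracRing α) := (toFracRing α).toAlgebra

lemma coe_algebraMap_fracRing (r : ExRing α) :
    ((algebraMap (ExRing α) (FracRing α) r : FracRing α) : (ZMod 2)⟦X⟧) = toSeries α r := rfl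

lemma algebraMap_fracRing_injective : Function.Injective (algebraMap (ExRing α) (FracRing α)) :=
  fun _ _ h => toSeries_injective (congrArg Subtype.val h)

instance isLocalHom_fracSubring_subtype : IsLocalHom (fracSubring α).subtype where
  map_nonunit u hu := by
    obtain ⟨v, hv⟩ := hu.exists_right_inv
    have h : (u : (ZMod 2)⟦X⟧) ≠ 0 := hu.ne_zero
    have h1 : v ∈ fracSubring α :=
      mem_fracSubring_of_mul_mem u.2 h (by
        have h2 : (u : (ZMod 2)⟦X⟧) * v = 1 := hv
        rw [h2]
        exact one_mem _)
    exact IsUnit.of_mul_eq_one (⟨v, h1⟩ : FracRing α) (Subtype.ext hv)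

instance isLocalRing_fracRing : IsLocalRing (FracRing α) :=
  RingHom.domain_isLocalRing (fracSubring α).subtype

instance isLocalHom_algebraMap_fracRing : IsLocalHom (algebraMap (ExRing α) (FracRing α)) := by
  have : IsLocalHom ((fracSubring α).subtype.comp (algebraMap (ExRing α) (FracRing α))) :=
    inferInstanceAs (IsLocalHom (toSeries α))
  exact isLocalHom_of_comp _ (fracSubring α).subtype

lemma isUnit_fracRing_iff {u : FracRing α} :
    IsUnit u ↔ PowerSeries.constantCoeff (u : (ZMod 2)⟦X⟧) ≠ 0 := by
  rw [← isUnit_map_iff (fracSubring α).subtype, Subring.subtype_apply,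
    PowerSeries.isUnit_iff_constantCoeff, isUnit_iff_ne_zero]

variable (α) in
/-- The element `x` of `S`. -/
def xS : FracRing α := algebraMap (ExRing α) (FracRing α) (xR α)

lemma coe_xS : (xS α : (ZMod 2)⟦X⟧) = PowerSeries.X := toSeries_xR

lemma xS_ne_zero : xS α ≠ 0 := fun h =>
  PowerSeries.X_ne_zero (R := ZMod 2) (by rw [← coe_xS (α := α), h]; rfl)

lemma exists_eq_xS_mul {u : FracRing α}
    (hu : PowerSeries.constantCoeff (u : (ZMod 2)⟦X⟧) = 0) : ∃ v, u = xS α * v := by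
  obtain ⟨v, hv⟩ := PowerSeries.X_dvd_iff.2 hu
  have h1 : v ∈ fracSubring α :=
    mem_fracSubring_of_mul_mem X_mem_fracSubring PowerSeries.X_ne_zero (hv ▸ u.2)
  exact ⟨⟨v, h1⟩, Subtype.ext (by rw [Subring.coe_mul, coe_xS]; exact hv)⟩

/-- $R$ already surjects onto the residue field $\mathbb F_2$ of $S$, and a series in $S$ without
constant term is divisible by $x$ inside $S$. -/
lemma exists_eq_algebraMap_add (u : FracRing α) :
    ∃ (r : ExRing α) (v : FracRing α), u = algebraMap _ _ r + xS α * v := by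
  obtain ⟨c, hc⟩ := constA_surjective (α := α) (PowerSeries.constantCoeff (u : (ZMod 2)⟦X⟧))
  obtain ⟨v, hv⟩ := exists_eq_xS_mul (u := u - algebraMap (ExRing α) _ (algebraMap _ _ c)) (by
    rw [AddSubgroupClass.coe_sub, map_sub, coe_algebraMap_fracRing, toSeries_algebraMap, ← hc]
    exact sub_self _)
  exact ⟨_, v, by rw [← hv, add_sub_cancel]⟩

lemma exists_eq_xS_pow_mul_of_coeff_ne_zero (n : ℕ) :
    ∀ u : FracRing α, PowerSeries.coeff n (u : (ZMod 2)⟦X⟧) ≠ 0 →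
      ∃ (k : ℕ) (v : FracRing α), IsUnit v ∧ u = xS α ^ k * v := by
  induction n with
  | zero => 
    refine fun u hu => ⟨0, u, isUnit_fracRing_iff.2 ?_, by rw [pow_zero, one_mul]⟩
    rwa [← PowerSeries.coeff_zero_eq_constantCoeff_apply]
  | succ n ih =>
    intro u hu
    by_cases h0 : PowerSeries.constantCoeff (u : (ZMod 2)⟦X⟧) = 0
    · obtain ⟨v, rfl⟩ := exists_eq_xS_mul h0
      rw [Subring.coe_mul, coe_xS, PowerSeries.coeff_succ_X_mul] at hu
      obtain ⟨k, w, hw, rfl⟩ := ih v hu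
      exact ⟨k + 1, w, hw, by rw [pow_succ', mul_assoc]⟩
    · exact ⟨0, u, isUnit_fracRing_iff.2 h0, by rw [pow_zero, one_mul]⟩

lemma exists_eq_xS_pow_mul {u : FracRing α} (hu : u ≠ 0) :
    ∃ (k : ℕ) (v : FracRing α), IsUnit v ∧ u = xS α ^ k * v := by
  have h : (u : (ZMod 2)⟦X⟧) ≠ 0 := fun h => hu (Subtype.ext h)
  obtain ⟨n, hn⟩ := PowerSeries.exists_coeff_ne_zero_iff_ne_zero.2 h
  exact exists_eq_xS_pow_mul_of_coeff_ne_zero n u hn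

lemma exists_algebraMap_mul_eq (u : FracRing α) :
    ∃ (s r : ExRing α), s ≠ 0 ∧ algebraMap _ _ s * u = algebraMap (ExRing α) (FracRing α) r := by
  obtain ⟨s, hs, hs0, ha⟩ := u.2
  refine ⟨algebraMap _ _ (⟨s, hs⟩ : PolyRing α), algebraMap _ _ (⟨_, ha⟩ : PolyRing α), ?_, ?_⟩
  · rw [Ne, ← map_zero (algebraMap (PolyRing α) (ExRing α)), algebraMap_injective.eq_iff]
    exact fun h => hs0 (congrArg Subtype.val h)
  · refine Subtype.ext ?_
    rw [Subring.coe_mul, coe_algebraMap_fracRing, coe_algebraMap_fracRing, toSeries_algebraMap,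
      toSeries_algebraMap]

/-- The series `αₙ / x`. -/
lemma IsRootSequence.exists_X_mul_eq (hα : IsRootSequence α) :
    ∃ β : ℕ → FracRing α, (∀ n, xS α * β n = algebraMap _ _ (rootR α n)) ∧
      ∃ e : ℕ → ℤ, ∀ n, β n = xS α * β (n + 1) ^ 2 + e n := by
  have h (n : ℕ) := exists_eq_xS_mul (u := algebraMap (ExRing α) (FracRing α) (rootR α n)) (by
    rw [coe_algebraMap_fracRing, toSeries_rootR]
    exact constantCoeff_of_mem_sparseSeries (hα.mem n))
  choose β hβ using h
  obtain ⟨e, he⟩ := hα.rootR_eq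
  refine ⟨β, fun n => (hβ n).symm, e, fun n => mul_left_cancel₀ xS_ne_zero ?_⟩
  rw [← hβ, he, map_add, map_pow, hβ, map_mul, map_intCast]
  change _ + _ * xS α = _
  ring

/-- Two ring homomorphisms on `S` agreeing on `R` agree on the elements `αₙ / x`. -/
lemma map_eq_of_eq_mul_sq {T : Type*} [Ring T] {f g : FracRing α →+* T}
    (hfg : ∀ r, f (algebraMap (ExRing α) _ r) = g (algebraMap (ExRing α) _ r))
    {b c : FracRing α} {a : ExRing α} {e : ℤ} (hc : xS α * c = algebraMap _ _ a)
    (hb : b = xS α * c ^ 2 + e) : f b = g b := by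
  have h1 : f c * f (xS α) = g c * g (xS α) := by
    rw [← map_mul, ← map_mul, mul_comm, hc, hfg]
  have h2 : f (xS α) * f c = g (xS α) * g c := by
    rw [← map_mul, ← map_mul, hc, hfg]
  have hx : f (xS α) = g (xS α) := hfg _
  rw [hb, map_add, map_add, map_intCast, map_intCast]
  congr 1
  -- A zigzag, since the target need not be commutative: $xc$ comes from $R$, so one copy of $f(c)$
  -- is exchanged for $g(c)$ on the left of $x$, which frees $x$ to exchange the other.
  calc f (xS α * c ^ 2) = f (xS α) * f c * f c := by simp only [map_mul, pow_two, mul_assoc]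
    _ = g c * g (xS α) * f c := by rw [h2, ← map_mul, mul_comm, map_mul]
    _ = g c * (g (xS α) * g c) := by rw [← hx, mul_assoc, h2, hx]
    _ = g (xS α * c ^ 2) := by
      rw [← map_mul, ← map_mul]
      congr 1
      ring

/-- Two ring homomorphisms on `S` agreeing on `R` are equal. -/
lemma IsRootSequence.map_eq (hα : IsRootSequence α) {T : Type*} [Ring T]
    {f g : FracRing α →+* T}
    (hfg : ∀ r, f (algebraMap (ExRing α) _ r) = g (algebraMap (ExRing α) _ r)) : f = g := by
  obtain ⟨β, hβ, e, he⟩ := hα.exists_X_mul_eq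
  let B : Subring (FracRing α) := Subring.closure (insert (xS α) (Set.range β))
  have hX : xS α ∈ B := Subring.subset_closure (Set.mem_insert _ _)
  have hB : ∀ b ∈ B, f b = g b := by
    intro b hb
    refine RingHom.eqOn_set_closure (f := f) (g := g) ?_ hb
    rintro y (rfl | ⟨n, rfl⟩)
    · exact hfg _
    · exact map_eq_of_eq_mul_sq hfg (hβ (n + 1)) (he n)
  have hdiv : ∀ b ∈ B, ∃ m : ℤ, ∃ v ∈ B, b = m + xS α * v := by
    intro b hb
    induction hb using Subring.closure_induction with
    | mem b hb =>
      rcases hb with rfl | ⟨n, rfl⟩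
      · exact ⟨0, 1, one_mem _, by simp⟩
      · refine ⟨e n, β (n + 1) ^ 2, ?_, by rw [add_comm, ← he]⟩
        exact pow_mem (Subring.subset_closure (Set.mem_insert_of_mem _ (Set.mem_range_self _))) 2
    | zero => exact ⟨0, 0, zero_mem _, by simp⟩
    | one => exact ⟨1, 0, zero_mem _, by simp⟩
    | add a b _ _ iha ihb =>
      obtain ⟨c, v, hv, rfl⟩ := iha
      obtain ⟨c', v', hv', rfl⟩ := ihb
      exact ⟨c + c', v + v', add_mem hv hv', by push_cast; ring⟩
    | neg a _ iha =>
      obtain ⟨c, v, hv, rfl⟩ := iha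
      exact ⟨-c, -v, neg_mem hv, by push_cast; ring⟩
    | mul a b _ _ iha ihb =>
      obtain ⟨c, v, hv, rfl⟩ := iha
      obtain ⟨c', v', hv', rfl⟩ := ihb
      exact ⟨c * c', v * c' + c * v' + xS α * v * v',
        add_mem (add_mem (mul_mem hv (intCast_mem _ _)) (mul_mem (intCast_mem _ _) hv'))
          (mul_mem (mul_mem hX hv) hv'), by push_cast; ring⟩
  -- Elements of `B` are integers modulo $xB$. If $xb\in B$, comparing constant terms makes that
  -- integer even, hence zero in $S$, and $x$ cancels.
  have hdiv' : ∀ b : FracRing α, xS α * b ∈ B → b ∈ B := by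
    intro b hb
    obtain ⟨m, v, hv, h⟩ := hdiv _ hb
    have h1 : ((m : ZMod 2)) = 0 := by
      have h2 := congrArg (fun u : FracRing α => PowerSeries.constantCoeff (u : (ZMod 2)⟦X⟧)) h
      simpa [coe_xS] using h2.symm
    obtain ⟨k, rfl⟩ := (ZMod.intCast_zmod_eq_zero_iff_dvd m 2).1 h1
    have h2 : (2 : FracRing α) = 0 := Subtype.ext two_eq_zero
    rw [Int.cast_mul] at h
    push_cast at h
    rw [h2, zero_mul, zero_add] at h
    rwa [mul_left_cancel₀ xS_ne_zero h]
  have hpow (k : ℕ) : ∀ b : FracRing α, xS α ^ k * b ∈ B → b ∈ B := by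
    induction k with
    | zero => exact fun b hb => by rwa [pow_zero, one_mul] at hb
    | succ k ih => exact fun b hb => ih b (hdiv' _ (by rwa [← mul_assoc, ← pow_succ']))
  have hA (a : PolyRing α) : algebraMap (ExRing α) (FracRing α) (algebraMap _ _ a) ∈ B := by
    obtain ⟨a, ha⟩ := a
    induction ha using Algebra.adjoin_induction with
    | mem a ha =>
      rcases ha with rfl | ⟨n, rfl⟩
      · exact hX
      · change algebraMap _ _ (rootR α n) ∈ B
        rw [← hβ]
        exact mul_mem hX (Subring.subset_closure (Set.mem_insert_of_mem _ ⟨n, rfl⟩))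
    | algebraMap c =>
      obtain ⟨m, rfl⟩ := ZMod.intCast_surjective c
      rw [show (⟨_, _⟩ : PolyRing α) = m from Subtype.ext (by simp), map_intCast, map_intCast]
      exact intCast_mem _ _
    | add a b ha hb iha ihb =>
      have := add_mem iha ihb
      rwa [← map_add, ← map_add] at this
    | mul a b ha hb iha ihb =>
      have := mul_mem iha ihb
      rwa [← map_mul, ← map_mul] at this
  ext u
  obtain ⟨s, hs, hs0, ha⟩ := u.2
  have hs1 : algebraMap (ExRing α) (FracRing α) (algebraMap _ _ (⟨s, hs⟩ : PolyRing α)) ≠ 0 := by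
    intro h
    rw [← map_zero (algebraMap (ExRing α) _), algebraMap_fracRing_injective.eq_iff,
      ← map_zero (algebraMap (PolyRing α) _), algebraMap_injective.eq_iff] at h
    exact hs0 (congrArg Subtype.val h)
  have hmul : algebraMap (ExRing α) (FracRing α) (algebraMap _ _ (⟨s, hs⟩ : PolyRing α)) * u =
      algebraMap _ _ (algebraMap _ _ (⟨_, ha⟩ : PolyRing α)) := Subtype.ext (by
    rw [Subring.coe_mul, coe_algebraMap_fracRing, coe_algebraMap_fracRing, toSeries_algebraMap,
      toSeries_algebraMap])
  -- Dividing numerator and denominator of `u` by the same power of $x$ keeps both in `B` and makes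
  -- the denominator a unit of $S$, so equality on `B` determines the value at `u`.
  obtain ⟨k, b, hb, h⟩ := exists_eq_xS_pow_mul hs1
  have hbB : b ∈ B := hpow k b (h ▸ hA _)
  have hbu : b * u ∈ B := hpow k _ (by rw [← mul_assoc, ← h, hmul]; exact hA _)
  have h1 := hB _ hbu
  rw [map_mul, map_mul, ← hB b hbB] at h1
  exact (hb.map f).mul_left_cancel h1

lemma IsRootSequence.epi (hα : IsRootSequence α) :
    Epi (RingCat.ofHom (algebraMap (ExRing α) (FracRing α))) where
  left_cancellation f g h := by
    ext1
    exact hα.map_eq fun r => DFunLike.congr_fun (congrArg RingCat.Hom.hom h) r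

/-- A flat local homomorphism is faithfully flat, which would give $xS\cap R=xR$; but
$\alpha_0=x\beta_0$ lies in $xS$ and not in $xR$. -/
lemma IsRootSequence.not_flat (hα : IsRootSequence α)
    (h : Transcendental (ZMod 2)[X] (α 0)) : ¬ Module.Flat (ExRing α) (FracRing α) := fun _ => by
  have : Module.FaithfullyFlat (ExRing α) (FracRing α) :=
    Module.FaithfullyFlat.of_flat_of_isLocalHom
  obtain ⟨β, hβ, -⟩ := hα.exists_X_mul_eq
  refine hα.rootR_notMem_span_xR h 0 ?_
  rw [← Ideal.comap_map_eq_self_of_faithfullyFlat (B := FracRing α) (Ideal.span {xR α}),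
    Ideal.mem_comap, Ideal.map_span, Set.image_singleton, Ideal.mem_span_singleton, ← hβ]
  exact ⟨_, rfl⟩

lemma IsRootSequence.not_surjective (hα : IsRootSequence α)
    (h : Transcendental (ZMod 2)[X] (α 0)) :
    ¬ Function.Surjective (algebraMap (ExRing α) (FracRing α)) := fun hs => by
  obtain ⟨β, hβ, -⟩ := hα.exists_X_mul_eq
  obtain ⟨r, hr⟩ := hs (β 0)
  refine hα.rootR_notMem_span_xR h 0 (Ideal.mem_span_singleton.2 ⟨r, ?_⟩)
  apply algebraMap_fracRing_injective
  rw [← hβ, map_mul, hr, xS]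

end EpiRing


section Pseudoflat

open TensorProduct

variable {α : ℕ → (ZMod 2)⟦X⟧}

/-! ### The vanishing of `Tor₁(S, S)` -/

/-- Exactness of a complex is preserved by tensoring with `M` if the inclusion of the next kernel
stays injective. -/
lemma lTensor_exact_of_ker_injective {R : Type*} [CommRing R] (M : Type*) {A B C D : Type*}
    [AddCommGroup M] [Module R M] [AddCommGroup A] [Module R A] [AddCommGroup B] [Module R B]
    [AddCommGroup C] [Module R C] [AddCommGroup D] [Module R D] {f : A →ₗ[R] B} {g : B →ₗ[R] C}
    {k : C →ₗ[R] D} (hfg : Function.Exact f g) (hgk : Function.Exact g k)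
    (hk : Function.Injective ((LinearMap.ker k).subtype.lTensor M)) :
    Function.Exact (f.lTensor M) (g.lTensor M) := by
  let g' : B →ₗ[R] LinearMap.ker k := g.codRestrict _ fun b => (hgk (g b)).2 ⟨b, rfl⟩
  have hg' : Function.Surjective g' := fun ⟨c, hc⟩ => by
    obtain ⟨b, rfl⟩ := (hgk c).1 hc
    exact ⟨b, rfl⟩
  have hfg' : Function.Exact f g' := fun b => by
    rw [← hfg b, ← Subtype.val_inj]
    rfl
  have h := lTensor_exact M hfg' hg'
  have hg : g = (LinearMap.ker k).subtype.comp g' := rfl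
  intro t
  rw [← h t, hg, LinearMap.lTensor_comp_apply, ← map_zero ((LinearMap.ker k).subtype.lTensor M), hk.eq_iff]

lemma IsRootSequence.exists_rootR_eq (hα : IsRootSequence α) (n k : ℕ) :
    ∃ c d, rootR α n = c * rootR α (n + k) + d * xR α := by
  obtain ⟨e, he⟩ := hα.rootR_eq
  induction k with
  | zero => exact ⟨1, 0, by simp⟩
  | succ k ih =>
    obtain ⟨c, d, h⟩ := ih
    refine ⟨c * rootR α (n + (k + 1)), c * e (n + k) + d, ?_⟩
    rw [h, he (n + k), add_assoc n k 1]
    ring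

lemma IsRootSequence.exists_eq_of_mem_maximalIdeal (hα : IsRootSequence α) {r : ExRing α}
    (hr : r ∈ IsLocalRing.maximalIdeal (ExRing α)) :
    ∃ (n : ℕ) (p q : ExRing α), r = p * xR α + q * rootR α n := by
  rw [hα.maximalIdeal_eq] at hr
  induction hr using Submodule.span_induction with
  | mem r hr =>
    rcases hr with rfl | ⟨n, rfl⟩
    · exact ⟨0, 1, 0, by simp⟩
    · exact ⟨n, 0, 1, by simp⟩
  | zero => exact ⟨0, 0, 0, by simp⟩
  | add a b _ _ iha ihb =>
    obtain ⟨n, p, q, rfl⟩ := iha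
    obtain ⟨m, p', q', rfl⟩ := ihb
    obtain ⟨c, d, h⟩ := hα.exists_rootR_eq n m
    obtain ⟨c', d', h'⟩ := hα.exists_rootR_eq m n
    rw [add_comm m n] at h'
    refine ⟨n + m, p + p' + q * d + q' * d', q * c + q' * c', ?_⟩
    rw [h, h']
    ring
  | smul c a _ ih =>
    obtain ⟨n, p, q, rfl⟩ := ih
    exact ⟨n, c * p, c * q, by rw [smul_eq_mul]; ring⟩

/-- If `x`, `αₙ` act like a regular sequence on `Z` for all `n`, then `𝔪 ⊗ Z → Z` is injective. -/
lemma IsRootSequence.rTensor_injective (hα : IsRootSequence α) {N Z : Type*} [AddCommGroup N]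
    [Module (ExRing α) N] [AddCommGroup Z] [Module (ExRing α) Z] (f : N →ₗ[ExRing α] ExRing α)
    (hf : Function.Injective f) (hr : LinearMap.range f = IsLocalRing.maximalIdeal (ExRing α))
    (h0 : ∀ z : Z, xR α • z = 0 → z = 0)
    (h1 : ∀ (n : ℕ) (z z' : Z), rootR α n • z = xR α • z' → ∃ y, z = xR α • y) :
    Function.Injective (f.rTensor Z) := by
  obtain ⟨X, hX⟩ : xR α ∈ LinearMap.range f := hr ▸ xR_mem
  have hA (n : ℕ) : rootR α n ∈ LinearMap.range f := hr ▸ hα.rootR_mem n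
  choose A hA using hA
  -- The maximal ideal is the directed union of the ideals $(x,\alpha_n)$, so two pure tensors
  -- suffice.
  have key (t : N ⊗[ExRing α] Z) : ∃ (n : ℕ) (y z : Z), t = X ⊗ₜ y + A n ⊗ₜ z := by
    induction t with
    | zero => exact ⟨0, 0, 0, by simp⟩
    | tmul v z =>
      have hv : f v ∈ IsLocalRing.maximalIdeal (ExRing α) := hr ▸ ⟨v, rfl⟩
      obtain ⟨n, p, q, h⟩ := hα.exists_eq_of_mem_maximalIdeal hv
      have : v = p • X + q • A n := hf (by simp [h, hX, hA])
      exact ⟨n, p • z, q • z, by rw [this, add_tmul, smul_tmul, smul_tmul]⟩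
    | add s t ihs iht =>
      obtain ⟨n, y, z, rfl⟩ := ihs
      obtain ⟨m, y', z', rfl⟩ := iht
      obtain ⟨c, d, h⟩ := hα.exists_rootR_eq n m
      obtain ⟨c', d', h'⟩ := hα.exists_rootR_eq m n
      rw [add_comm m n] at h'
      have e1 : A n = c • A (n + m) + d • X := hf (by simp [h, hX, hA])
      have e2 : A m = c' • A (n + m) + d' • X := hf (by simp [h', hX, hA])
      refine ⟨n + m, y + y' + d • z + d' • z', c • z + c' • z', ?_⟩
      rw [e1, e2]
      simp only [add_tmul, tmul_add, smul_tmul]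
      abel
  rw [injective_iff_map_eq_zero]
  intro t ht
  obtain ⟨n, y, z, rfl⟩ := key t
  have h2 : xR α • y + rootR α n • z = 0 := by
    have := congrArg (TensorProduct.lid (ExRing α) Z) ht
    simpa [hX, hA] using this
  -- Regularity forces $(y,z)$ to be a multiple of the Koszul relation $(-\alpha_n,x)$, which is
  -- already zero in the tensor product.
  obtain ⟨w, rfl⟩ := h1 n z (-y) (by rw [smul_neg, eq_neg_iff_add_eq_zero, add_comm, h2])
  have h3 : y + rootR α n • w = 0 := h0 _ (by rw [smul_add, smul_comm, h2])
  have h4 : xR α • A n = rootR α n • X := hf (by simp [hX, hA, mul_comm])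
  rw [← smul_tmul, h4, smul_tmul, ← tmul_add, h3, tmul_zero]

/-- Multiplication by `x` is injective on `S ⊗ Z`. -/
lemma IsRootSequence.eq_zero_of_xR_smul (hα : IsRootSequence α) {Z : Type*}
    [AddCommGroup Z] [Module (ExRing α) Z]
    (h0 : ∀ z : Z, xR α • z = 0 → z = 0)
    (h1 : ∀ (n : ℕ) (z z' : Z), rootR α n • z = xR α • z' → ∃ y, z = xR α • y)
    {w : FracRing α ⊗[ExRing α] Z} (hw : xR α • w = 0) : w = 0 := by
  -- The map $(r,u)\mapsto r+xu$ is onto, and projection to $R$ identifies its kernel with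
  -- $\mathfrak m=R\cap xS$. If $xw=0$, then $(0,w)$ comes from $\mathfrak m\otimes Z$; its image in
  -- $R\otimes Z$ is zero, so `rTensor_injective` gives $w=0$.
  let p : ExRing α × FracRing α →ₗ[ExRing α] FracRing α :=
    (Algebra.linearMap (ExRing α) (FracRing α)).coprod (xR α • LinearMap.id)
  have hp (r : ExRing α) (u : FracRing α) : p (r, u) = algebraMap _ _ r + xS α * u := by
    simp [p, Algebra.smul_def, xS]
  have hps : Function.Surjective p := fun u => by
    obtain ⟨r, v, h⟩ := exists_eq_algebraMap_add u
    exact ⟨(r, v), by rw [hp, h]⟩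
  let i := (LinearMap.ker p).subtype
  have hex : Function.Exact i p := p.exact_subtype_ker_map
  have hinj : Function.Injective ((LinearMap.fst (ExRing α) (ExRing α) (FracRing α)).comp i) := by
    rw [injective_iff_map_eq_zero]
    rintro ⟨⟨r, u⟩, hu⟩ (rfl : r = 0)
    rw [LinearMap.mem_ker, hp, map_zero, zero_add] at hu
    obtain rfl := (mul_eq_zero.1 hu).resolve_left xS_ne_zero
    rfl
  have hrange : LinearMap.range ((LinearMap.fst (ExRing α) (ExRing α) (FracRing α)).comp i) =
      IsLocalRing.maximalIdeal (ExRing α) := by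
    ext r
    rw [mem_maximalIdeal_iff, PowerSeries.X_dvd_iff, ← coe_algebraMap_fracRing]
    constructor
    · rintro ⟨⟨⟨r, u⟩, hu⟩, rfl⟩
      change PowerSeries.constantCoeff (algebraMap (ExRing α) (FracRing α) r : (ZMod 2)⟦X⟧) = 0
      rw [LinearMap.mem_ker, hp] at hu
      rw [eq_neg_of_add_eq_zero_left hu, NegMemClass.coe_neg, Subring.coe_mul, coe_xS]
      simp
    · intro hr
      obtain ⟨v, hv⟩ := exists_eq_xS_mul hr
      refine ⟨⟨(r, -v), ?_⟩, rfl⟩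
      rw [LinearMap.mem_ker, hp, hv]
      ring
  have hI := hα.rTensor_injective _ hinj hrange h0 h1
  have hexT := rTensor_exact Z hex hps
  obtain ⟨t, ht⟩ := (hexT ((LinearMap.inr (ExRing α) (ExRing α) (FracRing α)).rTensor Z w)).1 (by
    rw [← LinearMap.rTensor_comp_apply, LinearMap.coprod_inr, LinearMap.rTensor_smul,
      LinearMap.smul_apply, LinearMap.rTensor_id_apply, hw])
  have ht0 : t = 0 := hI (by
    rw [LinearMap.rTensor_comp_apply, ht, ← LinearMap.rTensor_comp_apply, LinearMap.fst_comp_inr,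
      LinearMap.rTensor_zero, LinearMap.zero_apply, map_zero])
  have := congrArg ((LinearMap.snd (ExRing α) (ExRing α) (FracRing α)).rTensor Z) ht
  rwa [ht0, map_zero, map_zero, ← LinearMap.rTensor_comp_apply, LinearMap.snd_comp_inr,
    LinearMap.rTensor_id_apply, eq_comm] at this

lemma exists_smul_eq_one_tmul {Z : Type*} [AddCommGroup Z] [Module (ExRing α) Z]
    (t : FracRing α ⊗[ExRing α] Z) :
    ∃ (s : ExRing α) (z : Z), s ≠ 0 ∧ s • t = (1 : FracRing α) ⊗ₜ[ExRing α] z := by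
  induction t with
  | zero => exact ⟨1, 0, one_ne_zero, by simp⟩
  | tmul u z =>
    obtain ⟨s, r, hs, h⟩ := exists_algebraMap_mul_eq u
    exact ⟨s, r • z, hs, by
      rw [smul_tmul', Algebra.smul_def, h, Algebra.algebraMap_eq_smul_one, smul_tmul]⟩
  | add a b iha ihb =>
    obtain ⟨s, z, hs, h⟩ := iha
    obtain ⟨s', z', hs', h'⟩ := ihb
    refine ⟨s * s', s' • z + s • z', mul_ne_zero hs hs', ?_⟩
    rw [smul_add, mul_comm s s', mul_smul, h, mul_comm s' s, mul_smul, h', tmul_add, tmul_smul,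
      tmul_smul]

/-- By the equational criterion the relation in $F$ comes from relations in $R$, where $\alpha_n$ is
regular modulo $x$. -/
lemma exists_smul_eq_of_flat {F : Type*} [AddCommGroup F] [Module (ExRing α) F]
    [Module.Flat (ExRing α) F] (hα : IsRootSequence α)
    (h : Transcendental (ZMod 2)[X] (α 0)) (n : ℕ) {z z' : F}
    (hz : rootR α n • z = xR α • z') : ∃ y, z = xR α • y := by
  obtain ⟨k, a, y, hy, ha⟩ := Module.Flat.isTrivialRelation_of_sum_smul_eq_zero
    (f := ![rootR α n, -xR α]) (x := ![z, z']) (by simp [Fin.sum_univ_two, hz])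
  have h1 (j : Fin k) : ∃ b, a 0 j = xR α * b := by
    rw [← dvd_def, ← Ideal.mem_span_singleton]
    refine hα.mem_span_xR_of_rootR_mul h n (Ideal.mem_span_singleton.2 ⟨a 1 j, ?_⟩)
    have := ha j
    simp only [Fin.sum_univ_two, Matrix.cons_val_zero, Matrix.cons_val_one] at this
    linear_combination this
  choose b hb using h1
  refine ⟨∑ j, b j • y j, ?_⟩
  rw [Finset.smul_sum]
  refine (hy 0).trans (Finset.sum_congr rfl fun j _ => ?_)
  rw [hb, mul_smul]

lemma eq_zero_of_one_tmul_eq_zero {F : Type*} [AddCommGroup F] [Module (ExRing α) F]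
    [Module.Flat (ExRing α) F] {z : F} (hz : (1 : FracRing α) ⊗ₜ[ExRing α] z = 0) : z = 0 := by
  have h1 := Module.Flat.rTensor_preserves_injective_linearMap (M := F)
    (Algebra.linearMap (ExRing α) (FracRing α)) algebraMap_fracRing_injective
  have h2 : (1 : ExRing α) ⊗ₜ[ExRing α] z = 0 := h1 (by simpa using hz)
  simpa using congrArg (TensorProduct.lid (ExRing α) F) h2

/-- The kernel of a map from a flat module to an `x`-torsion-free module stays a submodule after
tensoring with `S`. -/
lemma IsRootSequence.lTensor_ker_injective (hα : IsRootSequence α)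
    (h : Transcendental (ZMod 2)[X] (α 0)) {F T : Type*} [AddCommGroup F] [Module (ExRing α) F]
    [Module.Flat (ExRing α) F] [AddCommGroup T] [Module (ExRing α) T] (g : F →ₗ[ExRing α] T)
    (hT : ∀ t : T, xR α • t = 0 → t = 0) :
    Function.Injective ((LinearMap.ker g).subtype.lTensor (FracRing α)) := by
  have h0F (z : F) (hz : xR α • z = 0) : z = 0 := by
    have := (Module.Flat.isSMulRegular_of_nonZeroDivisors
      (mem_nonZeroDivisors_of_ne_zero (xR_ne_zero (α := α))) : IsSMulRegular F _)
    exact this (by simpa using hz)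
  have h0 (z : LinearMap.ker g) (hz : xR α • z = 0) : z = 0 :=
    Subtype.ext (h0F z (congrArg Subtype.val hz))
  have h1 (n : ℕ) (z z' : LinearMap.ker g) (hz : rootR α n • z = xR α • z') :
      ∃ y, z = xR α • y := by
    obtain ⟨y, hy⟩ := exists_smul_eq_of_flat hα h n (congrArg Subtype.val hz)
    -- The quotient of `z` by $x$ found in $F$ stays in the kernel because the target has no
    -- $x$-torsion.
    refine ⟨⟨y, hT _ ?_⟩, Subtype.ext hy⟩
    rw [← map_smul, ← hy]
    exact z.2
  rw [injective_iff_map_eq_zero]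
  intro t ht
  -- After clearing denominators `t` becomes $1\otimes z$, which is detected in $F$ by flatness, so
  -- $st=0$. In $S$ the scalar $s$ is a power of $x$ times a unit, and $x$ acts injectively.
  obtain ⟨s, z, hs, hz⟩ := exists_smul_eq_one_tmul t
  have h2 : (z : F) = 0 := eq_zero_of_one_tmul_eq_zero (α := α) (by
    have := congrArg ((LinearMap.ker g).subtype.lTensor (FracRing α)) hz
    rwa [map_smul, ht, smul_zero, LinearMap.lTensor_tmul, Submodule.subtype_apply,
      eq_comm] at this)
  obtain rfl : z = 0 := Subtype.ext h2
  rw [tmul_zero, ← algebraMap_smul (FracRing α)] at hz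
  have hs' : algebraMap (ExRing α) (FracRing α) s ≠ 0 := fun h =>
    hs (algebraMap_fracRing_injective (h.trans (map_zero _).symm))
  obtain ⟨k, u, hu, hk⟩ := exists_eq_xS_pow_mul hs'
  rw [hk, mul_smul] at hz
  have h3 (k : ℕ) (w : FracRing α ⊗[ExRing α] LinearMap.ker g) (hw : xS α ^ k • w = 0) :
      w = 0 := by
    induction k with
    | zero => rwa [pow_zero, one_smul] at hw
    | succ k ih =>
      refine ih (hα.eq_zero_of_xR_smul h0 h1 ?_)
      rwa [pow_succ', mul_smul, xS, algebraMap_smul] at hw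
  exact (hu.smul_eq_zero).1 (h3 k _ hz)

/-- In a projective resolution of $S$, exactness at degree 1 after tensoring only requires the first
syzygy to remain a submodule of $S\otimes P_0$. The augmentation lands in $S$, which is
$x$-torsion-free, so `lTensor_ker_injective` applies. -/
lemma IsRootSequence.isZero_tor (hα : IsRootSequence α)
    (h : Transcendental (ZMod 2)[X] (α 0)) :
    IsZero (((Tor (ModuleCat.{0} (ExRing α)) 1).obj (ModuleCat.of (ExRing α) (FracRing α))).obj
      (ModuleCat.of (ExRing α) (FracRing α))) := by
  let C := ModuleCat.{0} (ExRing α)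
  let M : C := ModuleCat.of (ExRing α) (FracRing α)
  obtain ⟨P⟩ := (inferInstance : HasProjectiveResolution M).out
  refine IsZero.of_iso ?_ (P.isoLeftDerivedObj ((MonoidalCategory.tensoringLeft C).obj M) 1)
  refine (HomologicalComplex.exactAt_iff_isZero_homology _ 1).1 ?_
  rw [HomologicalComplex.exactAt_iff' _ 2 1 0 (by simp) (by simp),
    ShortComplex.ShortExact.moduleCat_exact_iff_function_exact]
  have : Module.Projective (ExRing α) (P.complex.X 0) :=
    (IsProjective.iff_projective _).2 (P.projective 0)
  let g : P.complex.X 0 →ₗ[ExRing α] M := (P.π.f 0).hom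
  let d₁ : P.complex.X 1 →ₗ[ExRing α] P.complex.X 0 := (P.complex.d 1 0).hom
  let d₂ : P.complex.X 2 →ₗ[ExRing α] P.complex.X 1 := (P.complex.d 2 1).hom
  have e₂ : Function.Exact d₂ d₁ :=
    (ShortComplex.ShortExact.moduleCat_exact_iff_function_exact _).1 (P.exact_succ 0)
  have e₁ : Function.Exact d₁ g :=
    (ShortComplex.ShortExact.moduleCat_exact_iff_function_exact _).1 P.exact₀
  have hinj := hα.lTensor_ker_injective h g fun (t : FracRing α) ht => by
    rw [Algebra.smul_def] at ht
    exact (mul_eq_zero.1 ht).resolve_left xS_ne_zero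
  exact lTensor_exact_of_ker_injective (FracRing α) e₂ e₁ hinj

end Pseudoflat

end TelescopeExample

end

theorem mainTheorem10 :
    -- a starting series which is transcendental over the polynomial ring exists
    (∃ a ∈ TelescopeExample.sparseSeries, Transcendental (ZMod 2)[X] a) ∧
    -- every starting series determines a unique sequence of iterated square roots
    (∀ a ∈ TelescopeExample.sparseSeries,
      ∃! α : ℕ → (ZMod 2)⟦X⟧, α 0 = a ∧ TelescopeExample.IsRootSequence α) ∧
    -- the properties of the ring `R` attached to any such sequence
    ∀ α : ℕ → (ZMod 2)⟦X⟧, TelescopeExample.IsRootSequence α →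
      Transcendental (ZMod 2)[X] (α 0) →
      -- the ideal at which one localizes is `(x, αₙ : n ≥ 0)`, and it is maximal
      TelescopeExample.centerIdeal α =
        Ideal.span (insert (TelescopeExample.xElt α)
          (Set.range (TelescopeExample.rootElt α))) ∧
      (TelescopeExample.centerIdeal α).IsMaximal ∧
      -- `R` is a local subring of the power series ring
      (∃ j : TelescopeExample.ExRing α →+* (ZMod 2)⟦X⟧,
        (∀ a : TelescopeExample.PolyRing α,
          j (algebraMap (TelescopeExample.PolyRing α) (TelescopeExample.ExRing α) a) = a) ∧
        Function.Injective j ∧ IsLocalHom j) ∧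
      -- `R` is a separated local integral domain
      IsDomain (TelescopeExample.ExRing α) ∧
      IsLocalRing (TelescopeExample.ExRing α) ∧
      (⨅ n : ℕ, IsLocalRing.maximalIdeal (TelescopeExample.ExRing α) ^ n) = ⊥ ∧
      -- `R/(x)` is local and its maximal ideal is non-zero and idempotent
      (∃ _ : IsLocalRing
          (TelescopeExample.ExRing α ⧸ Ideal.span {TelescopeExample.xR α}),
        IsLocalRing.maximalIdeal
          (TelescopeExample.ExRing α ⧸ Ideal.span {TelescopeExample.xR α}) ≠ ⊥ ∧
        IsIdempotentElem (IsLocalRing.maximalIdeal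
          (TelescopeExample.ExRing α ⧸ Ideal.span {TelescopeExample.xR α}))) ∧
      -- the telescope properties fail
      ¬ TelescopeExample.SatisfiesRTC (TelescopeExample.ExRing α) ∧
      ¬ TelescopeExample.SatisfiesTC (TelescopeExample.ExRing α) ∧
      -- a non-flat, non-surjective, pseudoflat local ring epimorphism
      ∃ (S : Type) (_ : CommRing S) (_ : Algebra (TelescopeExample.ExRing α) S),
        IsLocalRing S ∧
        IsLocalHom (algebraMap (TelescopeExample.ExRing α) S) ∧
        TelescopeExample.IsPseudoflatEpi (TelescopeExample.ExRing α) S ∧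
        ¬ Module.Flat (TelescopeExample.ExRing α) S ∧
        ¬ Function.Surjective (algebraMap (TelescopeExample.ExRing α) S) := by
  refine ⟨TelescopeExample.exists_transcendental_mem_sparseSeries,
    fun a ha => TelescopeExample.existsUnique_isRootSequence ha, fun α hα h => ?_⟩
  have hRTC : ¬ TelescopeExample.SatisfiesRTC (TelescopeExample.ExRing α) := by
    obtain ⟨e, he⟩ := hα.rootR_eq
    exact TelescopeExample.not_satisfiesRTC
      (mem_nonZeroDivisors_of_ne_zero TelescopeExample.xR_ne_zero)
      TelescopeExample.two_ExRing_eq_zero he (hα.rootR_one_notMem h)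
  exact ⟨hα.centerIdeal_eq, TelescopeExample.centerIdeal_isMaximal,
    ⟨TelescopeExample.toSeries α, TelescopeExample.toSeries_algebraMap,
      TelescopeExample.toSeries_injective, inferInstance⟩,
    inferInstance, inferInstance, TelescopeExample.iInf_maximalIdeal_pow, hα.quotient_local h,
    hRTC, fun hTC => hRTC hTC.satisfiesRTC,
    TelescopeExample.FracRing α, inferInstance, inferInstance, inferInstance, inferInstance,
    ⟨hα.epi, hα.isZero_tor h⟩, hα.not_flat h, hα.not_surjective h⟩
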